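/- Let $\operatorname{Sym}$ be the $\mathbb R$-algebra of symmetric functions, with power sums $p_k$ and $p_\rho=p_{\rho_1}p_{\rho_2}\cdots$ for a partition $\rho$, and let $\operatorname{Sym}^{\mathscr E}$ and $\operatorname{Sym}^{\mathscr O}$ be the linear subspaces spanned by the homogeneous elements of even and of odd degree. For $t\in(-1,0)$ and a partition $\lambda$ put $\widetilde Q_\lambda(;t)=(-1)^{n(\lambda)}Q_\lambda(;t)$, where $Q_\lambda(;t)=b_\lambda(t)P_\lambda(;t)$ is the Hall–Littlewood $Q$-function, $b_\lambda(t)=\prod_{i\ge1}\prod_{1\le j\le m_i(\lambda)}(1-t^j)$, $m_i(\lambda)$ is the number of parts of $\lambda$ equal to $i$, and $n(\lambda)=\sum_{i\ge1}(i-1)\lambda_i$. There are unique linear functionals $\Phi_{\mathscr E}:\operatorname{Sym}^{\mathscr E}\to\mathbb R$ and $\Phi_{\mathscr O}:\operatorname{Sym}^{\mathscr O}\to\mathbb R$ such that, for $|\rho|$ even, $\Phi_{\mathscr E}(p_\rho)=1$ if $\rho=(2^n)$ for some $n\ge0$ and $\Phi_{\mathscr E}(p_\rho)=0$ otherwise,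 and, for $|\rho|$ odd, $\Phi_{\mathscr O}(p_\rho)=1$ if $\rho=(2^n,1)$ for some $n\ge0$ and $\Phi_{\mathscr O}(p_\rho)=0$ otherwise. They have the following properties. (a) ($p_2$-harmonicity) $\Phi_{\mathscr E}(p_2F)=\Phi_{\mathscr E}(F)$ for all $F\in\operatorname{Sym}^{\mathscr E}$ and $\Phi_{\mathscr O}(p_2F)=\Phi_{\mathscr O}(F)$ for all $F\in\operatorname{Sym}^{\mathscr O}$. (b) (Positivity) For every $t\in(-1,0)$, $\Phi_{\mathscr E}(\widetilde Q_\lambda(;t))>0$ for all $\lambda$ with $|\lambda|$ even, and $\Phi_{\mathscr O}(\widetilde Q_\lambda(;t))>0$ for all $\lambda$ with $|\lambda|$ odd. In particular $\Phi_{\mathscr E}$ (resp. $\Phi_{\mathscr O}$) is nonnegative on the convex cone spanned by the $\widetilde Q_\lambda(;t)$ with $|\lambda|$ even (resp. odd). (c) (The associated measures) Let $q$ be a power of an odd prime and let $\bar x=x^q$ for $x\in\mathbb F_{q^2}$. Let $I=\mathbb Z\setminus\{0\}$ in the even case and $I=\mathbb Z$ in the odd case. Call a matrix $M=[m_{ij}]$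 over $\mathbb F_{q^2}$, with indices in a subset of $I$ that is symmetric about $0$, skew-Hermitian if $m_{-b,-a}=-\overline{m_{a,b}}$ for all $a,b$. For $n\ge0$ let $\mathbb L_n$ be the group of skew-Hermitian $I\times I$ matrices with $m_{ij}=0$ whenever $i\ge j$ and $\max\{|i|,|j|\}>n$. Let $\mathbb L=\bigcup_n\mathbb L_n$, with the group topology in which the subgroups $\mathbb L_{-n}=\{M\in\mathbb L_0: m_{ij}=0\text{ if }|i|,|j|\le n\}$ form a base of neighbourhoods of $0$. Let $M^{[n]}=[m_{ij}]_{|i|,|j|\le n}$, a matrix of order $N$, where $N=2n$ in the even case and $N=2n+1$ in the odd case, and for a skew-Hermitian matrix $X$ of this format let $\operatorname{Cyl}_n(X)=\{M\in\mathbb L_n: M^{[n]}=X\}$. Let $G$ ($=U(2\infty,q^2)$ or $U(2\infty+1,q^2)$) be the group of $I\times I$ matrices over $\mathbb F_{q^2}$ that differ from the identity matrix in finitely many entries and preserve the Hermitian form with $\tau(e_a,e_b)=\delta_{a,-b}$; it acts on $\mathbb L$ by conjugation. Then, with $\Phi=\Phi_{\mathscr E}$ in the even case and $\Phi=\Phi_{\mathscr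 O}$ in the odd case, there is a unique $G$-invariant Borel measure $P$ on $\mathbb L$ that is finite on compact sets, is supported on the pronilpotent matrices (those $M$ for which, for some $n$, $M\in\mathbb L_n$ and $M^{[n]}$ is nilpotent), and satisfies $$P(\operatorname{Cyl}_n(X))=\frac{q^{\,n(\lambda)-N(N-1)/2}}{(1-q^{-2})^{N/2}}\;\Phi\bigl(\widetilde Q_\lambda(;-q^{-1})\bigr)$$ for all $n\ge0$ and every nilpotent skew-Hermitian $X$ of order $N$ with Jordan type $\lambda$. These measures are the analogues of the Plancherel measure for the unitary groups. -/

import Mathlib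

noncomputable section

namespace HLUnitary

/-! ### The algebra of symmetric functions -/

/-- The `ℝ`-algebra `Sym` of symmetric functions: formal power series in the variables
`x₀, x₁, x₂, …` that have bounded degree and are invariant under permutations of the variables. -/
def Sym : Subalgebra ℝ (MvPowerSeries ℕ ℝ) where
  carrier := {f | (∀ σ : Equiv.Perm ℕ, MvPowerSeries.renameEquiv ℝ σ f = f) ∧
    ∃ N : ℕ, ∀ d : ℕ →₀ ℕ, MvPowerSeries.coeff d f ≠ 0 → d.degree ≤ N}
  mul_mem' := by
    rintro f g ⟨hf, M, hM⟩ ⟨hg, N, hN⟩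
    refine ⟨fun σ => by rw [map_mul, hf, hg], M + N, fun d hd => ?_⟩
    classical
    rw [MvPowerSeries.coeff_mul] at hd
    obtain ⟨p, hp, hne⟩ := Finset.exists_ne_zero_of_sum_ne_zero hd
    rw [← Finset.HasAntidiagonal.mem_antidiagonal.mp hp, map_add]
    exact Nat.add_le_add (hM _ (left_ne_zero_of_mul hne)) (hN _ (right_ne_zero_of_mul hne))
  add_mem' := by
    rintro f g ⟨hf, M, hM⟩ ⟨hg, N, hN⟩
    refine ⟨fun σ => by rw [map_add, hf, hg], max M N, fun d hd => ?_⟩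
    by_cases h : MvPowerSeries.coeff d f = 0
    · refine le_max_of_le_right (hN d fun h' => hd ?_)
      rw [map_add, h, h', add_zero]
    · exact le_max_of_le_left (hM d h)
  algebraMap_mem' r := by
    refine ⟨fun σ => AlgEquiv.commutes _ r, 0, fun d hd => ?_⟩
    by_contra h
    classical
    rw [MvPowerSeries.algebraMap_apply, MvPowerSeries.coeff_C] at hd
    split_ifs at hd with h0
    · simp [h0] at h
    · exact hd rfl

/-- The homogeneous symmetric functions of degree `k`. -/
def symHom (k : ℕ) : Submodule ℝ Sym where
  carrier := {f | ∀ d : ℕ →₀ ℕ, MvPowerSeries.coeff d (f : MvPowerSeries ℕ ℝ) ≠ 0 → d.degree = k}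
  add_mem' := by
    intro f g hf hg d hd
    by_cases h : MvPowerSeries.coeff d (f : MvPowerSeries ℕ ℝ) = 0
    · refine hg d fun h' => hd ?_
      rw [Subalgebra.coe_add, map_add, h, h', add_zero]
    · exact hf d h
  zero_mem' := by
    intro d hd
    simp at hd
  smul_mem' := by
    intro c f hf d hd
    refine hf d fun h => hd ?_
    rw [Subalgebra.coe_smul, map_smul, h, smul_zero]

theorem mul_mem_symHom {a b : ℕ} {f g : Sym} (hf : f ∈ symHom a) (hg : g ∈ symHom b) :
    f * g ∈ symHom (a + b) := by
  intro d hd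
  classical
  rw [Subalgebra.coe_mul, MvPowerSeries.coeff_mul] at hd
  obtain ⟨p, hp, hne⟩ := Finset.exists_ne_zero_of_sum_ne_zero hd
  rw [← Finset.HasAntidiagonal.mem_antidiagonal.mp hp, map_add, hf _ (left_ne_zero_of_mul hne),
    hg _ (right_ne_zero_of_mul hne)]

theorem one_mem_symHom : (1 : Sym) ∈ symHom 0 := by
  intro d hd
  classical
  rw [Subalgebra.coe_one, MvPowerSeries.coeff_one] at hd
  split_ifs at hd with h0
  · simp [h0]
  · exact absurd rfl hd

open Classical in
/-- The power sum `∑ᵢ xᵢ ^ k` as a power series (used for `k ≥ 1`). -/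
def psumSeries (k : ℕ) : MvPowerSeries ℕ ℝ :=
  fun d => if ∃ i : ℕ, d = Finsupp.single i k then 1 else 0

theorem coeff_psumSeries_ne_zero {k : ℕ} {d : ℕ →₀ ℕ}
    (h : MvPowerSeries.coeff d (psumSeries k) ≠ 0) : ∃ i : ℕ, d = Finsupp.single i k := by
  by_contra h'
  exact h (if_neg h')

theorem psumSeries_mem (k : ℕ) : psumSeries k ∈ Sym := by
  refine ⟨fun σ => ?_, k, fun d hd => ?_⟩
  · ext d
    obtain ⟨e, rfl⟩ : ∃ e : ℕ →₀ ℕ, d = e.embDomain σ.toEmbedding :=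
      ⟨d.embDomain σ.symm.toEmbedding, by
        rw [Finsupp.embDomain_eq_mapDomain, Finsupp.embDomain_eq_mapDomain,
          ← Finsupp.mapDomain_comp]
        simp [Finsupp.mapDomain_id]⟩
    have h1 : MvPowerSeries.coeff (e.embDomain σ.toEmbedding)
        (MvPowerSeries.renameEquiv ℝ σ (psumSeries k)) = MvPowerSeries.coeff e (psumSeries k) :=
      MvPowerSeries.coeff_embDomain_rename σ.toEmbedding (psumSeries k) e
    rw [h1]
    have h2 : (∃ i : ℕ, e = Finsupp.single i k) ↔
        ∃ i : ℕ, e.embDomain σ.toEmbedding = Finsupp.single i k := by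
      constructor
      · rintro ⟨i, rfl⟩
        exact ⟨σ i, by rw [Finsupp.embDomain_single]; rfl⟩
      · rintro ⟨i, hi⟩
        refine ⟨σ.symm i, Finsupp.embDomain_injective σ.toEmbedding ?_⟩
        rw [hi, Finsupp.embDomain_single]
        simp
    classical
    exact if_congr h2 rfl rfl
  · obtain ⟨i, rfl⟩ := coeff_psumSeries_ne_zero hd
    simp

/-- The power sum `p_k ∈ Sym`. -/
def psum (k : ℕ) : Sym := ⟨psumSeries k, psumSeries_mem k⟩

theorem psum_mem_symHom (k : ℕ) : psum k ∈ symHom k := by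
  intro d hd
  obtain ⟨i, rfl⟩ := coeff_psumSeries_ne_zero hd
  simp

/-- `p_ρ = p_{ρ₁} p_{ρ₂} ⋯`. -/
def psumProd {N : ℕ} (ρ : Nat.Partition N) : Sym := (ρ.parts.map psum).prod

theorem psumProd_mem_symHom {N : ℕ} (ρ : Nat.Partition N) : psumProd ρ ∈ symHom N := by
  have h : ∀ s : Multiset ℕ, (s.map psum).prod ∈ symHom s.sum := by
    intro s
    induction s using Multiset.induction_on with
    | empty => simpa using one_mem_symHom
    | cons a s ih =>
      rw [Multiset.map_cons, Multiset.prod_cons, Multiset.sum_cons]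
      exact mul_mem_symHom (psum_mem_symHom a) ih
  have h' := h ρ.parts
  rwa [ρ.parts_sum] at h'

/-! In what follows the parity is recorded by `ε : Fin 2`: `ε = 0` is the even case and
`ε = 1` is the odd case, so that `N = 2 * n + ε`. -/

/-- `Sym^E` (for `ε = 0`) and `Sym^O` (for `ε = 1`): the linear subspaces of `Sym` spanned by the
homogeneous elements of even, respectively odd, degree. -/
def SymPar (ε : Fin 2) : Submodule ℝ Sym := ⨆ n : ℕ, symHom (2 * n + ε)

theorem symHom_le_symPar (ε : Fin 2) (n : ℕ) : symHom (2 * n + ε) ≤ SymPar ε :=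
  le_iSup (fun n : ℕ => symHom (2 * n + ε)) n

theorem psum_two_mul_mem (ε : Fin 2) {F : Sym} (hF : F ∈ SymPar ε) : psum 2 * F ∈ SymPar ε := by
  have h : SymPar ε ≤ (SymPar ε).comap (LinearMap.mulLeft ℝ (psum 2)) := by
    refine iSup_le fun n f hf => ?_
    refine symHom_le_symPar ε (n + 1) ?_
    have h' := mul_mem_symHom (psum_mem_symHom 2) hf
    have e : 2 + (2 * n + (ε : ℕ)) = 2 * (n + 1) + ε := by ring
    rw [e] at h'
    exact h'
  exact h hF

/-- `p_ρ` as an element of `Sym^E` or `Sym^O`. -/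
def psumPar (ε : Fin 2) {n : ℕ} (ρ : Nat.Partition (2 * n + ε)) : SymPar ε :=
  ⟨psumProd ρ, symHom_le_symPar ε n (psumProd_mem_symHom ρ)⟩

/-- `p₂ F` for `F` in `Sym^E` or `Sym^O`. -/
def pTwoMul (ε : Fin 2) (F : SymPar ε) : SymPar ε :=
  ⟨psum 2 * F, psum_two_mul_mem ε F.2⟩

/-! ### Hall–Littlewood functions -/

/-- The Hall–Littlewood polynomial `P_lam(x₁, …, x_m; t)` as a rational function:
the sum, over all distinct rearrangements `α` of `(lam₁, …, lam_m)`, of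
`x ^ α * ∏_{α i > α j} (x i - t * x j) / (x i - x j)`
(it is zero if `lam` has more than `m` parts). -/
def hlFrac (t : ℝ) {N : ℕ} (lam : Nat.Partition N) (m : ℕ) :
    FractionRing (MvPolynomial (Fin m) ℝ) :=
  ∑ α : Fin m → Fin (N + 1),
    if ((Finset.univ.val.map fun i => (α i : ℕ)).filter fun k => k ≠ 0) = lam.parts then
      (∏ i, algebraMap (MvPolynomial (Fin m) ℝ) (FractionRing (MvPolynomial (Fin m) ℝ))
          (MvPolynomial.X i ^ (α i : ℕ))) *
        ∏ i, ∏ j, if α j < α i then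
          algebraMap (MvPolynomial (Fin m) ℝ) (FractionRing (MvPolynomial (Fin m) ℝ))
              (MvPolynomial.X i - MvPolynomial.C t * MvPolynomial.X j) /
            algebraMap (MvPolynomial (Fin m) ℝ) (FractionRing (MvPolynomial (Fin m) ℝ))
              (MvPolynomial.X i - MvPolynomial.X j)
          else 1
    else 0

/-- `f` is the Hall–Littlewood function `P_lam(; t)`: for each `m`, setting all variables except
the first `m` ones equal to zero turns `f` into the polynomial `P_lam(x₁, …, x_m; t)`. -/
def IsHallLittlewoodP (t : ℝ) {N : ℕ} (lam : Nat.Partition N) (f : Sym) : Prop :=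
  ∀ m : ℕ, ∃ g : MvPolynomial (Fin m) ℝ,
    algebraMap (MvPolynomial (Fin m) ℝ) (FractionRing (MvPolynomial (Fin m) ℝ)) g
        = hlFrac t lam m ∧
      (g : MvPowerSeries (Fin m) ℝ) =
        MvPowerSeries.killCompl Fin.valEmbedding (f : MvPowerSeries ℕ ℝ)

/-- The function `P_lam(; t)` is unique. -/
theorem IsHallLittlewoodP.unique {t : ℝ} {N : ℕ} {lam : Nat.Partition N} {f f' : Sym}
    (hf : IsHallLittlewoodP t lam f) (hf' : IsHallLittlewoodP t lam f') : f = f' := by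
  apply Subtype.ext
  ext d
  obtain ⟨m, hm⟩ : ∃ m : ℕ, ∀ i ∈ d.support, i < m :=
    ⟨d.support.sup id + 1, fun i hi => Nat.lt_succ_of_le (Finset.le_sup (f := id) hi)⟩
  obtain ⟨g, hg, hgf⟩ := hf m
  obtain ⟨g', hg', hgf'⟩ := hf' m
  have hgg : g = g' :=
    IsFractionRing.injective (MvPolynomial (Fin m) ℝ) (FractionRing (MvPolynomial (Fin m) ℝ))
      (hg.trans hg'.symm)
  obtain ⟨e, rfl⟩ : ∃ e : Fin m →₀ ℕ, d = e.embDomain Fin.valEmbedding := by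
    refine ⟨d.comapDomain Fin.valEmbedding (Fin.valEmbedding.injective.injOn), ?_⟩
    rw [Finsupp.embDomain_comapDomain]
    intro i hi
    exact ⟨⟨i, hm i hi⟩, rfl⟩
  rw [← MvPowerSeries.coeff_killCompl, ← MvPowerSeries.coeff_killCompl, ← hgf, ← hgf', hgg]

/-- The Hall–Littlewood function `P_lam(; t)`, a homogeneous symmetric function of degree `|lam|`:
the unique element of `Sym` that reduces to `P_lam(x₁, …, x_m; t)` for each `m`. -/
def hallLittlewoodP (t : ℝ) {N : ℕ} (lam : Nat.Partition N) : symHom N :=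
  Classical.epsilon fun f : symHom N => IsHallLittlewoodP t lam (f : Sym)

/-- `b_lam(t) = ∏_{i ≥ 1} ∏_{1 ≤ j ≤ m_i(lam)} (1 - t ^ j)`. -/
def bCoeff (t : ℝ) {N : ℕ} (lam : Nat.Partition N) : ℝ :=
  ∏ i ∈ lam.parts.toFinset, ∏ j ∈ Finset.Icc 1 (lam.parts.count i), (1 - t ^ j)

/-- `n(lam) = ∑_{i ≥ 1} (i - 1) * lam_i`, the parts being listed in decreasing order. -/
def nStat {N : ℕ} (lam : Nat.Partition N) : ℕ :=
  ∑ i ∈ Finset.range lam.parts.card, i * (lam.parts.sort (· ≥ ·)).getD i 0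

/-- `Q_lam(; t) = b_lam(t) * P_lam(; t)`. -/
def hallLittlewoodQ (t : ℝ) {N : ℕ} (lam : Nat.Partition N) : symHom N :=
  bCoeff t lam • hallLittlewoodP t lam

/-- `Q̃_lam(; t) = (-1) ^ n(lam) * Q_lam(; t)`. -/
def qTilde (t : ℝ) {N : ℕ} (lam : Nat.Partition N) : symHom N :=
  (-1 : ℝ) ^ nStat lam • hallLittlewoodQ t lam

/-- `Q̃_lam(; t)` as an element of `Sym^E` or `Sym^O`. -/
def qTildePar (t : ℝ) (ε : Fin 2) {n : ℕ} (lam : Nat.Partition (2 * n + ε)) : SymPar ε :=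
  ⟨qTilde t lam, symHom_le_symPar ε n (qTilde t lam).2⟩

/-- The convex cone in `Sym^E` or `Sym^O` spanned by the functions `Q̃_lam(; t)`. -/
def hlCone (t : ℝ) (ε : Fin 2) : Submodule NNReal (SymPar ε) :=
  Submodule.span NNReal
    {F | ∃ (n : ℕ) (lam : Nat.Partition (2 * n + ε)), F = qTildePar t ε lam}

/-- `Φ` takes the value `1` on `p_ρ` if `ρ = (2ⁿ)` (even case), respectively `ρ = (2ⁿ, 1)`
(odd case), and the value `0` on all other `p_ρ`. -/
def IsPlancherelFunctional (ε : Fin 2) (Φ : SymPar ε →ₗ[ℝ] ℝ) : Prop :=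
  ∀ (n : ℕ) (ρ : Nat.Partition (2 * n + ε)),
    Φ (psumPar ε ρ) =
      if ρ.parts = Multiset.replicate n 2 + Multiset.replicate (ε : ℕ) 1 then 1 else 0

/-! ### Infinite skew-Hermitian matrices over a finite field with `q ^ 2` elements

The conjugation of the field `K` with `q ^ 2` elements is `x ↦ x ^ q`. -/

/-- The index set `ℤ ∖ {0}` (for `ε = 0`) or `ℤ` (for `ε = 1`). -/
def Idx (ε : Fin 2) : Type := {i : ℤ // i = 0 → ε = 1}

instance (ε : Fin 2) : DecidableEq (Idx ε) :=
  inferInstanceAs (DecidableEq {i : ℤ // i = 0 → ε = 1})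

instance (ε : Fin 2) : Neg (Idx ε) := ⟨fun i => ⟨-i.1, fun h => i.2 (neg_eq_zero.mp h)⟩⟩

/-- The central block of indices `i` with `|i| ≤ n`; it has `2 * n + ε` elements. -/
def Blk (ε : Fin 2) (n : ℕ) : Type := {i : Idx ε // |i.1| ≤ (n : ℤ)}

instance (ε : Fin 2) (n : ℕ) : DecidableEq (Blk ε n) :=
  inferInstanceAs (DecidableEq {i : Idx ε // |i.1| ≤ (n : ℤ)})

instance (ε : Fin 2) (n : ℕ) : Finite (Blk ε n) :=
  Finite.of_injective (fun i : Blk ε n => (⟨i.1.1, abs_le.mp i.2⟩ : Set.Icc (-(n : ℤ)) n))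
    fun _ _ h => Subtype.ext (Subtype.ext (congrArg (fun x : Set.Icc (-(n : ℤ)) n => x.1) h))

instance (ε : Fin 2) (n : ℕ) : Fintype (Blk ε n) := Fintype.ofFinite _

instance (ε : Fin 2) (n : ℕ) : Neg (Blk ε n) := ⟨fun i => ⟨-i.1, (abs_neg i.1.1).trans_le i.2⟩⟩

/-- A matrix `X` is skew-Hermitian (with respect to the Hermitian form whose matrix has `1`'s on
the secondary diagonal) if `X (-b) (-a) = - conj (X a b)`. -/
def IsSkewHermitian (q : ℕ) {K : Type*} [Field K] {ι : Type*} [Neg ι] (X : Matrix ι ι K) : Prop :=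
  ∀ a b : ι, X (-b) (-a) = -(X a b) ^ q

/-- The set `L_n`: skew-Hermitian infinite matrices `M` with `M i j = 0` whenever `i ≥ j` and
`max |i| |j| > n`. -/
def LSet (ε : Fin 2) (q : ℕ) (K : Type*) [Field K] (n : ℕ) : Set (Matrix (Idx ε) (Idx ε) K) :=
  {M | IsSkewHermitian q M ∧
    ∀ i j : Idx ε, j.1 ≤ i.1 → (n : ℤ) < max |i.1| |j.1| → M i j = 0}

/-- The space `L = ⋃ₙ L_n` of almost strictly upper triangular skew-Hermitian matrices. -/
def LSpace (ε : Fin 2) (q : ℕ) (K : Type*) [Field K] : Type _ :=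
  {M : Matrix (Idx ε) (Idx ε) K // ∃ n : ℕ, M ∈ LSet ε q K n}

/-- `M' - M` belongs to the subgroup `L_{-n} ⊆ L_0` of matrices whose central block
`|i|, |j| ≤ n` is zero. -/
def LClose {ε : Fin 2} {q : ℕ} {K : Type*} [Field K] (n : ℕ) (M M' : LSpace ε q K) : Prop :=
  M'.1 - M.1 ∈ LSet ε q K 0 ∧
    ∀ i j : Idx ε, |i.1| ≤ (n : ℤ) → |j.1| ≤ (n : ℤ) → M'.1 i j = M.1 i j

/-- The group topology on `L` for which the subgroups `L_{-n}` form a fundamental system of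
neighbourhoods of `0`. -/
instance (ε : Fin 2) (q : ℕ) (K : Type*) [Field K] : TopologicalSpace (LSpace ε q K) where
  IsOpen U := ∀ M ∈ U, ∃ n : ℕ, ∀ M' : LSpace ε q K, LClose n M M' → M' ∈ U
  isOpen_univ := fun _ _ => ⟨0, fun _ _ => Set.mem_univ _⟩
  isOpen_inter := by
    intro U V hU hV M hM
    obtain ⟨a, ha⟩ := hU M hM.1
    obtain ⟨b, hb⟩ := hV M hM.2
    have hle : ∀ {c : ℕ}, c ≤ max a b → ∀ {i : ℤ}, |i| ≤ (c : ℤ) → |i| ≤ ((max a b : ℕ) : ℤ) :=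
      fun h _ hi => hi.trans (by exact_mod_cast h)
    refine ⟨max a b, fun M' h => ⟨ha M' ⟨h.1, fun i j hi hj => ?_⟩, hb M' ⟨h.1, fun i j hi hj => ?_⟩⟩⟩
    · exact h.2 i j (hle (le_max_left a b) hi) (hle (le_max_left a b) hj)
    · exact h.2 i j (hle (le_max_right a b) hi) (hle (le_max_right a b) hj)
  isOpen_sUnion := by
    intro S hS M hM
    obtain ⟨U, hU, hMU⟩ := hM
    obtain ⟨n, hn⟩ := hS U hU M hMU
    exact ⟨n, fun M' h => ⟨U, hU, hn M' h⟩⟩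

instance (ε : Fin 2) (q : ℕ) (K : Type*) [Field K] : MeasurableSpace (LSpace ε q K) :=
  borel (LSpace ε q K)

instance (ε : Fin 2) (q : ℕ) (K : Type*) [Field K] : BorelSpace (LSpace ε q K) := ⟨rfl⟩

/-- The central block `M^[n]` with index set `{i : |i| ≤ n}`. -/
def corner {ε : Fin 2} {q : ℕ} {K : Type*} [Field K] (n : ℕ) (M : LSpace ε q K) :
    Matrix (Blk ε n) (Blk ε n) K :=
  fun i j => M.1 i.1 j.1

/-- The elementary cylinder set `Cyl_n(X) = {M ∈ L_n : M^[n] = X}`. -/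
def cyl {ε : Fin 2} (q : ℕ) {K : Type*} [Field K] (n : ℕ) (X : Matrix (Blk ε n) (Blk ε n) K) :
    Set (LSpace ε q K) :=
  {M | M.1 ∈ LSet ε q K n ∧ corner n M = X}

/-- The set of pronilpotent matrices: `M ∈ L_n` and `M^[n]` is nilpotent, for some `n`. -/
def pronilpotent (ε : Fin 2) (q : ℕ) (K : Type*) [Field K] : Set (LSpace ε q K) :=
  {M | ∃ n : ℕ, M.1 ∈ LSet ε q K n ∧ IsNilpotent (corner n M)}

/-- The infinite unitary group `U(2∞, q²)` (for `ε = 0`) or `U(2∞+1, q²)` (for `ε = 1`), as a set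
of matrices: all but finitely many entries of `g` coincide with those of the identity matrix, and
`τ (g e_a) (g e_b) = τ e_a e_b` for the Hermitian form with `τ e_a e_b = 1` if `a = -b` and
`τ e_a e_b = 0` otherwise. -/
def infUnitary (ε : Fin 2) (q : ℕ) (K : Type*) [Field K] : Set (Matrix (Idx ε) (Idx ε) K) :=
  {g | {p : Idx ε × Idx ε | g p.1 p.2 ≠ (1 : Matrix (Idx ε) (Idx ε) K) p.1 p.2}.Finite ∧
    ∀ a b : Idx ε, ∑ᶠ r : Idx ε, g r a * (g (-r) b) ^ q = if a = -b then 1 else 0}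

/-- `M' = g M g⁻¹`, written as `M' g = g M`. All sums are finite for `g` in the infinite unitary
group. -/
def IsConjBy {ε : Fin 2} {q : ℕ} {K : Type*} [Field K] (g : Matrix (Idx ε) (Idx ε) K)
    (M M' : LSpace ε q K) : Prop :=
  ∀ i j : Idx ε, ∑ᶠ k : Idx ε, M'.1 i k * g k j = ∑ᶠ k : Idx ε, g i k * M.1 k j

/-- The measure `P` on `L` is invariant under conjugation by the infinite unitary group:
`P (g A g⁻¹) = P A` for every Borel set `A`. -/
def IsUnitarilyInvariant {ε : Fin 2} {q : ℕ} {K : Type*} [Field K]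
    (P : MeasureTheory.Measure (LSpace ε q K)) : Prop :=
  ∀ g ∈ infUnitary ε q K, ∀ A : Set (LSpace ε q K), MeasurableSet A →
    P {M' | ∃ M ∈ A, IsConjBy g M M'} = P A

/-- The nilpotent matrix `X` has Jordan type `lam`, i.e. its Jordan blocks have lengths
`lam₁, lam₂, …`: a nilpotent Jordan block of length `p` contributes `min p k` to the dimension of
the kernel of `X ^ k`, and these dimensions determine the lengths of the blocks. -/
def HasJordanType {K : Type*} [Field K] {ι : Type*} [Fintype ι] [DecidableEq ι] {N : ℕ}
    (X : Matrix ι ι K) (lam : Nat.Partition N) : Prop :=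
  IsNilpotent X ∧ ∀ k : ℕ,
    Module.finrank K (LinearMap.ker (Matrix.toLin' (X ^ k))) =
      (lam.parts.map fun p => min p k).sum

end HLUnitary

end

/-! The power sums are free generators of Sym, so Sym is identified with the polynomial ring `Lam`,
in which `X n` stands for p_{n+1}. There Φ_E is the specialization p_2 = 1, p_k = 0 for k ≠ 2, and
Φ_O is the same specialization applied after ∂/∂p_1. Existence, uniqueness and p_2-harmonicity are
then immediate.

The working tool for Hall–Littlewood functions is Jing's vertex operator B_r (`jing`): Q_λ = B_{λ_1}
B_{λ_2} ⋯ 1, written `word` in terms of multiplicities. This is checked against the definition of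
P_λ by evaluation in finitely many variables (`evalVars_word`). Quadratic relations between the B_r,
together with their commutators with p_2 and with ∂/∂p_2, give explicit expansions of ∂Q_λ/∂p_2
(`pderiv_word`) and of p_2 Q_λ (`X_mul_word`) in the functions Q_μ. In both, either one part changes
by 2, or two equal parts both change by 1.

Positivity. In degree 2n+ε one has Φ(∂F/∂p_2) = n Φ(F). In the expansion of ∂Q_λ/∂p_2 the sign of
each coefficient for t in (-1,0) is the ratio of (-1)^{n(λ)} and (-1)^{n(μ)}; induction on the
degree gives (-1)^{n(λ)} Φ(Q_λ) > 0.

Measures. The relation Φ(p_2 Q_λ) = Φ(Q_λ) at t = -1/q, rewritten for the proposed masses of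
cylinders, says that the mass of a cylinder is a weighted sum of the masses of types of order N+2
(`cylMass_eq_sum`). The weights are numbers of skew-Hermitian extensions: bordering a nilpotent X by
a column y and a corner entry z changes the Jordan type in a way that depends on the first a with y
in Im X + Ker X^{a+1} and on whether the form τ(y, X^a y) vanishes. Counting isotropic vectors of
Hermitian forms over a finite field (`card_isotropic`) shows that the weights agree
(`sum_extendEnd`), so the masses are additive under refinement of cylinders.

Cylinders are compact and open, form a countable basis, and any two are nested or disjoint. The
Riesz–Markov theorem applied to a limit of finite sums gives a measure with the prescribed masses,
and a π-system argument gives uniqueness. Invariance holds because conjugation by g permutes the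
cylinders of high level and preserves the Jordan type of the central block. -/

noncomputable section

namespace HLUnitary

open MvPolynomial

/-! ### The generating series of the one-row functions q_r -/

section Series

variable {R : Type*} [CommRing R] [Algebra ℝ R]

/-- The coefficients of `exp (∑ₙ (1 - t ^ n) pₙ uⁿ / n)`, where `p k` stands for `p_{k+1}`. -/
def hlCoeff (t : ℝ) (p : ℕ → R) : ℕ → R
  | 0 => 1
  | r + 1 => ((r : ℝ) + 1)⁻¹ • ∑ k : Fin (r + 1), (1 - t ^ ((k : ℕ) + 1)) • (p k * hlCoeff t p (r - k))

theorem hlCoeff_zero (t : ℝ) (p : ℕ → R) : hlCoeff t p 0 = 1 := by rw [hlCoeff]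

theorem hlCoeff_succ (t : ℝ) (p : ℕ → R) (r : ℕ) :
    ((r : ℝ) + 1) • hlCoeff t p (r + 1) =
      ∑ k ∈ Finset.range (r + 1), (1 - t ^ (k + 1)) • (p k * hlCoeff t p (r - k)) := by
  rw [hlCoeff, smul_smul, mul_inv_cancel₀ (by positivity), one_smul,
    Fin.sum_univ_eq_sum_range (fun k => (1 - t ^ (k + 1)) • (p k * hlCoeff t p (r - k)))]

/-- The generating function of `hlCoeff t p`. -/
def hlSeries (t : ℝ) (p : ℕ → R) : PowerSeries R := PowerSeries.mk (hlCoeff t p)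

/-- The logarithmic derivative of `hlSeries t p`. -/
def hlLog (t : ℝ) (p : ℕ → R) : PowerSeries R := PowerSeries.mk fun n => (1 - t ^ (n + 1)) • p n

/-- The recursion that defines `hlCoeff` is this differential equation read off coefficientwise. It
replaces the exponential formula throughout. -/
theorem derivative_hlSeries (t : ℝ) (p : ℕ → R) :
    PowerSeries.derivative R (hlSeries t p) = hlLog t p * hlSeries t p := by
  ext n
  rw [PowerSeries.coeff_derivative, PowerSeries.coeff_mul,
    Finset.Nat.sum_antidiagonal_eq_sum_range_succ_mk]
  simp only [hlSeries, hlLog, PowerSeries.coeff_mk]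
  have h := hlCoeff_succ t p n
  simp only [← smul_mul_assoc] at h
  rw [← h, Algebra.smul_def, mul_comm]
  simp

/-- A linear first-order equation determines the coefficient of index n+1 from the lower ones, as
n+1 is invertible. Identities between generating series are proved below by checking that both sides
solve the same equation with the same constant term. -/
theorem eq_zero_of_derivative_eq_mul {f P : PowerSeries R}
    (h : PowerSeries.derivative R f = P * f) (h0 : PowerSeries.coeff 0 f = 0) : f = 0 := by
  ext n
  induction n using Nat.strong_induction_on with
  | _ n ih =>
    cases n with
    | zero => simpa using h0
    | succ n =>
      have h1 := congrArg (PowerSeries.coeff n) h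
      rw [PowerSeries.coeff_derivative, PowerSeries.coeff_mul,
        Finset.sum_eq_zero] at h1
      · have h2 : ((n : ℝ) + 1) • PowerSeries.coeff (n + 1) f = 0 := by
          rw [Algebra.smul_def, mul_comm]
          simpa using h1
        have h3 := congrArg (fun x => ((n : ℝ) + 1)⁻¹ • x) h2
        simp only [smul_smul, smul_zero] at h3
        rwa [inv_mul_cancel₀ (by positivity), one_smul] at h3
      · intro x hx
        rw [ih x.2 (by have := Finset.HasAntidiagonal.mem_antidiagonal.mp hx; omega)]
        simp

theorem one_sub_mul_geom {R : Type*} [CommRing R] (z : R) :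
    (1 - PowerSeries.C z * PowerSeries.X) * PowerSeries.mk (fun n => z ^ n) = 1 := by
  ext n
  cases n with
  | zero => simp
  | succ n =>
    rw [sub_mul, one_mul, mul_assoc, map_sub, PowerSeries.coeff_C_mul,
      PowerSeries.coeff_succ_X_mul]
    simp [PowerSeries.coeff_one, pow_succ']

/-- Replacing every `pₙ` by `pₙ - zⁿ` multiplies the series by `(1 - z u) / (1 - t z u)`. -/
theorem hlSeries_sub (t : ℝ) (p p' : ℕ → R) (z : R) (hp : ∀ n, p' n = p n - z ^ (n + 1)) :
    (1 - PowerSeries.C (t • z) * PowerSeries.X) * hlSeries t p' =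
      (1 - PowerSeries.C z * PowerSeries.X) * hlSeries t p := by
  set G : PowerSeries R := PowerSeries.mk fun n => z ^ n with hG
  set H : PowerSeries R := PowerSeries.mk fun n => (t • z) ^ n with hH
  have h1 : (1 - PowerSeries.C z * PowerSeries.X) * G = 1 := one_sub_mul_geom z
  have h2 : (1 - PowerSeries.C (t • z) * PowerSeries.X) * H = 1 := one_sub_mul_geom (t • z)
  have hlog : hlLog t p' = hlLog t p - PowerSeries.C z * G + PowerSeries.C (t • z) * H := by
    ext n
    simp only [hlLog, hG, hH, map_add, map_sub, PowerSeries.coeff_mk, PowerSeries.coeff_C_mul, hp]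
    simp only [Algebra.smul_def, mul_pow, map_sub, map_pow, map_one]
    ring
  have d1 : PowerSeries.derivative R (1 - PowerSeries.C z * PowerSeries.X : PowerSeries R) =
      -PowerSeries.C z := by
    rw [map_sub, Derivation.leibniz]
    simp
  have d2 : PowerSeries.derivative R (1 - PowerSeries.C (t • z) * PowerSeries.X : PowerSeries R) =
      -PowerSeries.C (t • z) := by
    rw [map_sub, Derivation.leibniz]
    simp
  -- Both sides have the logarithmic derivative `hlLog t p` - z / (1 - z u).
  refine sub_eq_zero.mp (eq_zero_of_derivative_eq_mul
    (P := hlLog t p - PowerSeries.C z * G) ?_ ?_)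
  · rw [map_sub, Derivation.leibniz, Derivation.leibniz, d1, d2, derivative_hlSeries,
      derivative_hlSeries, hlog]
    simp only [smul_eq_mul]
    linear_combination (PowerSeries.C (t • z) * hlSeries t p') * h2 -
      (PowerSeries.C z * hlSeries t p) * h1
  · simp [hlSeries, hlCoeff_zero]

theorem hlSeries_zero (t : ℝ) : hlSeries t (fun _ => (0 : R)) = 1 := by
  refine sub_eq_zero.mp (eq_zero_of_derivative_eq_mul (P := 0) ?_ ?_)
  · rw [map_sub, derivative_hlSeries]
    have : hlLog t (fun _ => (0 : R)) = 0 := by ext n; simp [hlLog]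
    simp [this]
  · simp [hlSeries, hlCoeff_zero]

/-- A derivation of the coefficients commutes with d/du, so the equation f' = P f may be
differentiated coefficientwise. It serves for ∂/∂p_2 and for the Euler derivation. -/
theorem derivative_derivation (d : Derivation ℝ R R) {f P : PowerSeries R}
    (h : PowerSeries.derivative R f = P * f) :
    PowerSeries.derivative R (PowerSeries.mk fun n => d (PowerSeries.coeff n f)) =
      (PowerSeries.mk fun n => d (PowerSeries.coeff n P)) * f +
        P * PowerSeries.mk fun n => d (PowerSeries.coeff n f) := by
  ext n
  have h1 := congrArg d (congrArg (PowerSeries.coeff n) h)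
  rw [PowerSeries.coeff_derivative, PowerSeries.coeff_mul, map_sum, Derivation.leibniz] at h1
  rw [PowerSeries.coeff_derivative, PowerSeries.coeff_mk, map_add, PowerSeries.coeff_mul,
    PowerSeries.coeff_mul, ← Finset.sum_add_distrib]
  have h2 : d ((n : R) + 1) = 0 := by
    rw [map_add, Derivation.map_natCast, Derivation.map_one_eq_zero, add_zero]
  rw [h2, smul_zero, zero_add, smul_eq_mul, mul_comm] at h1
  rw [h1]
  refine Finset.sum_congr rfl fun x _ => ?_
  simp only [Derivation.leibniz, PowerSeries.coeff_mk, smul_eq_mul]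
  ring

theorem map_hlCoeff {S : Type*} [CommRing S] [Algebra ℝ S] (f : R →ₐ[ℝ] S) (t : ℝ) (p : ℕ → R)
    (n : ℕ) : f (hlCoeff t p n) = hlCoeff t (fun k => f (p k)) n := by
  induction n using Nat.strong_induction_on with
  | _ n ih =>
    cases n with
    | zero => simp [hlCoeff_zero]
    | succ n =>
      rw [hlCoeff, hlCoeff, map_smul, map_sum]
      congr 1
      refine Finset.sum_congr rfl fun k _ => ?_
      rw [map_smul, map_mul, ih _ (by omega)]

end Series

/-! ### Jing's vertex operators on polynomials in the power sums -/

/-- The polynomial ring in the power sums; the variable `X n` stands for `p_{n+1}`. -/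
abbrev Lam : Type := MvPolynomial ℕ ℝ

/-- `q_r(; t)` for an integer `r`, as a polynomial in the power sums. -/
def qFun (t : ℝ) (r : ℤ) : Lam := if 0 ≤ r then hlCoeff t X r.toNat else 0

theorem qFun_natCast (t : ℝ) (r : ℕ) : qFun t r = hlCoeff t X r := by simp [qFun]

theorem qFun_neg (t : ℝ) {r : ℤ} (h : r < 0) : qFun t r = 0 := by simp [qFun, not_le.mpr h]

theorem qFun_zero (t : ℝ) : qFun t 0 = 1 := by simp [qFun, hlCoeff_zero]

/-- The substitution `pₙ ↦ pₙ - zⁿ`. -/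
def shiftHom : Lam →ₐ[ℝ] Polynomial Lam :=
  aeval fun n => Polynomial.C (X n) - Polynomial.X ^ (n + 1)

theorem shiftHom_X (n : ℕ) :
    shiftHom (X n) = Polynomial.C (X n) - Polynomial.X ^ (n + 1) := aeval_X _ _

/-- This is the coefficient of u^s in `hlSeries_sub`, with z the polynomial variable. -/
theorem shiftHom_qFun (t : ℝ) (s : ℤ) :
    shiftHom (qFun t s) - t • (Polynomial.X * shiftHom (qFun t (s - 1))) =
      Polynomial.C (qFun t s) - Polynomial.X * Polynomial.C (qFun t (s - 1)) := by
  rcases lt_or_ge s 0 with hs | hs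
  · simp [qFun_neg t hs, qFun_neg t (show s - 1 < 0 by omega)]
  obtain ⟨n, rfl⟩ := Int.eq_ofNat_of_zero_le hs
  have key := congrArg (PowerSeries.coeff n) (hlSeries_sub t (fun k => Polynomial.C (X k : Lam))
    (fun k => shiftHom (X k)) Polynomial.X fun n => shiftHom_X n)
  have e1 : ∀ k : ℕ, hlCoeff t (fun k => shiftHom (X k)) k = shiftHom (hlCoeff t X k) :=
    fun k => (map_hlCoeff shiftHom t X k).symm
  have e2 : ∀ k : ℕ, hlCoeff t (fun k => (Polynomial.C (X k : Lam))) k =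
      Polynomial.C (hlCoeff t X k) := fun k =>
    (map_hlCoeff (Algebra.ofId Lam (Polynomial Lam) |>.restrictScalars ℝ) t X k).symm
  rw [sub_mul, sub_mul, one_mul, one_mul, mul_assoc, mul_assoc, map_sub, map_sub,
    PowerSeries.coeff_C_mul, PowerSeries.coeff_C_mul] at key
  cases n with
  | zero =>
    simp only [hlSeries, PowerSeries.coeff_mk, PowerSeries.coeff_zero_X_mul, mul_zero, sub_zero,
      e1, e2] at key
    simp [qFun_neg t (show (-1 : ℤ) < 0 by omega), qFun_zero]
  | succ n =>
    simp only [hlSeries, PowerSeries.coeff_mk, PowerSeries.coeff_succ_X_mul, e1, e2] at key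
    have : ((n + 1 : ℕ) : ℤ) - 1 = (n : ℕ) := by push_cast; ring
    rw [this, qFun_natCast, qFun_natCast, ← smul_mul_assoc]
    exact key

/-- The functional `zᵏ F ↦ q_{r+k} F`. -/
def qPair (t : ℝ) (r : ℤ) : Polynomial Lam →ₗ[ℝ] Lam :=
  Polynomial.lsum fun k => LinearMap.mulLeft ℝ (qFun t (r + k))

theorem qPair_monomial (t : ℝ) (r : ℤ) (k : ℕ) (F : Lam) :
    qPair t r (Polynomial.monomial k F) = qFun t (r + k) * F := by
  rw [qPair, Polynomial.lsum_apply, Polynomial.sum_monomial_index]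
  · simp
  · simp

theorem qPair_X_pow_mul (t : ℝ) (r : ℤ) (n : ℕ) (G : Polynomial Lam) :
    qPair t r (Polynomial.X ^ n * G) = qPair t (r + n) G := by
  induction G using Polynomial.induction_on' with
  | add p q hp hq => rw [mul_add, map_add, map_add, hp, hq]
  | monomial k F =>
    rw [Polynomial.X_pow_mul_monomial, qPair_monomial, qPair_monomial]
    congr 2
    push_cast
    ring

theorem qPair_C_mul (t : ℝ) (r : ℤ) (F : Lam) (G : Polynomial Lam) :
    qPair t r (Polynomial.C F * G) = F * qPair t r G := by
  induction G using Polynomial.induction_on' with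
  | add p q hp hq => rw [mul_add, map_add, map_add, hp, hq, mul_add]
  | monomial k F' =>
    rw [Polynomial.C_mul_monomial, qPair_monomial, qPair_monomial]
    ring

/-- Jing's vertex operator `B_r`, which satisfies `Q_{(r, λ)} = B_r Q_λ`. -/
def jing (t : ℝ) (r : ℤ) : Lam →ₗ[ℝ] Lam := qPair t r ∘ₗ shiftHom.toLinearMap

theorem jing_apply (t : ℝ) (r : ℤ) (F : Lam) : jing t r F = qPair t r (shiftHom F) := rfl

theorem jing_one (t : ℝ) (r : ℤ) : jing t r 1 = qFun t r := by
  rw [jing_apply, map_one, ← Polynomial.monomial_zero_one, qPair_monomial]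
  simp

theorem jing_C (t : ℝ) (r : ℤ) (c : ℝ) : jing t r (C c) = c • qFun t r := by
  rw [← jing_one, ← map_smul, smul_eq_C_mul, mul_one]

/-- The substitution turns p_{n+1} into p_{n+1} - z^{n+1}, and a power of z raises the index of the
operator. Together with `jing_one` this determines B_r; the identities for B_r below are proved from
it by induction on F. -/
theorem jing_X_mul (t : ℝ) (r : ℤ) (n : ℕ) (F : Lam) :
    jing t r (X n * F) = X n * jing t r F - jing t (r + n + 1) F := by
  rw [jing_apply, map_mul, shiftHom_X, sub_mul, map_sub, qPair_C_mul, qPair_X_pow_mul, jing_apply,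
    jing_apply]
  push_cast
  rw [add_assoc]

theorem X_mul_jing (t : ℝ) (r : ℤ) (n : ℕ) (F : Lam) :
    X n * jing t r F = jing t r (X n * F) + jing t (r + n + 1) F := by
  rw [jing_X_mul, sub_add_cancel]

/-- The image of `shiftHom_qFun` under `qPair`. The right side changes sign when r and s are
exchanged, which is the case F = 1 of `jing_comm`. -/
theorem jing_qFun (t : ℝ) (r s : ℤ) :
    jing t (r - 1) (qFun t s) - t • jing t r (qFun t (s - 1)) =
      qFun t s * qFun t (r - 1) - qFun t (s - 1) * qFun t r := by
  have h := congrArg (qPair t (r - 1)) (shiftHom_qFun t s)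
  rw [map_sub, map_sub, map_smul] at h
  have e : ∀ (u : ℤ) (G : Polynomial Lam), qPair t (u - 1) (Polynomial.X * G) = qPair t u G := by
    intro u G
    have := qPair_X_pow_mul t (u - 1) 1 G
    simpa using this
  have e' : ∀ (u : ℤ) (F : Lam), qPair t u (Polynomial.C F) = F * qFun t u := by
    intro u F
    rw [← Polynomial.monomial_zero_left, qPair_monomial, mul_comm]
    simp
  rw [e, e, e', e'] at h
  exact h

/-- Multiplying F by p_{n+1} replaces the relation for (r, s) by p_{n+1} times itself minus the
relations for (r+n+1, s) and (r, s+n+1), so it propagates from constants to all of `Lam`. -/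
theorem jing_comm (t : ℝ) (r s : ℤ) (F : Lam) :
    jing t (r - 1) (jing t s F) - t • jing t r (jing t (s - 1) F) =
      t • jing t s (jing t (r - 1) F) - jing t (s - 1) (jing t r F) := by
  induction F using MvPolynomial.induction_on generalizing r s with
  | C c =>
    simp only [jing_C, map_smul]
    have h1 := jing_qFun t r s
    have h2 := jing_qFun t s r
    simp only [smul_eq_C_mul] at h1 h2 ⊢
    linear_combination C c * h1 + C c * h2
  | add p q hp hq =>
    simp only [map_add, smul_add]
    have h1 := hp r s
    have h2 := hq r s
    linear_combination h1 + h2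
  | mul_X p n hp =>
    rw [mul_comm p]
    simp only [jing_X_mul, map_sub, smul_sub]
    have h1 := hp r s
    have h2 := hp (r + n + 1) s
    have h3 := hp r (s + n + 1)
    have e : ∀ a : ℤ, a + n + 1 - 1 = a - 1 + n + 1 := fun a => by ring
    rw [e] at h2 h3
    simp only [smul_eq_C_mul] at h1 h2 h3 ⊢
    linear_combination X n * h1 - h2 - h3

/-- For r = s the commutation relation says that the difference of the two sides equals its own
negative. -/
theorem jing_swap_one (t : ℝ) (s : ℤ) (F : Lam) :
    jing t (s - 1) (jing t s F) = t • jing t s (jing t (s - 1) F) := by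
  have h := jing_comm t s s F
  have h2 : (2 : ℝ) • (jing t (s - 1) (jing t s F) - t • jing t s (jing t (s - 1) F)) = 0 := by
    rw [two_smul]
    linear_combination h
  exact sub_eq_zero.mp ((smul_eq_zero_iff_right two_ne_zero).mp h2)

/-- The commutation relation for (s+1, s). Indices at distance two can be sorted at the cost of a
term in which both are equal to the middle index; this is where pairs of equal parts come from. -/
theorem jing_swap_two (t : ℝ) (s : ℤ) (F : Lam) :
    jing t (s - 1) (jing t (s + 1) F) =
      t • jing t (s + 1) (jing t (s - 1) F) + (t - 1) • jing t s (jing t s F) := by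
  have h := jing_comm t (s + 1) s F
  rw [add_sub_cancel_right] at h
  rw [sub_smul, one_smul]
  linear_combination h

/-- Differentiating exp(∑ (1 - tⁿ) pₙ uⁿ / n) in p_2, the variable of index 1, multiplies it by (1 -
t²) u² / 2. -/
theorem pderiv_qFun (t : ℝ) (r : ℤ) :
    pderiv 1 (qFun t r) = ((1 - t ^ 2) / 2) • qFun t (r - 2) := by
  rcases lt_or_ge r 0 with hs | hs
  · simp [qFun_neg t hs, qFun_neg t (show r - 2 < 0 by omega)]
  obtain ⟨n, rfl⟩ := Int.eq_ofNat_of_zero_le hs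
  have h1 := derivative_derivation (pderiv (1 : ℕ)) (derivative_hlSeries t (X : ℕ → Lam))
  set E : PowerSeries Lam :=
    PowerSeries.mk fun n => pderiv 1 (PowerSeries.coeff n (hlSeries t (X : ℕ → Lam))) with hE
  have hP : (PowerSeries.mk fun n => pderiv 1 (PowerSeries.coeff n (hlLog t (X : ℕ → Lam)))) =
      PowerSeries.C (C (1 - t ^ 2)) * PowerSeries.X := by
    ext1 n
    simp only [PowerSeries.coeff_mk, hlLog, PowerSeries.coeff_C_mul, PowerSeries.coeff_X,
      Derivation.map_smul, pderiv_X]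
    by_cases hn : n = 1
    · subst hn
      simp [smul_eq_C_mul]
    · simp [hn]
  have hd : PowerSeries.derivative Lam (PowerSeries.X ^ 2 : PowerSeries Lam) =
      2 * PowerSeries.X := by
    rw [pow_two, Derivation.leibniz]
    simp [two_mul]
  have hc : (PowerSeries.C (C (1 - t ^ 2)) : PowerSeries Lam) =
      2 * PowerSeries.C (C ((1 - t ^ 2) / 2)) := by
    have h2 : (2 : PowerSeries Lam) = PowerSeries.C (C 2) := by
      rw [show (C 2 : Lam) = 2 from map_ofNat C 2]
      exact (map_ofNat _ 2).symm
    rw [h2, ← map_mul, ← map_mul]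
    congr 2
    ring
  have h2 : E = PowerSeries.C (C ((1 - t ^ 2) / 2)) *
      (PowerSeries.X ^ 2 * hlSeries t (X : ℕ → Lam)) := by
    -- Both sides solve the same inhomogeneous equation and vanish at u = 0; their difference solves
    -- the homogeneous one.
    refine sub_eq_zero.mp (eq_zero_of_derivative_eq_mul (P := hlLog t (X : ℕ → Lam)) ?_ ?_)
    · rw [map_sub, Derivation.leibniz, Derivation.leibniz, hd, derivative_hlSeries, h1, hP, hc]
      simp only [smul_eq_mul, PowerSeries.derivative_C]
      ring
    · rw [map_sub, hE, PowerSeries.coeff_mk, PowerSeries.coeff_C_mul,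
        PowerSeries.coeff_X_pow_mul']
      simp [hlSeries, hlCoeff_zero]
  have h3 := congrArg (PowerSeries.coeff n) h2
  rw [hE, PowerSeries.coeff_mk, PowerSeries.coeff_C_mul, PowerSeries.coeff_X_pow_mul', hlSeries,
    PowerSeries.coeff_mk, ← qFun_natCast] at h3
  rw [h3, smul_eq_C_mul]
  congr 1
  split_ifs with h
  · rw [PowerSeries.coeff_mk, ← qFun_natCast]
    congr 1
    push_cast [h]
    ring
  · rw [qFun_neg]
    omega

/-- `D B_r = B_r D + (1 - t²) / 2 * B_{r-2}` for `D = ∂ / ∂ p₂`. -/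
theorem pderiv_jing (t : ℝ) (r : ℤ) (F : Lam) :
    pderiv 1 (jing t r F) = jing t r (pderiv 1 F) + ((1 - t ^ 2) / 2) • jing t (r - 2) F := by
  induction F using MvPolynomial.induction_on generalizing r with
  | C c =>
    rw [jing_C, Derivation.map_smul, pderiv_qFun, pderiv_C, map_zero, zero_add, jing_C, smul_comm]
  | add p q hp hq =>
    simp only [map_add, smul_add, hp, hq]
    ring
  | mul_X p n hp =>
    rw [mul_comm p]
    have e : (r + n + 1 - 2 : ℤ) = r - 2 + n + 1 := by ring
    simp only [jing_X_mul, map_sub, pderiv_mul, map_add, hp, e, smul_sub, pderiv_X, mul_add]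
    by_cases hn : n = 1
    · subst hn
      simp only [Pi.single_eq_same, one_mul, smul_eq_C_mul]
      ring
    · simp only [Pi.single_eq_of_ne hn, zero_mul, map_zero, smul_eq_C_mul]
      ring

/-- The derivation of `Lam` that multiplies elements of degree `n` by `n`. -/
def eulerD : Derivation ℝ Lam Lam := mkDerivation ℝ fun n => ((n : ℝ) + 1) • (X n : Lam)

theorem eulerD_X (n : ℕ) : eulerD (X n) = ((n : ℝ) + 1) • (X n : Lam) := mkDerivation_X _ _ _

/-- On the generating series the Euler derivation of the coefficients agrees with u d/du; hence q_r
is homogeneous of degree r. -/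
theorem eulerD_qFun (t : ℝ) (r : ℤ) : eulerD (qFun t r) = (r : ℝ) • qFun t r := by
  rcases lt_or_ge r 0 with hs | hs
  · simp [qFun_neg t hs]
  obtain ⟨n, rfl⟩ := Int.eq_ofNat_of_zero_le hs
  have h0 := derivative_hlSeries t (X : ℕ → Lam)
  have h1 := derivative_derivation eulerD h0
  set E : PowerSeries Lam :=
    PowerSeries.mk fun n => eulerD (PowerSeries.coeff n (hlSeries t (X : ℕ → Lam))) with hE
  have hP : (PowerSeries.mk fun n => eulerD (PowerSeries.coeff n (hlLog t (X : ℕ → Lam)))) =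
      PowerSeries.derivative Lam (PowerSeries.X * hlLog t (X : ℕ → Lam)) := by
    ext1 n
    rw [PowerSeries.coeff_derivative, PowerSeries.coeff_succ_X_mul]
    simp only [PowerSeries.coeff_mk, hlLog, Derivation.map_smul, eulerD_X]
    simp only [smul_eq_C_mul, map_add, map_natCast, map_one]
    ring
  have h2 : E = PowerSeries.X * PowerSeries.derivative Lam (hlSeries t (X : ℕ → Lam)) := by
    refine sub_eq_zero.mp (eq_zero_of_derivative_eq_mul (P := hlLog t (X : ℕ → Lam)) ?_ ?_)
    · rw [map_sub, h1, hP, h0, ← mul_assoc, Derivation.leibniz _ (PowerSeries.X * _), h0]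
      simp only [smul_eq_mul]
      ring
    · simp [hE, hlSeries, hlCoeff_zero]
  have h3 := congrArg (PowerSeries.coeff n) h2
  rw [hE, PowerSeries.coeff_mk, hlSeries, PowerSeries.coeff_mk, ← qFun_natCast] at h3
  rw [h3]
  cases n with
  | zero => simp
  | succ n =>
    rw [PowerSeries.coeff_succ_X_mul, PowerSeries.coeff_derivative, PowerSeries.coeff_mk,
      ← qFun_natCast, smul_eq_C_mul, mul_comm]
    simp

theorem eulerD_jing (t : ℝ) (r : ℤ) (F : Lam) :
    eulerD (jing t r F) = jing t r (eulerD F) + (r : ℝ) • jing t r F := by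
  induction F using MvPolynomial.induction_on generalizing r with
  | C c =>
    rw [jing_C, Derivation.map_smul, eulerD_qFun, ← algebraMap_eq, Derivation.map_algebraMap, map_zero,
      zero_add, smul_comm]
  | add p q hp hq =>
    simp only [map_add, smul_add, hp, hq]
    ring
  | mul_X p n hp =>
    rw [mul_comm p]
    simp only [jing_X_mul, map_sub, Derivation.leibniz, map_add, hp, smul_sub, eulerD_X,
      smul_eq_mul, mul_smul_comm, map_smul, mul_add]
    rw [mul_comm p, jing_X_mul]
    simp only [smul_eq_C_mul]
    push_cast
    simp only [map_add, map_natCast, map_one]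
    ring

end HLUnitary

end

/-! ### Words in the vertex operators: ∂/∂p_2 and multiplication by p_2 on the functions Q_λ -/

noncomputable section

namespace HLUnitary

open MvPolynomial

/-- The Gaussian integer `1 + t + ⋯ + t ^ (m - 1)`. -/
def gaussInt (t : ℝ) (m : ℕ) : ℝ := ∑ i ∈ Finset.range m, t ^ i

/-- The Gaussian binomial coefficient `m` over `2`. -/
def gaussChooseTwo (t : ℝ) : ℕ → ℝ
  | 0 => 0
  | m + 1 => gaussInt t m + t ^ 2 * gaussChooseTwo t m

theorem gaussInt_zero (t : ℝ) : gaussInt t 0 = 0 := by simp [gaussInt]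

theorem gaussInt_succ (t : ℝ) (m : ℕ) : gaussInt t (m + 1) = gaussInt t m + t ^ m := by
  rw [gaussInt, Finset.sum_range_succ, gaussInt]

theorem gaussInt_succ' (t : ℝ) (m : ℕ) : gaussInt t (m + 1) = t * gaussInt t m + 1 := by
  rw [gaussInt, Finset.sum_range_succ', gaussInt, Finset.mul_sum]
  simp [pow_succ']

theorem gaussInt_mul (t : ℝ) (m : ℕ) : gaussInt t m * (1 - t) = 1 - t ^ m :=
  geom_sum_mul_neg t m

/-- The second Pascal rule. The defining one fits multiplication by p_2, where new factors move to
the left; this one fits ∂/∂p_2, where they move to the right. -/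
theorem gaussChooseTwo_succ (t : ℝ) (m : ℕ) :
    gaussChooseTwo t (m + 1) = gaussChooseTwo t m + t ^ (m - 1) * gaussInt t m := by
  induction m with
  | zero => simp [gaussChooseTwo, gaussInt]
  | succ m ih =>
    rw [gaussChooseTwo, ih]
    cases m with
    | zero => simp [gaussChooseTwo, gaussInt]
    | succ m =>
      have h1 : gaussChooseTwo t (m + 1) + t ^ m * gaussInt t (m + 1) =
        gaussInt t (m + 1) + t ^ 2 * gaussChooseTwo t (m + 1) := ih.symm
      have h2 := gaussInt_succ t (m + 1)
      have h3 := gaussInt_succ' t (m + 1)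
      simp only [Nat.add_sub_cancel] at *
      linear_combination (t ^ (m + 1) - 0) * (-h3) + h2 - h1

theorem gaussChooseTwo_mul (t : ℝ) (m : ℕ) :
    gaussChooseTwo t m * ((1 - t) * (1 - t ^ 2)) = (1 - t ^ m) * (1 - t ^ (m - 1)) := by
  induction m with
  | zero => simp [gaussChooseTwo]
  | succ m ih =>
    rw [gaussChooseTwo]
    cases m with
    | zero => simp [gaussChooseTwo, gaussInt]
    | succ m =>
      have h := gaussInt_mul t (m + 1)
      simp only [Nat.add_sub_cancel] at *
      linear_combination (1 - t ^ 2) * h + t ^ 2 * ih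

theorem jing_pred_pow (t : ℝ) (a : ℤ) (m : ℕ) (v : Lam) :
    jing t (a - 1) ((jing t a ^ m) v) = t ^ m • (jing t a ^ m) (jing t (a - 1) v) := by
  induction m with
  | zero => simp
  | succ m ih =>
    rw [pow_succ', Module.End.mul_apply, jing_swap_one, ih, map_smul, smul_smul, ← pow_succ',
      Module.End.mul_apply]

/-- Each passage of B_{a-2} over a factor B_a leaves a term with B_{a-1}², which must then pass the
remaining factors. The powers of t picked up on the way add up to t^{m-1}(1 + t + ⋯ + t^{m-1}). -/
theorem jing_pred_two_pow (t : ℝ) (a : ℤ) (m : ℕ) (v : Lam) :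
    jing t (a - 2) ((jing t a ^ m) v) = t ^ m • (jing t a ^ m) (jing t (a - 2) v) +
      ((t - 1) * (t ^ (m - 1) * gaussInt t m)) •
        (jing t a ^ (m - 1)) (jing t (a - 1) (jing t (a - 1) v)) := by
  have e : ∀ w, jing t (a - 2) (jing t a w) =
      t • jing t a (jing t (a - 2) w) + (t - 1) • jing t (a - 1) (jing t (a - 1) w) := by
    intro w
    have h := jing_swap_two t (a - 1) w
    rwa [sub_add_cancel, sub_sub, one_add_one_eq_two] at h
  induction m with
  | zero => simp [gaussInt_zero]
  | succ m ih =>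
    rw [pow_succ', Module.End.mul_apply, e, ih, jing_pred_pow, map_smul, jing_pred_pow,
      Module.End.mul_apply, map_add, map_smul, map_smul, Nat.add_sub_cancel, gaussInt_succ]
    cases m with
    | zero => simp [gaussInt_zero]
    | succ m =>
      rw [Nat.add_sub_cancel, pow_succ' (jing t a) m, Module.End.mul_apply, Module.End.mul_apply]
      simp only [smul_eq_C_mul, map_add, map_mul, map_sub, map_pow, map_one]
      ring

/-- The commutator with ∂/∂p_2 replaces one of the m factors B_a by B_{a-2}; moving it to the right
of the others produces Gaussian binomials. For m < 2 the truncated exponents are harmless, since the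
coefficients vanish. -/
theorem pderiv_jing_pow (t : ℝ) (a : ℤ) (m : ℕ) (v : Lam) :
    pderiv 1 ((jing t a ^ m) v) = (jing t a ^ m) (pderiv 1 v) + ((1 - t ^ 2) / 2) •
      (gaussInt t m • (jing t a ^ (m - 1)) (jing t (a - 2) v) +
        ((t - 1) * gaussChooseTwo t m) •
          (jing t a ^ (m - 2)) (jing t (a - 1) (jing t (a - 1) v))) := by
  induction m with
  | zero => simp [gaussInt_zero, gaussChooseTwo]
  | succ m ih =>
    rw [pow_succ', Module.End.mul_apply, pderiv_jing, ih, jing_pred_two_pow, gaussInt_succ,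
      gaussChooseTwo_succ, Module.End.mul_apply]
    simp only [map_add, map_smul]
    rcases m with _ | _ | m
    · simp [gaussInt_zero, gaussChooseTwo]
    · simp [gaussInt, gaussChooseTwo, smul_add, add_smul]
      ring
    · have e1 : m + 1 + 1 - 1 = m + 1 := rfl
      have e2 : m + 1 + 1 - 2 = m := rfl
      have e3 : m + 1 + 1 + 1 - 1 = m + 1 + 1 := rfl
      have e4 : m + 1 + 1 + 1 - 2 = m + 1 := rfl
      rw [e1, e2, e3, e4]
      simp only [pow_succ', Module.End.mul_apply]
      simp only [smul_eq_C_mul, map_add, map_mul, map_sub, map_pow, map_one]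
      ring

/-- The counterpart for p_2: one factor B_a becomes B_{a+2}, which is sorted to the left. -/
theorem X_mul_jing_pow (t : ℝ) (a : ℤ) (m : ℕ) (v : Lam) :
    X 1 * (jing t a ^ m) v = (jing t a ^ m) (X 1 * v) +
      gaussInt t m • jing t (a + 2) ((jing t a ^ (m - 1)) v) +
        ((t - 1) * gaussChooseTwo t m) •
          jing t (a + 1) (jing t (a + 1) ((jing t a ^ (m - 2)) v)) := by
  have e : ∀ w, jing t a (jing t (a + 2) w) =
      t • jing t (a + 2) (jing t a w) + (t - 1) • jing t (a + 1) (jing t (a + 1) w) := by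
    intro w
    have h := jing_swap_two t (a + 1) w
    rwa [add_sub_cancel_right, add_assoc, one_add_one_eq_two] at h
  have e' : ∀ w, jing t a (jing t (a + 1) w) = t • jing t (a + 1) (jing t a w) := by
    intro w
    have h := jing_swap_one t (a + 1) w
    rwa [add_sub_cancel_right] at h
  have ex : ∀ w, X 1 * jing t a w = jing t a (X 1 * w) + jing t (a + 2) w := by
    intro w
    rw [X_mul_jing, add_assoc a]
    norm_num
  induction m with
  | zero => simp [gaussInt_zero, gaussChooseTwo]
  | succ m ih =>
    rw [pow_succ', Module.End.mul_apply, ex, ih, gaussInt_succ', gaussChooseTwo,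
      Module.End.mul_apply]
    simp only [map_add, map_smul]
    rcases m with _ | _ | m
    · simp [gaussInt_zero, gaussChooseTwo]
    · simp [gaussInt, gaussChooseTwo, e, smul_add, add_smul]
      ring
    · have e1 : m + 1 + 1 - 1 = m + 1 := rfl
      have e2 : m + 1 + 1 - 2 = m := rfl
      have e3 : m + 1 + 1 + 1 - 1 = m + 1 + 1 := rfl
      have e4 : m + 1 + 1 + 1 - 2 = m + 1 := rfl
      rw [e1, e2, e3, e4]
      simp only [pow_succ', Module.End.mul_apply, e, e', map_smul]
      simp only [smul_eq_C_mul, map_add, map_mul, map_sub, map_pow, map_one]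
      ring

/-- `B_K ^ (m K) ⋯ B_1 ^ (m 1) 1`, that is, `Q_λ` for the partition `λ` in which the part `a`
has multiplicity `m a` for `1 ≤ a ≤ K`. -/
def word (t : ℝ) (m : ℕ → ℕ) : ℕ → Lam
  | 0 => 1
  | K + 1 => (jing t ((K : ℤ) + 1) ^ m (K + 1)) (word t m K)

theorem word_congr (t : ℝ) {m m' : ℕ → ℕ} {K : ℕ} (h : ∀ j, 1 ≤ j → j ≤ K → m j = m' j) :
    word t m K = word t m' K := by
  induction K with
  | zero => rfl
  | succ K ih =>
    rw [word, word, h (K + 1) (by omega) le_rfl, ih fun j h1 h2 => h j h1 (by omega)]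

theorem word_succ_of_eq_zero (t : ℝ) {m : ℕ → ℕ} {K : ℕ} (h : m (K + 1) = 0) :
    word t m (K + 1) = word t m K := by
  rw [word, h, pow_zero, Module.End.one_apply]

theorem word_of_le (t : ℝ) {m : ℕ → ℕ} {K L : ℕ} (hKL : K ≤ L) (h : ∀ j, K < j → j ≤ L → m j = 0) :
    word t m L = word t m K := by
  induction L, hKL using Nat.le_induction with
  | base => rfl
  | succ L hL ih =>
    rw [word_succ_of_eq_zero t (h (L + 1) (by omega) le_rfl), ih fun j h1 h2 => h j h1 (by omega)]

/-- Increase the multiplicity of `a` by `x`. -/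
def bump (m : ℕ → ℕ) (a x : ℕ) : ℕ → ℕ := fun j => if j = a then m j + x else m j

/-- For K = 0 the reason is B_0 1 = q_0 = 1. As `word` never reads the multiplicity of 0, parts that
shrink to size zero disappear without special treatment. -/
theorem jing_pow_word (t : ℝ) (m : ℕ → ℕ) (K x : ℕ) :
    (jing t (K : ℤ) ^ x) (word t m K) = word t (bump m K x) K := by
  cases K with
  | zero =>
    have h : jing t 0 1 = 1 := by rw [jing_one, qFun_zero]
    simp only [word, Nat.cast_zero]
    induction x with
    | zero => simp
    | succ x ih => rw [pow_succ, Module.End.mul_apply, h, ih]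
  | succ K =>
    have h : word t m K = word t (bump m (K + 1) x) K :=
      word_congr t fun j h1 h2 => by simp [bump, show j ≠ K + 1 by omega]
    rw [word, word, ← Module.End.mul_apply, Nat.cast_succ, ← pow_add, h]
    simp [bump, add_comm]

theorem jing_pow_pow (t : ℝ) (a : ℤ) (x y : ℕ) (v : Lam) :
    (jing t (a - 1) ^ x) ((jing t a ^ y) v) =
      t ^ (x * y) • (jing t a ^ y) ((jing t (a - 1) ^ x) v) := by
  induction x with
  | zero => simp
  | succ x ih =>
    rw [pow_succ', Module.End.mul_apply, ih, map_smul, jing_pred_pow, smul_smul, ← pow_add,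
      Module.End.mul_apply]
    congr 2
    ring

theorem jing_pow_word_succ (t : ℝ) (m : ℕ → ℕ) (K x : ℕ) :
    (jing t (K : ℤ) ^ x) (word t m (K + 1)) =
      t ^ (x * m (K + 1)) • word t (bump m K x) (K + 1) := by
  have h := jing_pow_pow t ((K : ℤ) + 1) x (m (K + 1)) (word t m K)
  rw [add_sub_cancel_right, jing_pow_word] at h
  rw [word, h, word]
  simp [bump]

/-- Replace a part `a` by a part `a - 2`. -/
def downTwo (m : ℕ → ℕ) (a : ℕ) : ℕ → ℕ :=
  fun j => if j = a then m j - 1 else if j + 2 = a then m j + 1 else m j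

/-- Replace two parts `a` by two parts `a - 1`. -/
def downPair (m : ℕ → ℕ) (a : ℕ) : ℕ → ℕ :=
  fun j => if j = a then m j - 2 else if j + 1 = a then m j + 2 else m j

/-- Replace a part `a` by a part `a + 2`. -/
def upTwo (m : ℕ → ℕ) (a : ℕ) : ℕ → ℕ :=
  fun j => if j = a then m j - 1 else if j = a + 2 then m j + 1 else m j

/-- Replace two parts `a` by two parts `a + 1`. -/
def upPair (m : ℕ → ℕ) (a : ℕ) : ℕ → ℕ :=
  fun j => if j = a then m j - 2 else if j = a + 1 then m j + 2 else m j

/-- B_{K-1} passes the block of factors B_K and merges with the factors B_{K-1}. For K = 0 it gives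
q_{-1} = 0. -/
theorem jing_pred_word (t : ℝ) (m : ℕ → ℕ) (K : ℕ) :
    jing t ((K : ℤ) - 1) (word t m K) =
      (if K = 0 then 0 else t ^ m K) • word t (fun j => if j + 1 = K then m j + 1 else m j) K := by
  cases K with
  | zero => simp [word, jing_one, qFun_neg]
  | succ K =>
    have h := jing_pow_word_succ t m K 1
    rw [pow_one, one_mul] at h
    rw [Nat.cast_succ, add_sub_cancel_right, h]
    simp only [Nat.add_right_cancel_iff, if_neg (Nat.succ_ne_zero K)]
    rfl

/-- The index i stands for the part a = i + 1. A part a - 2 created from a must be sorted past the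
parts a - 1, whence the power t^{m_{a-1}}; two parts a - 1 merge at once with the existing ones. The
value 0 at i = 0 expresses that a part 1 cannot become -1. -/
theorem pderiv_word (t : ℝ) (m : ℕ → ℕ) (K : ℕ) :
    pderiv 1 (word t m K) = ((1 - t ^ 2) / 2) • ∑ i ∈ Finset.range K,
      ((gaussInt t (m (i + 1)) * if i = 0 then 0 else t ^ m i) • word t (downTwo m (i + 1)) K +
        ((t - 1) * gaussChooseTwo t (m (i + 1))) • word t (downPair m (i + 1)) K) := by
  induction K with
  | zero => simp [word]
  | succ K ih =>
    rw [word, pderiv_jing_pow, ih, Finset.sum_range_succ, map_smul, smul_add (_ / _ : ℝ) _ (_ + _),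
      map_sum]
    congr 2
    · refine Finset.sum_congr rfl fun i hi => ?_
      have hi' := Finset.mem_range.mp hi
      rw [map_add, map_smul, map_smul, word, word]
      congr 4
      · simp only [downTwo]
        rw [if_neg (by omega), if_neg (by omega)]
      · simp only [downPair]
        rw [if_neg (by omega), if_neg (by omega)]
    · have e1 : (K : ℤ) + 1 - 2 = K - 1 := by ring
      have h2 := jing_pow_word t m K 2
      rw [pow_two, Module.End.mul_apply] at h2
      have z1 : word t (fun j => if j + 1 = K then m j + 1 else m j) K =
          word t (downTwo m (K + 1)) K :=
        word_congr t fun j _ _ => by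
          simp only [downTwo]
          split_ifs <;> omega
      have z2 : word t (bump m K 2) K = word t (downPair m (K + 1)) K :=
        word_congr t fun j _ _ => by
          simp only [downPair, bump]
          split_ifs <;> omega
      have z3 : downTwo m (K + 1) (K + 1) = m (K + 1) - 1 := by simp [downTwo]
      have z4 : downPair m (K + 1) (K + 1) = m (K + 1) - 2 := by simp [downPair]
      rw [e1, add_sub_cancel_right, jing_pred_word, h2, map_smul, smul_smul, word, word, z1, z2,
        z3, z4]

theorem qFun_one (t : ℝ) : qFun t 1 = (1 - t) • X 0 := by
  have h := hlCoeff_succ t (X : ℕ → Lam) 0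
  have h1 := qFun_natCast t 1
  simp only [Nat.cast_one] at h1
  simpa [hlCoeff_zero, h1] using h

theorem qFun_two (t : ℝ) :
    (2 : ℝ) • qFun t 2 = ((1 - t) ^ 2) • (X 0 * X 0) + (1 - t ^ 2) • X 1 := by
  have h := hlCoeff_succ t (X : ℕ → Lam) 1
  have h1 : hlCoeff t (X : ℕ → Lam) 1 = (1 - t) • X 0 := by
    rw [← qFun_one]
    exact (qFun_natCast t 1).symm
  have h2 : hlCoeff t (X : ℕ → Lam) 2 = qFun t 2 := (qFun_natCast t 2).symm
  rw [Finset.sum_range_succ, Finset.sum_range_one, one_add_one_eq_two, h2, Nat.sub_self,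
    Nat.sub_zero, h1, hlCoeff_zero, Nat.cast_one, one_add_one_eq_two] at h
  rw [h]
  simp only [smul_eq_C_mul, map_sub, map_pow, map_one]
  ring

/-- The expansion of p_2 in Q_{(2)} and Q_{(1,1)}: the case of the empty partition in the Pieri rule
below. -/
theorem X_one_eq (t : ℝ) (h1 : 1 - t ≠ 0) (h2 : 1 - t ^ 2 ≠ 0) :
    (X 1 : Lam) = (1 - t)⁻¹ • jing t 2 1 - (1 - t ^ 2)⁻¹ • jing t 1 (jing t 1 1) := by
  have e : jing t 1 (X 0) = X 0 * qFun t 1 - qFun t 2 := by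
    have := jing_X_mul t 1 0 1
    simpa [jing_one, one_add_one_eq_two] using this
  have h3 := qFun_two t
  have h4 : (1 - t ^ 2) • (X 1 : Lam) = (2 : ℝ) • qFun t 2 - ((1 - t) ^ 2) • (X 0 * X 0) := by
    rw [h3]; ring
  have h5 : (X 1 : Lam) = (1 - t ^ 2)⁻¹ • ((1 - t ^ 2) • (X 1 : Lam)) := by
    rw [smul_smul, inv_mul_cancel₀ h2, one_smul]
  rw [h5, h4, jing_one, jing_one, qFun_one, map_smul, e, qFun_one, mul_smul_comm]
  have e1 : (1 - t)⁻¹ = (1 - t ^ 2)⁻¹ * (1 + t) := by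
    field_simp
    ring
  rw [e1, mul_smul, ← smul_sub]
  congr 1
  simp only [smul_eq_C_mul, map_add, map_sub, map_pow, map_one, map_ofNat]
  ring

/-- Forget the multiplicities of the parts greater than `K`. -/
def trunc (m : ℕ → ℕ) (K : ℕ) : ℕ → ℕ := fun j => if j ≤ K then m j else 0

/-- The largest parts of the word have size K + 2, so the factors B_{K+1} have only those to cross
before they merge. -/
theorem jing_pow_word_add_two (t : ℝ) {w w' : ℕ → ℕ} (K x : ℕ) (h0 : w' (K + 3) = 0)
    (h : ∀ j, 1 ≤ j → j ≤ K + 2 → bump w (K + 1) x j = w' j) :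
    (jing t ((K : ℤ) + 1) ^ x) (word t w (K + 2)) =
      t ^ (x * w (K + 2)) • word t w' (K + 3) := by
  rw [word_succ_of_eq_zero t h0]
  have h1 := jing_pow_word_succ t w (K + 1) x
  rw [Nat.cast_succ] at h1
  rw [h1, word_congr t h]

/-- The Pieri rule for p_2. The operator p_2 is carried through the word from the left: its
commutators with the B_a enlarge parts, and what remains is p_2 · 1, which adds a new part 2 or two
new parts 1. New parts may have size up to K + 2, hence the longer word and `trunc`, which keeps
stray values of m beyond K out of it. -/
theorem X_mul_word (t : ℝ) (h1 : 1 - t ≠ 0) (h2 : 1 - t ^ 2 ≠ 0) (m : ℕ → ℕ) (K : ℕ) :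
    X 1 * word t m K = ∑ i ∈ Finset.range K,
      ((gaussInt t (m (i + 1)) * t ^ trunc m K (i + 2)) •
          word t (upTwo (trunc m K) (i + 1)) (K + 2) +
        ((t - 1) * gaussChooseTwo t (m (i + 1))) • word t (upPair (trunc m K) (i + 1)) (K + 2)) +
      ((t ^ trunc m K 1 * (1 - t)⁻¹) • word t (bump (trunc m K) 2 1) (K + 2) -
        (1 - t ^ 2)⁻¹ • word t (bump (trunc m K) 1 2) (K + 2)) := by
  induction K with
  | zero =>
    have e := X_one_eq t h1 h2
    simp only [word, trunc, bump, mul_one, Finset.range_zero, Finset.sum_empty]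
    simpa [pow_two, one_add_one_eq_two] using e
  | succ K ih =>
    rw [word, X_mul_jing_pow, ih, Finset.sum_range_succ, map_add, map_sum, map_sub, map_smul,
      map_smul]
    set x := m (K + 1) with hx
    have t0 : ∀ j, K + 1 < j → trunc m (K + 1) j = 0 := fun j hj => by
      simp only [trunc]; rw [if_neg (by omega)]
    have t1 : ∀ j, K < j → trunc m K j = 0 := fun j hj => by
      simp only [trunc]; rw [if_neg (by omega)]
    have t2 : ∀ j, bump (trunc m K) (K + 1) x j = trunc m (K + 1) j := by
      intro j
      simp only [bump, trunc, hx]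
      split_ifs <;> first | omega | (subst_vars; omega)
    have t3 : ∀ j, j ≠ K + 1 → trunc m (K + 1) j = trunc m K j := by
      intro j hj
      rw [← t2, bump, if_neg hj]
    have hA : ∀ i ∈ Finset.range K, (jing t ((K : ℤ) + 1) ^ x)
        ((gaussInt t (m (i + 1)) * t ^ trunc m K (i + 2)) •
          word t (upTwo (trunc m K) (i + 1)) (K + 2) +
        ((t - 1) * gaussChooseTwo t (m (i + 1))) • word t (upPair (trunc m K) (i + 1)) (K + 2)) =
        (gaussInt t (m (i + 1)) * t ^ trunc m (K + 1) (i + 2)) •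
          word t (upTwo (trunc m (K + 1)) (i + 1)) (K + 1 + 2) +
        ((t - 1) * gaussChooseTwo t (m (i + 1))) •
          word t (upPair (trunc m (K + 1)) (i + 1)) (K + 1 + 2) := by
      intro i hi
      have hi' := Finset.mem_range.mp hi
      rw [map_add, map_smul, map_smul]
      rw [jing_pow_word_add_two t (w' := upTwo (trunc m (K + 1)) (i + 1)) K x,
        jing_pow_word_add_two t (w' := upPair (trunc m (K + 1)) (i + 1)) K x]
      · rw [smul_smul, smul_smul]
        congr 2
        · rw [mul_assoc, ← pow_add]
          congr 2
          simp only [upTwo]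
          rw [if_neg (show ¬ K + 2 = i + 1 by omega), t1 (K + 2) (by omega)]
          -- Only for i + 1 = K is the enlarged part of size K + 2; crossing it costs t^x, which is
          -- the required power t^{m (K+1)}.
          by_cases hi : i + 1 = K
          · rw [if_pos (by omega), t1 (i + 2) (by omega), show i + 2 = K + 1 by omega, ← t2,
              bump, if_pos rfl, t1 (K + 1) (by omega)]
            ring
          · rw [if_neg (by omega), t3 _ (by omega)]
            ring
        · simp only [upPair]
          rw [if_neg (show ¬ K + 2 = i + 1 by omega), if_neg (by omega), t1 (K + 2) (by omega)]
          simp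
      · simp only [upPair]
        rw [if_neg (by omega), if_neg (by omega), t0 _ (by omega)]
      · intro j _ _
        have t4 := t2 j
        simp only [bump, upPair] at t4 ⊢
        split_ifs at t4 ⊢ <;> omega
      · simp only [upTwo]
        rw [if_neg (by omega), if_neg (by omega), t0 _ (by omega)]
      · intro j _ _
        have t4 := t2 j
        simp only [bump, upTwo] at t4 ⊢
        split_ifs at t4 ⊢ <;> omega
    rw [Finset.sum_congr rfl hA]
    have hB : (jing t ((K : ℤ) + 1) ^ x) (word t (bump (trunc m K) 1 2) (K + 2)) =
        word t (bump (trunc m (K + 1)) 1 2) (K + 1 + 2) := by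
      rw [jing_pow_word_add_two t (w' := bump (trunc m (K + 1)) 1 2) K x]
      · rw [bump, if_neg (by omega), t1 _ (by omega), mul_zero, pow_zero, one_smul]
      · rw [bump, if_neg (by omega), t0 _ (by omega)]
      · intro j _ _
        have t4 := t2 j
        simp only [bump] at t4 ⊢
        split_ifs at t4 ⊢ <;> omega
    have hC : (t ^ trunc m K 1 * (1 - t)⁻¹) •
        (jing t ((K : ℤ) + 1) ^ x) (word t (bump (trunc m K) 2 1) (K + 2)) =
        (t ^ trunc m (K + 1) 1 * (1 - t)⁻¹) •
          word t (bump (trunc m (K + 1)) 2 1) (K + 1 + 2) := by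
      rw [jing_pow_word_add_two t (w' := bump (trunc m (K + 1)) 2 1) K x]
      · rw [smul_smul, mul_right_comm, ← pow_add]
        congr 3
        rw [bump, t1 (K + 2) (by omega), ← t2 1, bump]
        split_ifs <;> omega
      · rw [bump, if_neg (by omega), t0 _ (by omega)]
      · intro j _ _
        have t4 := t2 j
        simp only [bump] at t4 ⊢
        split_ifs at t4 ⊢ <;> omega
    rw [hB, hC]
    have hD : jing t ((K : ℤ) + 1 + 2) ((jing t ((K : ℤ) + 1) ^ (x - 1)) (word t m K)) =
        word t (upTwo (trunc m (K + 1)) (K + 1)) (K + 1 + 2) := by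
      rw [word, word_succ_of_eq_zero, word]
      · have z1 : upTwo (trunc m (K + 1)) (K + 1) (K + 1 + 1 + 1) = 1 := by
          have z0 := t0 (K + 1 + 1 + 1) (by omega)
          unfold upTwo
          split_ifs <;> omega
        have z2 : upTwo (trunc m (K + 1)) (K + 1) (K + 1) = x - 1 := by
          simp [upTwo, trunc, hx]
        rw [z1, z2, pow_one]
        have z3 : word t m K = word t (upTwo (trunc m (K + 1)) (K + 1)) K :=
          word_congr t fun j hj1 hj2 => by
            simp only [upTwo, trunc]
            rw [if_neg (by omega), if_neg (by omega), if_pos (by omega)]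
        rw [z3]
        congr 2
      · simp only [upTwo]
        rw [if_neg (by omega), if_neg (by omega), t0 _ (by omega)]
    have hE : jing t ((K : ℤ) + 1 + 1) (jing t ((K : ℤ) + 1 + 1)
        ((jing t ((K : ℤ) + 1) ^ (x - 2)) (word t m K))) =
        word t (upPair (trunc m (K + 1)) (K + 1)) (K + 1 + 2) := by
      rw [word_succ_of_eq_zero, word, word]
      · have z1 : upPair (trunc m (K + 1)) (K + 1) (K + 1 + 1) = 2 := by
          have z0 := t0 (K + 1 + 1) (by omega)
          unfold upPair
          split_ifs <;> omega
        have z2 : upPair (trunc m (K + 1)) (K + 1) (K + 1) = x - 2 := by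
          simp [upPair, trunc, hx]
        rw [z1, z2, pow_two, Module.End.mul_apply]
        have z3 : word t m K = word t (upPair (trunc m (K + 1)) (K + 1)) K :=
          word_congr t fun j hj1 hj2 => by
            simp only [upPair, trunc]
            rw [if_neg (by omega), if_neg (by omega), if_pos (by omega)]
        rw [z3]
        push_cast
        rfl
      · simp only [upPair]
        rw [if_neg (by omega), if_neg (by omega), t0 _ (by omega)]
    rw [hD, hE, t0 (K + 2) (by omega), pow_zero, mul_one]
    ring

end HLUnitary

end

/-! ### The power sums as free generators of Sym, and the functionals Φ -/

noncomputable section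

namespace HLUnitary

open MvPolynomial

/-- The homomorphism from polynomials in the power sums to symmetric functions. -/
def theta : Lam →ₐ[ℝ] Sym := aeval fun n => HLUnitary.psum (n + 1)

/-- Setting all variables except the first `m` ones equal to zero. -/
def restrVars (m : ℕ) : Sym →ₐ[ℝ] MvPowerSeries (Fin m) ℝ :=
  (MvPowerSeries.killCompl Fin.valEmbedding).comp Sym.val

/-- The polynomial in `m` variables given by a polynomial in the power sums. -/
def finEval (m : ℕ) : Lam →ₐ[ℝ] MvPolynomial (Fin m) ℝ :=
  aeval fun n => MvPolynomial.psum (Fin m) ℝ (n + 1)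

theorem restrVars_psum (m k : ℕ) :
    restrVars m (HLUnitary.psum (k + 1)) =
      (MvPolynomial.psum (Fin m) ℝ (k + 1) : MvPowerSeries (Fin m) ℝ) := by
  classical
  ext d
  change MvPowerSeries.coeff d (MvPowerSeries.killCompl Fin.valEmbedding (psumSeries (k + 1))) = _
  rw [MvPowerSeries.coeff_killCompl, coeff_coe, MvPolynomial.psum, coeff_sum]
  simp only [coeff_X_pow]
  change (if _ then _ else _) = _
  split_ifs with h
  · obtain ⟨i, hi⟩ := h
    have hi1 : i ∈ (Finsupp.embDomain Fin.valEmbedding d).support := by rw [hi]; simp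
    rw [Finsupp.support_embDomain, Finset.mem_map] at hi1
    obtain ⟨j, -, rfl⟩ := hi1
    rw [← Finsupp.embDomain_single, Finsupp.embDomain_inj] at hi
    subst hi
    rw [Finset.sum_eq_single j]
    · simp
    · intro b _ hb
      rw [if_neg]
      rw [Finsupp.single_left_inj (by omega)]
      exact hb
    · simp
  · symm
    refine Finset.sum_eq_zero fun i _ => if_neg fun hi => h ⟨i, ?_⟩
    rw [← hi, Finsupp.embDomain_single]
    rfl

theorem restrVars_theta (m : ℕ) (F : Lam) :
    restrVars m (theta F) = (finEval m F : MvPowerSeries (Fin m) ℝ) := by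
  have h : (restrVars m).comp theta = (coeToMvPowerSeries.algHom ℝ).comp (finEval m) := by
    refine algHom_ext fun n => ?_
    rw [AlgHom.comp_apply, AlgHom.comp_apply, theta, aeval_X, restrVars_psum, finEval, aeval_X]
    simp
  have h1 := DFunLike.congr_fun h F
  simpa using h1

/-- The power sums `p_1, …, p_m` in `m` variables. -/
def psumHom (m : ℕ) : MvPolynomial (Fin m) ℝ →ₐ[ℝ] MvPolynomial (Fin m) ℝ :=
  aeval fun i => MvPolynomial.psum (Fin m) ℝ ((i : ℕ) + 1)

/-- Newton's identities express k e_k by power sums and lower e_j, and k is invertible. -/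
theorem esymm_mem_range (m k : ℕ) (hk : k ≤ m) : esymm (Fin m) ℝ k ∈ (psumHom m).range := by
  induction k using Nat.strong_induction_on with
  | _ k ih =>
    rcases Nat.eq_zero_or_pos k with rfl | hpos
    · rw [esymm_zero]; exact one_mem _
    have h := mul_esymm_eq_sum (Fin m) ℝ k
    have h1 : (k : MvPolynomial (Fin m) ℝ) * esymm (Fin m) ℝ k ∈ (psumHom m).range := by
      rw [h]
      refine mul_mem (pow_mem (neg_mem (one_mem _)) _) (sum_mem fun a ha => ?_)
      rw [Finset.mem_filter, Finset.HasAntidiagonal.mem_antidiagonal] at ha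
      refine mul_mem (mul_mem (pow_mem (neg_mem (one_mem _)) _) (ih _ ha.2 (by omega))) ?_
      refine ⟨X ⟨a.2 - 1, by omega⟩, ?_⟩
      simp only [psumHom, AlgHom.toRingHom_eq_coe, RingHom.coe_coe, aeval_X]
      congr 1
      omega
    have h2 := Subalgebra.smul_mem _ h1 ((k : ℝ)⁻¹)
    rw [smul_eq_C_mul, ← mul_assoc, ← map_natCast (C : ℝ →+* MvPolynomial (Fin m) ℝ), ← map_mul,
      inv_mul_cancel₀ (by positivity), map_one, one_mul] at h2
    exact h2

theorem mem_range_psumHom {m : ℕ} {g : MvPolynomial (Fin m) ℝ} (hg : g.IsSymmetric) :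
    g ∈ (psumHom m).range := by
  obtain ⟨p, hp⟩ := (esymmAlgHom_fin_bijective ℝ m).2 ⟨g, hg⟩
  have h1 : g = aeval (fun i : Fin m => esymm (Fin m) ℝ (i + 1)) p := by
    rw [← esymmAlgHom_apply, hp]
  rw [h1]
  clear h1 hp hg
  induction p using MvPolynomial.induction_on with
  | C c => rw [aeval_C]; exact Subalgebra.algebraMap_mem _ _
  | add p q hp hq =>
    rw [map_add]
    exact add_mem hp hq
  | mul_X p i hp =>
    rw [map_mul, aeval_X]
    exact mul_mem hp (esymm_mem_range m _ i.2)

/-- The kernels of the powers of f form an ascending chain, which stabilizes at some n; a kernel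
element of f, written as f^n y, then has y in ker f^{n+1} = ker f^n. -/
theorem injective_of_surjective_ringHom {R : Type*} [CommRing R] [IsNoetherianRing R]
    (f : R →+* R) (hf : Function.Surjective f) : Function.Injective f := by
  have hsurj : ∀ n : ℕ, Function.Surjective (f ^ n) := by
    intro n
    rw [RingHom.coe_pow]
    exact hf.iterate n
  have hmono : Monotone fun n : ℕ => RingHom.ker (f ^ n) := by
    refine monotone_nat_of_le_succ fun n x hx => ?_
    rw [RingHom.mem_ker] at hx ⊢
    rw [pow_succ', RingHom.mul_def, RingHom.comp_apply, hx, map_zero]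
  obtain ⟨n, hn⟩ := monotone_stabilizes_iff_noetherian.mpr ‹IsNoetherianRing R›
    ⟨fun n : ℕ => RingHom.ker (f ^ n), hmono⟩
  rw [injective_iff_map_eq_zero]
  intro x hx
  obtain ⟨y, rfl⟩ := hsurj n x
  have h1 : y ∈ RingHom.ker (f ^ (n + 1)) := by
    rw [RingHom.mem_ker, pow_succ', RingHom.mul_def, RingHom.comp_apply, hx]
  have h2 : RingHom.ker (f ^ n) = RingHom.ker (f ^ (n + 1)) := hn (n + 1) (Nat.le_succ n)
  rw [← h2] at h1
  exact h1

/-- Algebraic independence of p_1, …, p_m in m variables. The symmetric polynomials are a polynomial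
ring in the e_i, so `psumHom` becomes a surjective endomorphism of a noetherian ring. -/
theorem psumHom_injective (m : ℕ) : Function.Injective (psumHom m) := by
  let e := AlgEquiv.ofBijective (esymmAlgHom (Fin m) ℝ m) (esymmAlgHom_fin_bijective ℝ m)
  have hsym : ∀ p, psumHom m p ∈ symmetricSubalgebra (Fin m) ℝ := by
    intro p
    induction p using MvPolynomial.induction_on with
    | C c => rw [psumHom, aeval_C]; exact Subalgebra.algebraMap_mem _ _
    | add p q hp hq => rw [map_add]; exact add_mem hp hq
    | mul_X p i hp =>
      rw [map_mul, psumHom, aeval_X]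
      exact mul_mem hp (psum_isSymmetric _ _ _)
  let f : MvPolynomial (Fin m) ℝ →ₐ[ℝ] MvPolynomial (Fin m) ℝ :=
    e.symm.toAlgHom.comp ((psumHom m).codRestrict _ hsym)
  have hf : Function.Surjective f := by
    intro p
    obtain ⟨q, hq⟩ := mem_range_psumHom (e p).2
    refine ⟨q, ?_⟩
    have : (psumHom m).codRestrict _ hsym q = e p := Subtype.ext hq
    change e.symm ((psumHom m).codRestrict _ hsym q) = p
    rw [this, AlgEquiv.symm_apply_apply]
  have hinj := injective_of_surjective_ringHom f.toRingHom hf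
  intro p q hpq
  refine hinj ?_
  change e.symm ((psumHom m).codRestrict _ hsym p) = e.symm ((psumHom m).codRestrict _ hsym q)
  congr 1
  exact Subtype.ext hpq

theorem finEval_rename (m : ℕ) (p : MvPolynomial (Fin m) ℝ) :
    finEval m (rename (fun i : Fin m => (i : ℕ)) p) = psumHom m p := by
  rw [finEval, aeval_rename, psumHom]
  rfl

/-- A polynomial involves only finitely many power sums, and these stay independent after
restriction to sufficiently many variables. -/
theorem theta_injective : Function.Injective theta := by
  rw [injective_iff_map_eq_zero]
  intro F hF
  obtain ⟨s, q, rfl⟩ := exists_finset_rename F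
  set m := s.sup id + 1
  have hs : ∀ x : { x // x ∈ s }, (x : ℕ) < m := fun x =>
    Nat.lt_succ_of_le (Finset.le_sup (f := id) x.2)
  have h1 : rename ((↑) : { x // x ∈ s } → ℕ) q = rename (fun i : Fin m => (i : ℕ))
      (rename (fun x : { x // x ∈ s } => (⟨x, hs x⟩ : Fin m)) q) := by
    rw [rename_rename]
    rfl
  have h2 := restrVars_theta m (rename ((↑) : { x // x ∈ s } → ℕ) q)
  rw [hF, map_zero, h1, finEval_rename] at h2
  have h3 : psumHom m (rename (fun x : { x // x ∈ s } => (⟨x, hs x⟩ : Fin m)) q) = 0 :=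
    coe_injective (Fin m) ℝ (by rw [← h2, coe_zero])
  rw [h1, (injective_iff_map_eq_zero _).mp (psumHom_injective m) _ h3, map_zero]

/-- The parts of the partition that corresponds to a monomial in the power sums. -/
def monoParts (d : ℕ →₀ ℕ) : Multiset ℕ := d.toMultiset.map (· + 1)

/-- The partition that corresponds to a monomial in the power sums. -/
def monoPartition {N : ℕ} (d : ℕ →₀ ℕ) (h : (monoParts d).sum = N) : Nat.Partition N where
  parts := monoParts d
  parts_pos := by
    intro i hi
    obtain ⟨a, -, rfl⟩ := Multiset.mem_map.mp hi
    exact Nat.succ_pos a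
  parts_sum := h

theorem theta_monomial {N : ℕ} (d : ℕ →₀ ℕ) (h : (monoParts d).sum = N) (c : ℝ) :
    theta (monomial d c) = c • psumProd (monoPartition d h) := by
  rw [theta, aeval_monomial, ← Algebra.smul_def]
  congr 1
  change _ = ((d.toMultiset.map (· + 1)).map HLUnitary.psum).prod
  rw [Multiset.map_map, Finsupp.toMultiset_map, Finsupp.prod_toMultiset,
    Finsupp.prod_mapDomain_index]
  · rfl
  · simp
  · intros; rw [pow_add]

theorem theta_monomial_mem (d : ℕ →₀ ℕ) (c : ℝ) :
    theta (monomial d c) ∈ symHom (monoParts d).sum := by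
  rw [theta_monomial d rfl c]
  exact Submodule.smul_mem _ _ (psumProd_mem_symHom _)

theorem coeff_embDomain_of_mem_sym (f : Sym) (σ : Equiv.Perm ℕ) (d : ℕ →₀ ℕ) :
    MvPowerSeries.coeff (d.embDomain σ.toEmbedding) (f : MvPowerSeries ℕ ℝ) =
      MvPowerSeries.coeff d (f : MvPowerSeries ℕ ℝ) := by
  have h1 := MvPowerSeries.coeff_embDomain_rename σ.toEmbedding (f : MvPowerSeries ℕ ℝ) d
  have h2 : MvPowerSeries.rename σ.toEmbedding (f : MvPowerSeries ℕ ℝ) = f := f.2.1 σ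
  rwa [h2] at h1

/-- A monomial of degree N involves at most N variables, and a permutation moves them among the
first N without changing the coefficient. -/
theorem eq_zero_of_restrVars_eq_zero {N : ℕ} {f : Sym} (hf : f ∈ symHom N)
    (h : restrVars N f = 0) : f = 0 := by
  apply Subtype.ext
  ext d
  by_contra hne
  have hd := hf d hne
  have hcard : d.support.card ≤ N := by
    rw [← hd, Finsupp.degree_apply, Finset.card_eq_sum_ones]
    exact Finset.sum_le_sum fun i hi => Nat.one_le_iff_ne_zero.mpr (Finsupp.mem_support_iff.mp hi)
  obtain ⟨g, hg⟩ := Equiv.Perm.exists_smul_eq_embedding (d.support.orderEmbOfFin rfl).toEmbedding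
    (Fin.valEmbedding : Fin d.support.card ↪ ℕ)
  have hsup : ∀ i ∈ d.support, g i < N := by
    intro i hi
    obtain ⟨k, rfl⟩ : i ∈ Set.range (d.support.orderEmbOfFin rfl) := by
      rw [Finset.range_orderEmbOfFin]; exact hi
    have := DFunLike.congr_fun hg k
    have h2 : g (d.support.orderEmbOfFin rfl k) = k := this
    rw [h2]
    exact k.2.trans_le hcard
  obtain ⟨e, he⟩ : ∃ e : Fin N →₀ ℕ, d.embDomain g.toEmbedding = e.embDomain Fin.valEmbedding := by
    refine ⟨(d.embDomain g.toEmbedding).comapDomain Fin.valEmbedding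
      (Fin.valEmbedding.injective.injOn), ?_⟩
    rw [Finsupp.embDomain_comapDomain]
    intro i hi
    rw [Finsupp.support_embDomain, Finset.mem_coe, Finset.mem_map] at hi
    obtain ⟨j, hj, rfl⟩ := hi
    exact ⟨⟨g j, hsup j hj⟩, rfl⟩
  apply hne
  rw [← coeff_embDomain_of_mem_sym f g, he, ← MvPowerSeries.coeff_killCompl]
  exact congrArg (MvPowerSeries.coeff e) h

theorem exists_polynomial_restrVars {N m : ℕ} {f : Sym} (hf : f ∈ symHom N) :
    ∃ g : MvPolynomial (Fin m) ℝ, g.IsSymmetric ∧ (g : MvPowerSeries (Fin m) ℝ) = restrVars m f := by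
  classical
  set s : Finset (Fin m →₀ ℕ) := Finset.finsuppAntidiag Finset.univ N with hs
  set c : (Fin m →₀ ℕ) → ℝ := fun d => MvPowerSeries.coeff d (restrVars m f) with hc
  have hdeg : ∀ d, c d ≠ 0 → d ∈ s := by
    intro d hd
    have h1 := hf (d.embDomain Fin.valEmbedding) hd
    rw [hs, Finset.mem_finsuppAntidiag]
    refine ⟨?_, Finset.subset_univ _⟩
    rw [← h1, Finsupp.embDomain_eq_mapDomain, Finsupp.degree_mapDomain, Finsupp.degree_eq_sum]
  have hcoeff : ∀ d, coeff d (∑ d ∈ s, monomial d (c d)) = c d := by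
    intro d
    rw [coeff_sum]
    simp only [coeff_monomial]
    rw [Finset.sum_ite_eq']
    split_ifs with h
    · rfl
    · by_contra h'
      exact h (hdeg d (Ne.symm h'))
  refine ⟨∑ d ∈ s, monomial d (c d), ?_, ?_⟩
  · intro σ
    ext d
    obtain ⟨e, rfl⟩ : ∃ e : Fin m →₀ ℕ, d = e.mapDomain σ :=
      ⟨d.mapDomain σ.symm, by rw [← Finsupp.mapDomain_comp]; simp [Finsupp.mapDomain_id]⟩
    rw [coeff_rename_mapDomain _ σ.injective, hcoeff, hcoeff]
    change MvPowerSeries.coeff (e.embDomain Fin.valEmbedding) (f : MvPowerSeries ℕ ℝ) =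
      MvPowerSeries.coeff ((e.mapDomain σ).embDomain Fin.valEmbedding) (f : MvPowerSeries ℕ ℝ)
    rw [← coeff_embDomain_of_mem_sym f (σ.viaEmbedding Fin.valEmbedding)]
    congr 1
    simp only [Finsupp.embDomain_eq_mapDomain, ← Finsupp.mapDomain_comp]
    congr 2
    funext i
    exact Equiv.Perm.viaEmbedding_apply σ Fin.valEmbedding i
  · ext d
    rw [coeff_coe, hcoeff]

/-- The restriction of f to N variables is a polynomial in p_1, …, p_N; its part of weight N, lifted
to Sym, has the same restriction as f and hence equals f. Other weights contribute nothing in degree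
N. -/
theorem symHom_le_span (N : ℕ) :
    symHom N ≤ Submodule.span ℝ (Set.range fun ρ : Nat.Partition N => psumProd ρ) := by
  intro f hf
  obtain ⟨g, hgs, hg⟩ := exists_polynomial_restrVars (m := N) hf
  obtain ⟨p, hp⟩ := mem_range_psumHom hgs
  set G : Lam := rename (fun i : Fin N => (i : ℕ)) p with hG
  have hGg : finEval N G = g := (finEval_rename N p).trans hp
  set H : Sym := ∑ d ∈ G.support with (monoParts d).sum = N, theta (monomial d (coeff d G)) with hH
  have hH1 : H ∈ Submodule.span ℝ (Set.range fun ρ : Nat.Partition N => psumProd ρ) := by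
    refine sum_mem fun d hd => ?_
    rw [theta_monomial d (Finset.mem_filter.mp hd).2]
    exact Submodule.smul_mem _ _ (Submodule.subset_span ⟨_, rfl⟩)
  have hH2 : H ∈ symHom N := by
    refine sum_mem fun d hd => ?_
    have := theta_monomial_mem d (coeff d G)
    rwa [(Finset.mem_filter.mp hd).2] at this
  suffices hz : f - H = 0 by rwa [sub_eq_zero.mp hz]
  refine eq_zero_of_restrVars_eq_zero (sub_mem hf hH2) ?_
  rw [map_sub, ← hg, ← hGg, ← restrVars_theta, ← map_sub]
  have hK : theta G - H = ∑ d ∈ G.support with ¬ (monoParts d).sum = N,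
      theta (monomial d (coeff d G)) := by
    rw [sub_eq_iff_eq_add', hH, Finset.sum_filter_add_sum_filter_not, ← map_sum, ← as_sum]
  ext e
  by_contra hne
  have h1 : (e.embDomain Fin.valEmbedding).degree = N := by
    by_contra hN
    apply hne
    rw [map_sub, map_sub, restrVars_theta, hGg, hg]
    change MvPowerSeries.coeff (e.embDomain Fin.valEmbedding) (f : MvPowerSeries ℕ ℝ) -
      MvPowerSeries.coeff (e.embDomain Fin.valEmbedding) (H : MvPowerSeries ℕ ℝ) = 0
    rw [not_ne_iff.mp fun h => hN (hf _ h), not_ne_iff.mp fun h => hN (hH2 _ h), sub_zero]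
  apply hne
  rw [hK, map_sum, map_sum]
  refine Finset.sum_eq_zero fun d hd => ?_
  by_contra h2
  exact (Finset.mem_filter.mp hd).2 ((theta_monomial_mem d (coeff d G) _ h2).symm.trans h1)

theorem psumProd_eq_theta {N : ℕ} (ρ : Nat.Partition N) :
    psumProd ρ = theta (ρ.parts.map fun k => (X (k - 1) : Lam)).prod := by
  rw [psumProd, map_multiset_prod, Multiset.map_map]
  congr 1
  refine Multiset.map_congr rfl fun k hk => ?_
  rw [Function.comp_apply, theta, aeval_X, Nat.sub_add_cancel (ρ.parts_pos hk)]

theorem symPar_le_range (ε : Fin 2) : SymPar ε ≤ LinearMap.range theta.toLinearMap := by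
  refine iSup_le fun n => (symHom_le_span _).trans (Submodule.span_le.mpr ?_)
  rintro _ ⟨ρ, rfl⟩
  exact ⟨_, (psumProd_eq_theta ρ).symm⟩

/-- The specialization `p₂ ↦ 1`, `pₙ ↦ 0` for `n ≠ 2`. -/
def evalTwo : Lam →ₐ[ℝ] ℝ := aeval fun n => if n = 1 then 1 else 0

theorem evalTwo_X (n : ℕ) : evalTwo (X n) = if n = 1 then 1 else 0 := aeval_X _ _

/-- The functional on polynomials in the power sums that induces `Φ`. -/
def lamFunctional (ε : Fin 2) : Lam →ₗ[ℝ] ℝ :=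
  -- In the odd case ∂/∂p_1 followed by p_1 = 0 selects the monomials that contain p_1 exactly once.
  if ε = 0 then evalTwo.toLinearMap else evalTwo.toLinearMap ∘ₗ (pderiv 0).toLinearMap

theorem lamFunctional_X_mul (ε : Fin 2) (F : Lam) :
    lamFunctional ε (X 1 * F) = lamFunctional ε F := by
  rw [lamFunctional]
  split_ifs with h
  · simp [evalTwo_X]
  · simp [evalTwo_X, pderiv_X]

theorem evalTwo_prod {s : Multiset ℕ} (hs : ∀ k ∈ s, 0 < k) :
    evalTwo (s.map fun k => (X (k - 1) : Lam)).prod =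
      if s = Multiset.replicate s.card 2 then 1 else 0 := by
  rw [map_multiset_prod, Multiset.map_map]
  simp only [Multiset.eq_replicate_card]
  split_ifs with h
  · refine Multiset.prod_eq_one fun x hx => ?_
    obtain ⟨k, hk, rfl⟩ := Multiset.mem_map.mp hx
    simp [h k hk, evalTwo_X]
  · push Not at h
    obtain ⟨k, hk, hk2⟩ := h
    refine Multiset.prod_eq_zero (Multiset.mem_map.mpr ⟨k, hk, ?_⟩)
    have := hs k hk
    simp only [Function.comp_apply, evalTwo_X]
    rw [if_neg (by omega)]

theorem lamFunctional_prod (ε : Fin 2) {n : ℕ} {s : Multiset ℕ} (hpos : ∀ k ∈ s, 0 < k)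
    (hsum : s.sum = 2 * n + ε) :
    lamFunctional ε (s.map fun k => (X (k - 1) : Lam)).prod =
      if s = Multiset.replicate n 2 + Multiset.replicate (ε : ℕ) 1 then 1 else 0 := by
  have key : ∀ {u : Multiset ℕ}, u.sum = 2 * n →
      (u = Multiset.replicate u.card 2 ↔ u = Multiset.replicate n 2) := by
    intro u hu
    constructor
    · intro h
      rw [h, Multiset.sum_replicate, smul_eq_mul] at hu
      rwa [show u.card = n by omega] at h
    · rintro rfl
      simp
  fin_cases ε
  · simp only [lamFunctional, Fin.zero_eta, if_true, AlgHom.toLinearMap_apply]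
    rw [evalTwo_prod hpos]
    simp only [Multiset.replicate_zero, add_zero] at hsum ⊢
    exact if_congr (key hsum) rfl rfl
  · simp only [Fin.mk_one] at hsum ⊢
    have hdef : ∀ F, lamFunctional 1 F = evalTwo (pderiv 0 F) := fun F => rfl
    rw [hdef]
    by_cases h1 : 1 ∈ s
    · obtain ⟨u, rfl⟩ := Multiset.exists_cons_of_mem h1
      have e0 : evalTwo (X 0) = 0 := by simp [evalTwo_X]
      rw [Multiset.map_cons, Multiset.prod_cons, pderiv_mul, map_add, map_mul, map_mul,
        Nat.sub_self, e0, pderiv_X, zero_mul, add_zero, Pi.single_eq_same, map_one, one_mul,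
        evalTwo_prod fun k hk => hpos k (Multiset.mem_cons_of_mem hk)]
      rw [Multiset.sum_cons] at hsum
      refine if_congr ?_ rfl rfl
      rw [Multiset.replicate_one, ← Multiset.singleton_add, add_comm {1}, add_left_inj]
      exact key (by omega)
    · rw [if_neg]
      · have : pderiv 0 (s.map fun k => (X (k - 1) : Lam)).prod = 0 := by
          have h2 : ∀ k ∈ s, k ≠ 1 ∧ 0 < k := fun k hk => ⟨fun h => h1 (h ▸ hk), hpos k hk⟩
          clear h1 hsum hpos
          induction s using Multiset.induction_on with
          | empty => simp
          | cons a s ih =>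
            rw [Multiset.map_cons, Multiset.prod_cons, pderiv_mul,
              ih fun k hk => h2 k (Multiset.mem_cons_of_mem hk), pderiv_X]
            have := h2 a (Multiset.mem_cons_self a s)
            rw [Pi.single_eq_of_ne (by omega)]
            simp
        rw [this, map_zero]
      · intro h
        apply h1
        rw [h]
        simp

/-- The functionals `Φ_E` and `Φ_O`. -/
def plancherel (ε : Fin 2) : SymPar ε →ₗ[ℝ] ℝ :=
  lamFunctional ε ∘ₗ (LinearEquiv.ofInjective theta.toLinearMap theta_injective).symm.toLinearMap ∘ₗ
    Submodule.inclusion (symPar_le_range ε)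

theorem plancherel_apply (ε : Fin 2) {F : Lam} {f : SymPar ε} (h : (f : Sym) = theta F) :
    plancherel ε f = lamFunctional ε F := by
  have h1 : Submodule.inclusion (symPar_le_range ε) f =
      LinearEquiv.ofInjective theta.toLinearMap theta_injective F := Subtype.ext h
  rw [plancherel, LinearMap.comp_apply, LinearMap.comp_apply, h1, LinearEquiv.coe_coe,
    LinearEquiv.symm_apply_apply]

theorem isPlancherelFunctional_plancherel (ε : Fin 2) :
    IsPlancherelFunctional ε (plancherel ε) := by
  intro n ρ
  rw [plancherel_apply ε (psumProd_eq_theta ρ : (psumPar ε ρ : Sym) = _), lamFunctional_prod ε (fun k hk => ρ.parts_pos hk)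
    ρ.parts_sum]

theorem IsPlancherelFunctional.unique {ε : Fin 2} {Φ Φ' : SymPar ε →ₗ[ℝ] ℝ}
    (h : IsPlancherelFunctional ε Φ) (h' : IsPlancherelFunctional ε Φ') : Φ = Φ' := by
  have hle : SymPar ε ≤ (LinearMap.eqLocus Φ Φ').map (SymPar ε).subtype := by
    refine iSup_le fun n => (symHom_le_span _).trans (Submodule.span_le.mpr ?_)
    rintro _ ⟨ρ, rfl⟩
    exact ⟨psumPar ε ρ, (h n ρ).trans (h' n ρ).symm, rfl⟩
  ext f
  obtain ⟨g, hg, hgf⟩ := hle f.2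
  rw [← Subtype.ext (a1 := g) (a2 := f) hgf]
  exact hg

theorem plancherel_pTwoMul (ε : Fin 2) (F : SymPar ε) :
    plancherel ε (pTwoMul ε F) = plancherel ε F := by
  obtain ⟨G, hG⟩ := symPar_le_range ε F.2
  have hG' : (F : Sym) = theta G := hG.symm
  rw [plancherel_apply ε hG', ← lamFunctional_X_mul, plancherel_apply]
  rw [map_mul, ← hG', theta, aeval_X]
  rfl

end HLUnitary

end

/-! ### Hall–Littlewood polynomials in finitely many variables -/

noncomputable section

namespace HLUnitary

open MvPolynomial

section Arrangements

variable {𝔽 ι : Type*} [Field 𝔽] [DecidableEq ι]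

/-- `∏_{j ∈ S, j ≠ i} (x i - t x j) / (x i - x j)`. -/
def hlWeight (x : ι → 𝔽) (t : 𝔽) (S : Finset ι) (i : ι) : 𝔽 :=
  ∏ j ∈ S.erase i, (x i - t * x j) / (x i - x j)

variable {x : ι → 𝔽} (hx : Function.Injective x) (t : 𝔽)

theorem hlWeight_insert {S : Finset ι} {i k : ι} (hi : i ∈ S) (hk : k ∉ S) :
    hlWeight x t (insert k S) i = hlWeight x t S i * ((x i - t * x k) / (x i - x k)) := by
  have hik : k ≠ i := fun h => hk (h ▸ hi)
  rw [hlWeight, Finset.erase_insert_of_ne hik, Finset.prod_insert, mul_comm]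
  · rfl
  · exact fun h => hk (Finset.mem_of_mem_erase h)

theorem hlWeight_insert_self {S : Finset ι} {k : ι} (hk : k ∉ S) :
    hlWeight x t (insert k S) k = ∏ j ∈ S, (x k - t * x j) / (x k - x j) := by
  rw [hlWeight, Finset.erase_insert hk]

include hx

/-- The partial fraction expansion of the left side in z: simple poles at the x_i, and value 1 at
infinity. -/
theorem prod_div_eq_one_add_sum (S : Finset ι) {z : 𝔽} (hz : ∀ i ∈ S, z ≠ x i) :
    ∏ j ∈ S, (z - t * x j) / (z - x j) =
      1 + (1 - t) * ∑ i ∈ S, x i * hlWeight x t S i / (z - x i) := by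
  induction S using Finset.induction_on generalizing z with
  | empty => simp
  | insert k S hk ih =>
    have hzk : z - x k ≠ 0 := sub_ne_zero.mpr (hz k (Finset.mem_insert_self k S))
    have hks : ∀ i ∈ S, x k - x i ≠ 0 := fun i hi =>
      sub_ne_zero.mpr fun h => hk (hx h ▸ hi)
    rw [Finset.prod_insert hk, Finset.sum_insert hk, hlWeight_insert_self t hk,
      ih fun i hi => hz i (Finset.mem_insert_of_mem hi), ih fun i hi h => hks i hi (by rw [h, sub_self])]
    have e : ∀ i ∈ S, x i * hlWeight x t (insert k S) i / (z - x i) =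
        (z - t * x k) / (z - x k) * (x i * hlWeight x t S i / (z - x i)) -
          (1 - t) * x k / (z - x k) * (x i * hlWeight x t S i / (x k - x i)) := by
      intro i hi
      have h1 : z - x i ≠ 0 := sub_ne_zero.mpr (hz i (Finset.mem_insert_of_mem hi))
      have h2 := hks i hi
      have h3 : x i - x k ≠ 0 := by rw [← neg_sub]; exact neg_ne_zero.mpr h2
      rw [hlWeight_insert t hi hk]
      have e2 : (x i - t * x k) / (x i - x k) / (z - x i) = (z - t * x k) / (z - x k) / (z - x i) -
          (1 - t) * x k / (z - x k) / (x k - x i) := by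
        field_simp
        ring
      linear_combination x i * hlWeight x t S i * e2
    rw [Finset.sum_congr rfl e, Finset.sum_sub_distrib, ← Finset.mul_sum, ← Finset.mul_sum]
    field_simp
    ring

/-- When a variable x_k is added, the correction terms are those of the partial fraction expansion
at z = x_k, and what remains is the recursion of 1 + t + ⋯ + t^{n-1}. -/
theorem sum_hlWeight (S : Finset ι) :
    ∑ i ∈ S, hlWeight x t S i = ∑ i ∈ Finset.range S.card, t ^ i := by
  induction S using Finset.induction_on with
  | empty => simp
  | insert k S hk ih =>
    have hks : ∀ i ∈ S, x k - x i ≠ 0 := fun i hi =>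
      sub_ne_zero.mpr fun h => hk (hx h ▸ hi)
    have e : ∀ i ∈ S, hlWeight x t (insert k S) i =
        t * hlWeight x t S i - (1 - t) * (x i * hlWeight x t S i / (x k - x i)) := by
      intro i hi
      have h2 := hks i hi
      have h3 : x i - x k ≠ 0 := by rw [← neg_sub]; exact neg_ne_zero.mpr h2
      rw [hlWeight_insert t hi hk]
      field_simp
      ring
    rw [Finset.sum_insert hk, hlWeight_insert_self t hk, Finset.sum_congr rfl e,
      prod_div_eq_one_add_sum hx t S fun i hi h => hks i hi (by rw [h, sub_self]),
      Finset.sum_sub_distrib, ← Finset.mul_sum, ← Finset.mul_sum, ih, Finset.card_insert_of_notMem hk,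
      geom_sum_succ]
    ring

omit hx

/-- The nonzero entries of an exponent vector. -/
def expParts (S : Finset ι) (α : ι → ℕ) : Multiset ℕ := (S.val.map α).filter fun k => k ≠ 0

/-- The term of the Hall–Littlewood polynomial that corresponds to an exponent vector. -/
def hlTerm (x : ι → 𝔽) (t : 𝔽) (S : Finset ι) (α : ι → ℕ) : 𝔽 :=
  (∏ i ∈ S, x i ^ α i) *
    ∏ i ∈ S, ∏ j ∈ S, if α j < α i then (x i - t * x j) / (x i - x j) else 1

theorem expParts_of_mem {S : Finset ι} {i : ι} (hi : i ∈ S) {α : ι → ℕ} (h0 : α i ≠ 0) :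
    expParts S α = α i ::ₘ expParts (S.erase i) α := by
  have h1 : S.val = i ::ₘ (S.erase i).val := by
    rw [Finset.erase_val, Multiset.cons_erase hi]
  rw [expParts, h1, Multiset.map_cons, Multiset.filter_cons_of_pos (p := fun k => k ≠ 0) _ h0, expParts]

omit [DecidableEq ι] in
theorem expParts_congr {S : Finset ι} {α β : ι → ℕ} (h : ∀ i ∈ S, α i = β i) :
    expParts S α = expParts S β := by
  rw [expParts, expParts, Multiset.map_congr rfl fun i hi => h i hi]

omit [DecidableEq ι] in
theorem hlTerm_congr {S : Finset ι} {α β : ι → ℕ} (h : ∀ i ∈ S, α i = β i) :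
    hlTerm x t S α = hlTerm x t S β := by
  rw [hlTerm, hlTerm]
  congr 1
  · exact Finset.prod_congr rfl fun i hi => by rw [h i hi]
  · exact Finset.prod_congr rfl fun i hi => Finset.prod_congr rfl fun j hj => by
      rw [h i hi, h j hj]

/-- The weight of i in S has a factor for every other j. Those with smaller exponent belong to the
term of α already; those with the same maximal exponent do not, and make up the extra weight on the
left. -/
theorem hlTerm_of_max {S : Finset ι} {i : ι} (hi : i ∈ S) {α : ι → ℕ}
    (hmax : ∀ j ∈ S, α j ≤ α i) :
    hlWeight x t (S.filter fun j => α j = α i) i * hlTerm x t S α =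
      x i ^ α i * hlWeight x t S i * hlTerm x t (S.erase i) α := by
  have h1 : ∀ f : ι → 𝔽, ∏ j ∈ S, f j = f i * ∏ j ∈ S.erase i, f j := fun f =>
    (Finset.mul_prod_erase S f hi).symm
  have h2 : (∏ k ∈ S.erase i, ∏ j ∈ S, if α j < α k then (x k - t * x j) / (x k - x j) else 1) =
      ∏ k ∈ S.erase i, ∏ j ∈ S.erase i, if α j < α k then (x k - t * x j) / (x k - x j) else 1 := by
    refine Finset.prod_congr rfl fun k hk => ?_
    rw [h1, if_neg (not_lt.mpr (hmax k (Finset.mem_of_mem_erase hk))), one_mul]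
  have h3 : hlWeight x t S i = hlWeight x t (S.filter fun j => α j = α i) i *
      ∏ j ∈ S.erase i, if α j < α i then (x i - t * x j) / (x i - x j) else 1 := by
    rw [hlWeight, hlWeight, ← Finset.filter_erase, Finset.prod_filter, ← Finset.prod_mul_distrib]
    refine Finset.prod_congr rfl fun j hj => ?_
    rcases (hmax j (Finset.mem_of_mem_erase hj)).lt_or_eq with h | h
    · rw [if_neg h.ne, if_pos h, one_mul]
    · rw [if_pos h, if_neg h.not_lt, mul_one]
  rw [hlTerm, hlTerm, h1 fun j => x j ^ α j,
    h1 fun k => ∏ j ∈ S, if α j < α k then (x k - t * x j) / (x k - x j) else 1, h2, h3,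
    h1 fun j => if α j < α i then (x i - t * x j) / (x i - x j) else 1, if_neg (lt_irrefl _)]
  ring

variable [Fintype ι]

/-- The exponent vectors supported in `S` with entries at most `N`. -/
def expVectors (S : Finset ι) (N : ℕ) : Finset (ι → ℕ) :=
  Fintype.piFinset fun i => if i ∈ S then Finset.range (N + 1) else {0}

theorem mem_expVectors {S : Finset ι} {N : ℕ} {α : ι → ℕ} :
    α ∈ expVectors S N ↔ (∀ i ∈ S, α i ≤ N) ∧ ∀ i ∉ S, α i = 0 := by
  rw [expVectors, Fintype.mem_piFinset]
  constructor
  · intro h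
    refine ⟨fun i hi => ?_, fun i hi => ?_⟩
    · have := h i
      rw [if_pos hi, Finset.mem_range] at this
      omega
    · have := h i
      rwa [if_neg hi, Finset.mem_singleton] at this
  · rintro ⟨h1, h2⟩ i
    split_ifs with hi
    · rw [Finset.mem_range]
      have := h1 i hi
      omega
    · rw [Finset.mem_singleton]
      exact h2 i hi

/-- The Hall–Littlewood polynomial in the variables `x i`, `i ∈ S`. -/
def hlSum (x : ι → 𝔽) (t : 𝔽) (N : ℕ) (S : Finset ι) (s : Multiset ℕ) : 𝔽 :=
  ∑ α ∈ expVectors S N with expParts S α = s, hlTerm x t S α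

theorem hlSum_zero (N : ℕ) (S : Finset ι) : hlSum x t N S 0 = 1 := by
  have h : (expVectors S N).filter (fun α => expParts S α = 0) = {0} := by
    ext α
    rw [Finset.mem_filter, Finset.mem_singleton, mem_expVectors]
    constructor
    · rintro ⟨⟨-, h1⟩, h2⟩
      funext i
      by_cases hi : i ∈ S
      · rw [expParts, Multiset.filter_eq_nil] at h2
        have := h2 (α i) (Multiset.mem_map_of_mem α hi)
        simpa using this
      · exact h1 i hi
    · rintro rfl
      refine ⟨⟨by simp, by simp⟩, ?_⟩
      rw [expParts, Multiset.filter_eq_nil]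
      intro k hk
      obtain ⟨i, -, rfl⟩ := Multiset.mem_map.mp hk
      simp
  rw [hlSum, h, Finset.sum_singleton]
  simp [hlTerm]

include hx in
-- Double counting of pairs of an exponent vector and a position i where it takes its maximal value
-- r. Summation over i for a fixed vector gives a Gaussian integer by `sum_hlWeight`; for a fixed i
-- the entry at i is deleted.
theorem sum_hlWeight_mul_hlSum {N r : ℕ} (hr : r ≠ 0) (hrN : r ≤ N) {s : Multiset ℕ}
    (hs : ∀ k ∈ s, k ≤ r) (S : Finset ι) :
    ∑ i ∈ S, x i ^ r * hlWeight x t S i * hlSum x t N (S.erase i) s =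
      (∑ i ∈ Finset.range ((r ::ₘ s).count r), t ^ i) * hlSum x t N S (r ::ₘ s) := by
  have hR : (∑ i ∈ Finset.range ((r ::ₘ s).count r), t ^ i) * hlSum x t N S (r ::ₘ s) =
      ∑ α ∈ expVectors S N with expParts S α = r ::ₘ s, ∑ i ∈ S with α i = r,
        hlWeight x t (S.filter fun j => α j = r) i * hlTerm x t S α := by
    rw [hlSum, Finset.mul_sum]
    refine Finset.sum_congr rfl fun α hα => ?_
    rw [← Finset.sum_mul, sum_hlWeight hx]
    congr 3
    rw [← (Finset.mem_filter.mp hα).2, expParts, Multiset.count_filter_of_pos (p := fun k => k ≠ 0) hr,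
      Multiset.count_map, Finset.card_def, Finset.filter_val]
    simp only [eq_comm]
  rw [hR, Finset.sum_congr rfl fun α _ => Finset.sum_filter _ _, Finset.sum_comm]
  refine Finset.sum_congr rfl fun i hi => ?_
  rw [← Finset.sum_filter, hlSum, Finset.mul_sum, Finset.filter_filter]
  -- Vectors supported in S without i have the entry 0 at i, so deletion of the part r means
  -- resetting that entry to 0.
  refine Finset.sum_bij' (fun α _ => Function.update α i r) (fun α _ => Function.update α i 0)
    ?_ ?_ ?_ ?_ ?_
  · intro α hα
    rw [Finset.mem_filter, mem_expVectors] at hα ⊢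
    refine ⟨⟨fun j hj => ?_, fun j hj => ?_⟩, ?_, ?_⟩
    · by_cases hji : j = i
      · subst hji; simpa using hrN
      · rw [Function.update_of_ne hji]
        exact hα.1.1 j (Finset.mem_erase.mpr ⟨hji, hj⟩)
    · have hji : j ≠ i := fun h => hj (h ▸ hi)
      rw [Function.update_of_ne hji]
      exact hα.1.2 j fun h => hj (Finset.mem_of_mem_erase h)
    · rw [expParts_of_mem hi (by simpa using hr), Function.update_self, ← hα.2]
      congr 1
      exact expParts_congr fun j hj => Function.update_of_ne (Finset.ne_of_mem_erase hj) _ _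
    · simp
  · intro α hα
    rw [Finset.mem_filter, mem_expVectors] at hα ⊢
    refine ⟨⟨fun j hj => ?_, fun j hj => ?_⟩, ?_⟩
    · rw [Function.update_of_ne (Finset.ne_of_mem_erase hj)]
      exact hα.1.1 j (Finset.mem_of_mem_erase hj)
    · by_cases hji : j = i
      · subst hji; simp
      · rw [Function.update_of_ne hji]
        exact hα.1.2 j fun h => hj (Finset.mem_erase.mpr ⟨hji, h⟩)
    · have h1 := hα.2.1
      rw [expParts_of_mem hi (by rw [hα.2.2]; exact hr), hα.2.2, Multiset.cons_inj_right] at h1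
      rw [← h1]
      exact expParts_congr fun j hj => Function.update_of_ne (Finset.ne_of_mem_erase hj) _ _
  · intro α hα
    rw [Finset.mem_filter, mem_expVectors] at hα
    simp only [Function.update_idem]
    rw [Function.update_eq_self_iff]
    exact (hα.1.2 i (Finset.notMem_erase i S)).symm
  · intro α hα
    rw [Finset.mem_filter] at hα
    simp only [Function.update_idem]
    rw [Function.update_eq_self_iff]
    exact hα.2.2.symm
  · intro α hα
    rw [Finset.mem_filter, mem_expVectors] at hα
    have hmax : ∀ j ∈ S, Function.update α i r j ≤ Function.update α i r i := by
      intro j hj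
      rw [Function.update_self]
      by_cases hji : j = i
      · subst hji; simp
      · rw [Function.update_of_ne hji]
        by_cases h0 : α j = 0
        · omega
        · refine hs _ ?_
          rw [← hα.2, expParts, Multiset.mem_filter]
          exact ⟨Multiset.mem_map_of_mem α (Finset.mem_erase.mpr ⟨hji, hj⟩), h0⟩
    have h := hlTerm_of_max (x := x) t hi hmax
    rw [Function.update_self] at h
    rw [h]
    congr 1
    exact hlTerm_congr t fun j hj => (Function.update_of_ne (Finset.ne_of_mem_erase hj) _ _).symm

end Arrangements

/-! ### Vertex operators after evaluation at finitely many variables -/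

section Evaluation

variable {𝔽 ι : Type*} [Field 𝔽] [Algebra ℝ 𝔽] [DecidableEq ι]

/-- Evaluation of the power sums at the variables `x i`, `i ∈ S`. -/
def evalVars (x : ι → 𝔽) (S : Finset ι) : Lam →ₐ[ℝ] 𝔽 := aeval fun n => ∑ i ∈ S, x i ^ (n + 1)

omit [DecidableEq ι] in
theorem evalVars_X (x : ι → 𝔽) (S : Finset ι) (n : ℕ) :
    evalVars x S (X n) = ∑ i ∈ S, x i ^ (n + 1) := aeval_X _ _

/-- This is `hlSeries_sub` with z = x_k: removing the variable x_k subtracts its powers from the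
power sums. -/
theorem evalVars_qFun_insert (x : ι → 𝔽) (t : ℝ) {S : Finset ι} {k : ι} (hk : k ∉ S) (r : ℕ) :
    evalVars x (insert k S) (qFun t ((r + 1 : ℕ) : ℤ)) =
      x k * evalVars x (insert k S) (qFun t (r : ℤ)) + evalVars x S (qFun t ((r + 1 : ℕ) : ℤ)) -
        algebraMap ℝ 𝔽 t * x k * evalVars x S (qFun t (r : ℤ)) := by
  have key := congrArg (PowerSeries.coeff (r + 1)) (hlSeries_sub t
    (fun n => evalVars x (insert k S) (X n)) (fun n => evalVars x S (X n)) (x k) fun n => by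
      simp only [evalVars_X]
      rw [Finset.sum_insert hk, add_sub_cancel_left])
  rw [sub_mul, sub_mul, one_mul, one_mul, mul_assoc, mul_assoc, map_sub, map_sub,
    PowerSeries.coeff_C_mul, PowerSeries.coeff_C_mul] at key
  simp only [hlSeries, PowerSeries.coeff_mk, PowerSeries.coeff_succ_X_mul, ← map_hlCoeff,
    ← qFun_natCast] at key
  rw [Algebra.smul_def] at key
  linear_combination -key

variable {x : ι → 𝔽} (hx : Function.Injective x) (t : ℝ)

include hx

/-- Both sides obey the same recursion when a variable is added. The start r = 1 is separate: q_0 =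
1 is not given by the formula, and `sum_hlWeight` makes up for it. -/
theorem evalVars_qFun (S : Finset ι) {r : ℕ} (hr : r ≠ 0) :
    evalVars x S (qFun t (r : ℤ)) =
      (1 - algebraMap ℝ 𝔽 t) * ∑ i ∈ S, x i ^ r * hlWeight x (algebraMap ℝ 𝔽 t) S i := by
  induction S using Finset.induction_on generalizing r with
  | empty =>
    rw [qFun_natCast, map_hlCoeff]
    have h := congrArg (PowerSeries.coeff r) (hlSeries_zero (R := 𝔽) t)
    rw [hlSeries, PowerSeries.coeff_mk, PowerSeries.coeff_one, if_neg hr] at h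
    simpa [evalVars_X] using h
  | insert k S hk ih =>
    set τ := algebraMap ℝ 𝔽 t
    have hks : ∀ i ∈ S, x i - x k ≠ 0 := fun i hi => sub_ne_zero.mpr fun h => hk (hx h ▸ hi)
    have hY : ∀ r : ℕ, ∑ i ∈ insert k S, x i ^ (r + 1) * hlWeight x τ (insert k S) i =
        x k * ∑ i ∈ insert k S, x i ^ r * hlWeight x τ (insert k S) i +
          ∑ i ∈ S, x i ^ (r + 1) * hlWeight x τ S i -
            τ * x k * ∑ i ∈ S, x i ^ r * hlWeight x τ S i := by
      intro r
      rw [Finset.sum_insert hk, Finset.sum_insert hk, mul_add, Finset.mul_sum, Finset.mul_sum,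
        add_assoc, add_sub_assoc, ← Finset.sum_add_distrib, ← Finset.sum_sub_distrib]
      congr 1
      · ring
      · refine Finset.sum_congr rfl fun i hi => ?_
        have h3 := hks i hi
        rw [hlWeight_insert τ hi hk]
        field_simp
        ring
    obtain ⟨r, rfl⟩ : ∃ r', r = r' + 1 := ⟨r - 1, by omega⟩
    clear hr
    induction r with
    | zero =>
      rw [evalVars_qFun_insert x t hk, ih (r := 0 + 1) (by omega), hY]
      simp only [Nat.cast_zero, qFun_zero, map_one, pow_zero, one_mul, sum_hlWeight hx τ,
        Finset.card_insert_of_notMem hk]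
      have h1 := geom_sum_mul_neg τ (S.card + 1)
      have h2 := geom_sum_mul_neg τ S.card
      linear_combination -x k * h1 + τ * x k * h2
    | succ r ihr =>
      rw [evalVars_qFun_insert x t hk, ihr, ih (r := r + 1 + 1) (by omega),
        ih (r := r + 1) (by omega), hY (r + 1)]
      ring

/-- Subtracting x_i^n from each p_n amounts to omitting the variable x_i, so the rule `jing_X_mul`
becomes an identity for each summand. -/
theorem evalVars_jing (S : Finset ι) {r : ℕ} (hr : r ≠ 0) (F : Lam) :
    evalVars x S (jing t r F) = (1 - algebraMap ℝ 𝔽 t) *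
      ∑ i ∈ S, x i ^ r * hlWeight x (algebraMap ℝ 𝔽 t) S i * evalVars x (S.erase i) F := by
  induction F using MvPolynomial.induction_on generalizing r with
  | C c =>
    rw [jing_C, map_smul, evalVars_qFun hx t S hr, Algebra.smul_def, ← algebraMap_eq]
    simp only [AlgHom.commutes]
    rw [← Finset.sum_mul]
    ring
  | add p q hp hq =>
    simp only [map_add, mul_add, Finset.sum_add_distrib, hp hr, hq hr]
  | mul_X p n hp =>
    have e : ((r : ℤ) + n + 1) = ((r + n + 1 : ℕ) : ℤ) := by push_cast; ring
    rw [mul_comm p, jing_X_mul, map_sub, map_mul, hp hr, e, hp (by omega), mul_left_comm, ← mul_sub,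
      Finset.mul_sum, ← Finset.sum_sub_distrib]
    congr 1
    refine Finset.sum_congr rfl fun i hi => ?_
    have h1 : evalVars x (S.erase i) (X n) = evalVars x S (X n) - x i ^ (n + 1) := by
      rw [evalVars_X, evalVars_X, ← Finset.add_sum_erase S _ hi, add_sub_cancel_left]
    rw [map_mul, h1]
    ring

/-- The multiset in which `a` has multiplicity `m a` for `1 ≤ a ≤ K`. -/
def multMultiset (m : ℕ → ℕ) : ℕ → Multiset ℕ
  | 0 => 0
  | K + 1 => Multiset.replicate (m (K + 1)) (K + 1) + multMultiset m K

omit hx in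
theorem le_of_mem_multMultiset {m : ℕ → ℕ} {K k : ℕ} (h : k ∈ multMultiset m K) : k ≤ K := by
  induction K with
  | zero => simp [multMultiset] at h
  | succ K ih =>
    rw [multMultiset, Multiset.mem_add] at h
    rcases h with h | h
    · exact (Multiset.eq_of_mem_replicate h).le
    · exact (ih h).trans (Nat.le_succ K)

variable [Fintype ι]

/-- Each B_{K+1} adjoins one more largest part. `sum_hlWeight_mul_hlSum` contributes the Gaussian
integer of its new multiplicity y + 1, and multiplied by 1 - t this is 1 - t^{y+1}, the next factor
of b_λ(t). -/
theorem evalVars_word (m : ℕ → ℕ) {K N : ℕ} (hK : K ≤ N) (S : Finset ι) :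
    evalVars x S (word t m K) =
      algebraMap ℝ 𝔽 (∏ a ∈ Finset.Icc 1 K, ∏ j ∈ Finset.Icc 1 (m a), (1 - t ^ j)) *
        hlSum x (algebraMap ℝ 𝔽 t) N S (multMultiset m K) := by
  induction K generalizing S with
  | zero => simp [word, multMultiset, hlSum_zero]
  | succ K ih =>
    rw [word, multMultiset, Finset.prod_Icc_succ_top (by omega)]
    generalize m (K + 1) = y
    induction y generalizing S with
    | zero => simpa using ih (by omega) S
    | succ y ihy =>
      have e : ((K : ℤ) + 1) = ((K + 1 : ℕ) : ℤ) := by push_cast; ring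
      rw [pow_succ', Module.End.mul_apply, e, evalVars_jing hx t S (Nat.succ_ne_zero K), ← e]
      simp only [ihy]
      have h1 : ∀ i, x i ^ (K + 1) * hlWeight x (algebraMap ℝ 𝔽 t) S i *
          (algebraMap ℝ 𝔽 ((∏ a ∈ Finset.Icc 1 K, ∏ j ∈ Finset.Icc 1 (m a), (1 - t ^ j)) *
            ∏ j ∈ Finset.Icc 1 y, (1 - t ^ j)) *
              hlSum x (algebraMap ℝ 𝔽 t) N (S.erase i)
                (Multiset.replicate y (K + 1) + multMultiset m K)) =
          algebraMap ℝ 𝔽 ((∏ a ∈ Finset.Icc 1 K, ∏ j ∈ Finset.Icc 1 (m a), (1 - t ^ j)) *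
            ∏ j ∈ Finset.Icc 1 y, (1 - t ^ j)) * (x i ^ (K + 1) *
              hlWeight x (algebraMap ℝ 𝔽 t) S i * hlSum x (algebraMap ℝ 𝔽 t) N (S.erase i)
                (Multiset.replicate y (K + 1) + multMultiset m K)) := fun i => by ring
      have hle : ∀ k ∈ Multiset.replicate y (K + 1) + multMultiset m K, k ≤ K + 1 := by
        intro k hk
        rw [Multiset.mem_add] at hk
        rcases hk with h | h
        · exact (Multiset.eq_of_mem_replicate h).le
        · exact (le_of_mem_multMultiset h).trans (Nat.le_succ K)
      have hcount : ((K + 1) ::ₘ (Multiset.replicate y (K + 1) + multMultiset m K)).count (K + 1) =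
          y + 1 := by
        rw [Multiset.count_cons_self, Multiset.count_add, Multiset.count_replicate_self,
          Multiset.count_eq_zero_of_notMem, add_zero]
        intro h
        have := le_of_mem_multMultiset h
        omega
      simp only [h1]
      rw [← Finset.mul_sum, sum_hlWeight_mul_hlSum hx _ (Nat.succ_ne_zero K) hK hle, hcount,
        Finset.prod_Icc_succ_top (by omega), Multiset.replicate_succ, Multiset.cons_add]
      have h2 := geom_sum_mul_neg (algebraMap ℝ 𝔽 t) (y + 1)
      simp only [map_mul, map_sub, map_one, map_pow]
      linear_combination (algebraMap ℝ 𝔽 (∏ a ∈ Finset.Icc 1 K, ∏ j ∈ Finset.Icc 1 (m a),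
        (1 - t ^ j)) * algebraMap ℝ 𝔽 (∏ j ∈ Finset.Icc 1 y, (1 - t ^ j)) *
          hlSum x (algebraMap ℝ 𝔽 t) N S
            ((K + 1) ::ₘ (Multiset.replicate y (K + 1) + multMultiset m K))) * h2

end Evaluation

end HLUnitary

end

/-! ### Identification of Q_λ with a word, and the statistic n(λ) -/

noncomputable section

namespace HLUnitary

open MvPolynomial

theorem count_multMultiset (m : ℕ → ℕ) (K a : ℕ) :
    (multMultiset m K).count a = if 1 ≤ a ∧ a ≤ K then m a else 0 := by
  induction K with
  | zero =>
    simp only [multMultiset, Multiset.count_zero]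
    split_ifs with h
    · omega
    · rfl
  | succ K ih =>
    rw [multMultiset, Multiset.count_add, ih, Multiset.count_replicate]
    split_ifs <;> first | omega | (subst_vars; omega)

theorem le_of_mem_parts {N : ℕ} (lam : Nat.Partition N) {a : ℕ} (ha : a ∈ lam.parts) : a ≤ N := by
  rw [← lam.parts_sum]
  exact Multiset.single_le_sum (fun _ _ => Nat.zero_le _) a ha

theorem multMultiset_count {N : ℕ} (lam : Nat.Partition N) :
    multMultiset (fun a => lam.parts.count a) N = lam.parts := by
  ext a
  rw [count_multMultiset]
  split_ifs with h
  · rfl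
  · symm
    rw [Multiset.count_eq_zero]
    intro ha
    exact h ⟨lam.parts_pos ha, le_of_mem_parts lam ha⟩

theorem bCoeff_eq (t : ℝ) {N : ℕ} (lam : Nat.Partition N) :
    bCoeff t lam = ∏ a ∈ Finset.Icc 1 N, ∏ j ∈ Finset.Icc 1 (lam.parts.count a), (1 - t ^ j) := by
  rw [bCoeff]
  refine Finset.prod_subset (fun a ha => ?_) fun a _ ha => ?_
  · rw [Multiset.mem_toFinset] at ha
    exact Finset.mem_Icc.mpr ⟨lam.parts_pos ha, le_of_mem_parts lam ha⟩
  · rw [Multiset.mem_toFinset] at ha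
    rw [Multiset.count_eq_zero_of_notMem ha]
    simp

theorem one_sub_pow_pos {t : ℝ} (h1 : -1 < t) (h2 : t < 1) {j : ℕ} (hj : j ≠ 0) :
    0 < 1 - t ^ j := by
  have h3 : |t| ^ j < 1 := pow_lt_one₀ (abs_nonneg t) (abs_lt.mpr ⟨h1, h2⟩) hj
  have h4 : t ^ j ≤ |t| ^ j := by rw [← abs_pow]; exact le_abs_self _
  linarith

theorem bCoeff_ne_zero {t : ℝ} (h1 : -1 < t) (h2 : t < 1) {N : ℕ} (lam : Nat.Partition N) :
    bCoeff t lam ≠ 0 := by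
  rw [bCoeff]
  refine Finset.prod_ne_zero_iff.mpr fun a _ => Finset.prod_ne_zero_iff.mpr fun j hj => ?_
  exact (one_sub_pow_pos h1 h2 (by have := (Finset.mem_Icc.mp hj).1; omega)).ne'

/-- The variables of the polynomial ring as elements of its fraction field. -/
def fracVar (m : ℕ) (i : Fin m) : FractionRing (MvPolynomial (Fin m) ℝ) :=
  algebraMap (MvPolynomial (Fin m) ℝ) (FractionRing (MvPolynomial (Fin m) ℝ)) (X i)

theorem fracVar_injective (m : ℕ) : Function.Injective (fracVar m) :=
  (IsFractionRing.injective (MvPolynomial (Fin m) ℝ) _).comp (X_injective)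

theorem hlFrac_eq_hlSum (t : ℝ) {N : ℕ} (lam : Nat.Partition N) (m : ℕ) :
    hlFrac t lam m = hlSum (fracVar m) (algebraMap ℝ _ t) N Finset.univ lam.parts := by
  rw [hlSum, Finset.sum_filter, hlFrac]
  refine Finset.sum_bij' (fun α _ i => (α i : ℕ))
    (fun α hα i => ⟨α i, Nat.lt_succ_of_le ((mem_expVectors.mp hα).1 i (Finset.mem_univ i))⟩)
    ?_ ?_ ?_ ?_ ?_
  · intro α _
    exact mem_expVectors.mpr ⟨fun i _ => Nat.le_of_lt_succ (α i).2, by simp⟩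
  · intros; exact Finset.mem_univ _
  · intros; rfl
  · intros; rfl
  · intro α _
    refine if_congr Iff.rfl ?_ rfl
    rw [hlTerm]
    congr 1
    · exact Finset.prod_congr rfl fun i _ => by rw [map_pow]; rfl
    · refine Finset.prod_congr rfl fun i _ => Finset.prod_congr rfl fun j _ => ?_
      refine if_congr Iff.rfl ?_ rfl
      rw [map_sub, map_sub, map_mul, ← algebraMap_eq, ← IsScalarTower.algebraMap_apply]
      rfl

theorem evalVars_fracVar (m : ℕ) (F : Lam) :
    evalVars (fracVar m) Finset.univ F = algebraMap _ _ (finEval m F) := by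
  have h : evalVars (fracVar m) Finset.univ =
      (IsScalarTower.toAlgHom ℝ (MvPolynomial (Fin m) ℝ) (FractionRing _)).comp (finEval m) := by
    refine algHom_ext fun n => ?_
    rw [evalVars_X, AlgHom.comp_apply, finEval, aeval_X, MvPolynomial.psum, map_sum]
    exact Finset.sum_congr rfl fun i _ => by rw [map_pow]; rfl
  rw [h]
  rfl

/-- The word is b_λ(t) P_λ in every finite set of variables, and b_λ(t) ≠ 0 for |t| < 1. The
variables are taken in the fraction field, where they are distinct. -/
theorem isHallLittlewoodP_theta {t : ℝ} (h1 : -1 < t) (h2 : t < 1) {N : ℕ}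
    (lam : Nat.Partition N) :
    IsHallLittlewoodP t lam
      (theta ((bCoeff t lam)⁻¹ • word t (fun a => lam.parts.count a) N)) := by
  intro m
  refine ⟨finEval m ((bCoeff t lam)⁻¹ • word t (fun a => lam.parts.count a) N), ?_, ?_⟩
  · rw [← evalVars_fracVar, map_smul, evalVars_word (fracVar_injective m) t _ le_rfl,
      multMultiset_count, ← bCoeff_eq, hlFrac_eq_hlSum, Algebra.smul_def, ← mul_assoc, ← map_mul,
      inv_mul_cancel₀ (bCoeff_ne_zero h1 h2 lam), map_one, one_mul]
  · exact (restrVars_theta m _).symm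

theorem eulerD_monomial (d : ℕ →₀ ℕ) (c : ℝ) :
    eulerD (monomial d c) = ((monoParts d).sum : ℝ) • monomial d c := by
  induction d using Finsupp.induction_linear generalizing c with
  | zero =>
    change eulerD (C c) = _
    rw [← algebraMap_eq, Derivation.map_algebraMap]
    simp [monoParts]
  | add d e hd he =>
    have h1 : monomial (d + e) c = monomial d c * monomial e (1 : ℝ) := by
      rw [monomial_mul, mul_one]
    have h2 : (monoParts (d + e)).sum = (monoParts d).sum + (monoParts e).sum := by
      simp [monoParts]
    rw [h1, Derivation.leibniz, hd, he, h2]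
    push_cast
    rw [add_smul, smul_eq_mul, smul_eq_mul, mul_smul_comm, mul_smul_comm,
      mul_comm (monomial e (1 : ℝ))]
    ring
  | single a n =>
    have h1 : monomial (Finsupp.single a n) c = c • (X a : Lam) ^ n := by
      rw [X_pow_eq_monomial, smul_monomial, smul_eq_mul, mul_one]
    rw [h1, Derivation.map_smul, Derivation.leibniz_pow, eulerD_X, monoParts,
      Finsupp.toMultiset_single, Multiset.map_nsmul, Multiset.map_singleton, Multiset.sum_nsmul,
      Multiset.sum_singleton]
    cases n with
    | zero => simp
    | succ n =>
      simp only [smul_eq_C_mul, smul_eq_mul, nsmul_eq_mul, Nat.add_sub_cancel, pow_succ]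
      push_cast
      simp only [map_add, map_mul, map_natCast, map_one]
      ring

/-- Monomials are eigenvectors of the Euler derivation with their weight as eigenvalue, so only
monomials of weight N occur in F. -/
theorem theta_mem_symHom {F : Lam} {N : ℕ} (h : eulerD F = (N : ℝ) • F) : theta F ∈ symHom N := by
  have h1 : ∀ d ∈ F.support, (monoParts d).sum = N := by
    intro d hd
    have h2 : eulerD F = ∑ d ∈ F.support, ((monoParts d).sum : ℝ) • monomial d (coeff d F) := by
      conv_lhs => rw [as_sum F, map_sum]
      exact Finset.sum_congr rfl fun d _ => eulerD_monomial d _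
    have h3 := congrArg (coeff d) (h2.symm.trans h)
    rw [coeff_sum, coeff_smul] at h3
    simp only [coeff_smul, coeff_monomial, smul_eq_mul, mul_ite, mul_zero] at h3
    rw [Finset.sum_ite_eq', if_pos hd] at h3
    exact_mod_cast mul_right_cancel₀ (mem_support_iff.mp hd) h3
  rw [as_sum F, map_sum]
  refine sum_mem fun d hd => ?_
  have h2 := theta_monomial_mem d (coeff d F)
  rwa [h1 d hd] at h2

theorem eulerD_jing_pow (t : ℝ) (r : ℤ) (x : ℕ) {F : Lam} {w : ℝ} (h : eulerD F = w • F) :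
    eulerD ((jing t r ^ x) F) = (x * r + w) • (jing t r ^ x) F := by
  induction x with
  | zero => simpa using h
  | succ x ih =>
    rw [pow_succ', Module.End.mul_apply, eulerD_jing, ih, map_smul, ← add_smul]
    push_cast
    congr 1
    ring

/-- The sum of the parts. -/
def wordSize (m : ℕ → ℕ) (K : ℕ) : ℕ := ∑ a ∈ Finset.Icc 1 K, a * m a

theorem eulerD_word (t : ℝ) (m : ℕ → ℕ) (K : ℕ) :
    eulerD (word t m K) = (wordSize m K : ℝ) • word t m K := by
  induction K with
  | zero => simp [word, wordSize]
  | succ K ih =>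
    rw [word, eulerD_jing_pow t _ _ ih, wordSize, wordSize, Finset.sum_Icc_succ_top (by omega)]
    push_cast
    congr 1
    ring

theorem sum_count_mul_eq {s : Multiset ℕ} {K : ℕ} (hs : ∀ a ∈ s, 1 ≤ a ∧ a ≤ K) :
    wordSize (fun a => s.count a) K = s.sum := by
  induction s using Multiset.induction_on with
  | empty => simp [wordSize]
  | cons b s ih =>
    rw [Multiset.sum_cons, ← ih fun a ha => hs a (Multiset.mem_cons_of_mem ha), wordSize, wordSize]
    have hb := hs b (Multiset.mem_cons_self b s)
    simp only [Multiset.count_cons, mul_add, Finset.sum_add_distrib, mul_ite, mul_one, mul_zero]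
    rw [Finset.sum_ite_eq', if_pos (Finset.mem_Icc.mpr hb), add_comm]

theorem wordSize_count {N : ℕ} (lam : Nat.Partition N) :
    wordSize (fun a => lam.parts.count a) N = N := by
  rw [sum_count_mul_eq fun a ha => ⟨lam.parts_pos ha, le_of_mem_parts lam ha⟩, lam.parts_sum]

theorem theta_word_mem {N : ℕ} (t : ℝ) (lam : Nat.Partition N) :
    theta (word t (fun a => lam.parts.count a) N) ∈ symHom N := by
  refine theta_mem_symHom ?_
  rw [eulerD_word, wordSize_count]

/-- The choice operator in `hallLittlewoodP` is meaningful because a homogeneous witness exists, and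
`IsHallLittlewoodP.unique` identifies its value with that witness. -/
theorem coe_hallLittlewoodP {t : ℝ} (h1 : -1 < t) (h2 : t < 1) {N : ℕ} (lam : Nat.Partition N) :
    (hallLittlewoodP t lam : Sym) =
      theta ((bCoeff t lam)⁻¹ • word t (fun a => lam.parts.count a) N) := by
  have hex := isHallLittlewoodP_theta h1 h2 lam
  have hmem : theta ((bCoeff t lam)⁻¹ • word t (fun a => lam.parts.count a) N) ∈ symHom N := by
    rw [map_smul]
    exact Submodule.smul_mem _ _ (theta_word_mem t lam)
  have h := Classical.epsilon_spec (p := fun f : symHom N => IsHallLittlewoodP t lam (f : Sym))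
    ⟨⟨_, hmem⟩, hex⟩
  exact IsHallLittlewoodP.unique h hex

theorem plancherel_qTildePar {t : ℝ} (h1 : -1 < t) (h2 : t < 1) (ε : Fin 2) {n : ℕ}
    (lam : Nat.Partition (2 * n + ε)) :
    plancherel ε (qTildePar t ε lam) = (-1) ^ nStat lam *
      lamFunctional ε (word t (fun a => lam.parts.count a) (2 * n + ε)) := by
  rw [← smul_eq_mul, ← map_smul]
  refine plancherel_apply ε ?_
  change (-1 : ℝ) ^ nStat lam • (bCoeff t lam • (hallLittlewoodP t lam : Sym)) = _
  rw [coe_hallLittlewoodP h1 h2, map_smul, map_smul, smul_smul (bCoeff t lam),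
    mul_inv_cancel₀ (bCoeff_ne_zero h1 h2 lam), one_smul]

/-- The number of parts that are at least `j`. -/
def tailCount (m : ℕ → ℕ) (K j : ℕ) : ℕ := ∑ i ∈ Finset.Icc j K, m i

/-- The statistic `n(λ) = ∑_j (λ'_j choose 2)`. -/
def wordStat (m : ℕ → ℕ) (K : ℕ) : ℕ := ∑ j ∈ Finset.Icc 1 K, (tailCount m K j).choose 2

theorem tailCount_bump (m : ℕ → ℕ) {K a : ℕ} (ha : a ≤ K) (x j : ℕ) :
    tailCount (bump m a x) K j = tailCount m K j + if j ≤ a then x else 0 := by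
  have h : ∀ i, bump m a x i = m i + if i = a then x else 0 := by
    intro i
    rw [bump]
    split_ifs <;> rfl
  simp only [tailCount, h, Finset.sum_add_distrib, Finset.sum_ite_eq', Finset.mem_Icc, ha, and_true]

/-- A new part a raises λ'_j by one for j ≤ a, and C(c+1, 2) - C(c, 2) = c. -/
theorem wordStat_bump (m : ℕ → ℕ) {K a : ℕ} (ha : a ≤ K) :
    wordStat (bump m a 1) K = wordStat m K + ∑ j ∈ Finset.Icc 1 a, tailCount m K j := by
  have h : ∀ j, (tailCount (bump m a 1) K j).choose 2 =
      (tailCount m K j).choose 2 + if j ≤ a then tailCount m K j else 0 := by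
    intro j
    rw [tailCount_bump m ha]
    split_ifs
    · rw [Nat.choose_succ_succ', Nat.choose_one_right, add_comm]
    · rfl
  simp only [wordStat, h, Finset.sum_add_distrib]
  congr 1
  rw [← Finset.sum_filter]
  refine Finset.sum_congr ?_ fun _ _ => rfl
  ext j
  simp only [Finset.mem_filter, Finset.mem_Icc]
  omega

theorem wordSize_bump (m : ℕ → ℕ) {K a : ℕ} (ha : a ≤ K) (x : ℕ) :
    wordSize (bump m a x) K = wordSize m K + a * x := by
  have h : ∀ i, i * bump m a x i = i * m i + if i = a then a * x else 0 := by
    intro i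
    rw [bump]
    split_ifs with h
    · subst h; ring
    · rfl
  simp only [wordSize, h, Finset.sum_add_distrib, Finset.sum_ite_eq', Finset.mem_Icc, ha, and_true]
  split_ifs with h1
  · rfl
  · rw [show a = 0 by omega, zero_mul]

theorem tailCount_eq_add (m : ℕ → ℕ) {K j : ℕ} (hj : j ≤ K) :
    tailCount m K j = m j + tailCount m K (j + 1) := by
  have h : Finset.Icc (j + 1) K = Finset.Ioc j K := by
    ext i
    simp only [Finset.mem_Icc, Finset.mem_Ioc]
    omega
  rw [tailCount, tailCount, ← Finset.sum_Ioc_add_eq_sum_Icc hj, add_comm, h]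

theorem wordStat_bump_two (m : ℕ → ℕ) {K a : ℕ} (ha : a ≤ K) :
    wordStat (bump m a 2) K = wordStat m K + 2 * (∑ j ∈ Finset.Icc 1 a, tailCount m K j) + a := by
  have h1 : bump m a 2 = bump (bump m a 1) a 1 := by
    funext j
    simp only [bump]
    split_ifs <;> rfl
  rw [h1, wordStat_bump _ ha, wordStat_bump _ ha]
  have h2 : ∑ j ∈ Finset.Icc 1 a, tailCount (bump m a 1) K j =
      ∑ j ∈ Finset.Icc 1 a, (tailCount m K j + 1) := by
    refine Finset.sum_congr rfl fun j hj => ?_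
    rw [tailCount_bump m ha, if_pos (Finset.mem_Icc.mp hj).2]
  rw [h2, Finset.sum_add_distrib]
  simp
  ring

theorem tailCount_count {s : Multiset ℕ} {K : ℕ} (hs : ∀ a ∈ s, a ≤ K) (j : ℕ) :
    tailCount (fun a => s.count a) K j = s.countP (j ≤ ·) := by
  induction s using Multiset.induction_on with
  | empty => simp [tailCount]
  | cons b s ih =>
    rw [Multiset.countP_cons, ← ih fun a ha => hs a (Multiset.mem_cons_of_mem ha), tailCount,
      tailCount]
    have hb := hs b (Multiset.mem_cons_self b s)
    simp only [Multiset.count_cons, Finset.sum_add_distrib]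
    rw [Finset.sum_ite_eq']
    simp [hb]

theorem sum_countP_le {l : List ℕ} {K : ℕ} (hl : ∀ a ∈ l, a ≤ K) :
    ∑ j ∈ Finset.Icc 1 K, l.countP (j ≤ ·) = l.sum := by
  induction l with
  | nil => simp
  | cons b l ih =>
    have hb : b ≤ K := hl b List.mem_cons_self
    rw [List.sum_cons, ← ih fun a ha => hl a (List.mem_cons_of_mem b ha)]
    simp only [List.countP_cons, Finset.sum_add_distrib, decide_eq_true_eq]
    rw [add_comm, ← Finset.sum_filter, ← Finset.card_eq_sum_ones]
    congr 1
    have : (Finset.Icc 1 K).filter (fun j => j ≤ b) = Finset.Icc 1 b := by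
      ext j
      simp only [Finset.mem_filter, Finset.mem_Icc]
      omega
    rw [this, Nat.card_Icc, Nat.add_sub_cancel]

/-- Putting a largest part in front shifts the positions of all others, which adds their sum on the
left. On the right each column count c with j ≤ b rises by one and its binomial by c; columns j > b
are empty. -/
theorem sum_mul_getD_eq {l : List ℕ} {K : ℕ} (hl : ∀ a ∈ l, a ≤ K)
    (hs : l.Pairwise (· ≥ ·)) :
    ∑ i ∈ Finset.range l.length, i * l.getD i 0 =
      ∑ j ∈ Finset.Icc 1 K, (l.countP (j ≤ ·)).choose 2 := by
  induction l with
  | nil => simp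
  | cons b l ih =>
    have hl' : ∀ a ∈ l, a ≤ K := fun a ha => hl a (List.mem_cons_of_mem b ha)
    rw [List.pairwise_cons] at hs
    have h1 : ∀ j, ((b :: l).countP (j ≤ ·)).choose 2 =
        (l.countP (j ≤ ·)).choose 2 + l.countP (j ≤ ·) := by
      intro j
      rw [List.countP_cons]
      split_ifs with h
      · rw [Nat.choose_succ_succ', Nat.choose_one_right, add_comm]
      · have h0 : l.countP (j ≤ ·) = 0 := by
          rw [List.countP_eq_zero]
          intro a ha
          have := hs.1 a ha
          simp only [decide_eq_true_eq] at h ⊢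
          omega
        simp [h0]
    simp only [h1, Finset.sum_add_distrib]
    rw [← ih hl' hs.2, sum_countP_le hl', List.length_cons, Finset.sum_range_succ']
    simp only [List.getD_cons_succ, add_mul, one_mul, zero_mul, add_zero, Finset.sum_add_distrib]
    congr 1
    clear ih hs hl hl' h1
    induction l with
    | nil => simp
    | cons a l ih =>
      rw [List.length_cons, Finset.sum_range_succ', List.sum_cons]
      simp only [List.getD_cons_succ, List.getD_cons_zero, ih]
      ring

theorem nStat_eq {N : ℕ} (lam : Nat.Partition N) :
    nStat lam = wordStat (fun a => lam.parts.count a) N := by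
  have hle : ∀ a ∈ lam.parts, a ≤ N := fun a ha => le_of_mem_parts lam ha
  have h1 := sum_mul_getD_eq (l := lam.parts.sort (· ≥ ·)) (K := N)
    (fun a ha => hle a ((Multiset.mem_sort (· ≥ ·)).mp ha)) (Multiset.pairwise_sort _ _)
  rw [nStat, wordStat, ← Multiset.length_sort (r := (· ≥ ·)), h1]
  refine Finset.sum_congr rfl fun j _ => ?_
  rw [tailCount_count hle]
  conv_rhs => rw [← Multiset.sort_eq lam.parts (· ≥ ·)]
  rw [Multiset.coe_countP]

end HLUnitary

end

/-! ### Positivity of Φ on the signed functions Q_λ -/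

noncomputable section

namespace HLUnitary

open MvPolynomial

theorem pderiv_zero_pderiv_one (F : Lam) : pderiv 0 (pderiv 1 F) = pderiv 1 (pderiv 0 F) := by
  have h : ⁅(pderiv 0 : Derivation ℝ Lam Lam), (pderiv 1 : Derivation ℝ Lam Lam)⁆ = 0 := by
    refine derivation_ext fun n => ?_
    rw [Derivation.commutator_apply]
    simp only [pderiv_X, Pi.single_apply]
    split_ifs <;> simp
  have h2 := congrArg (fun D : Derivation ℝ Lam Lam => D F) h
  simp only [Derivation.commutator_apply, Derivation.coe_zero, Pi.zero_apply] at h2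
  exact sub_eq_zero.mp h2

theorem pderiv_zero_eulerD (F : Lam) :
    pderiv 0 (eulerD F) = eulerD (pderiv 0 F) + pderiv 0 F := by
  have h : ⁅(pderiv 0 : Derivation ℝ Lam Lam), eulerD⁆ = pderiv 0 := by
    refine derivation_ext fun n => ?_
    rw [Derivation.commutator_apply, eulerD_X, Derivation.map_smul]
    by_cases hn : n = 0
    · subst hn
      simp
    · simp [pderiv_X_of_ne hn]
  have h2 := congrArg (fun D : Derivation ℝ Lam Lam => D F) h
  simp only [Derivation.commutator_apply] at h2
  exact sub_eq_iff_eq_add'.mp h2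

/-- The Euler derivation is ∑ n p_n ∂/∂p_n, and after the specialization only the term 2 p_2 ∂/∂p_2
survives. -/
theorem evalTwo_eulerD (F : Lam) : evalTwo (eulerD F) = 2 * evalTwo (pderiv 1 F) := by
  induction F using MvPolynomial.induction_on with
  | C a =>
    rw [← algebraMap_eq, Derivation.map_algebraMap, Derivation.map_algebraMap]
    simp
  | add p q hp hq => simp only [map_add, hp, hq, mul_add]
  | mul_X p n hp =>
    rw [Derivation.leibniz, Derivation.leibniz]
    simp only [smul_eq_mul, map_add, map_mul, hp, eulerD_X, map_smul, evalTwo_X, pderiv_X,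
      Pi.single_apply]
    split_ifs with h
    · subst h
      simp
      ring
    · simp

theorem lamFunctional_eulerD (ε : Fin 2) (F : Lam) :
    lamFunctional ε (eulerD F) = 2 * lamFunctional ε (pderiv 1 F) + ε * lamFunctional ε F := by
  rw [lamFunctional]
  split_ifs with h
  · subst h
    simp [evalTwo_eulerD]
  · obtain rfl : ε = 1 := by omega
    simp [pderiv_zero_eulerD, pderiv_zero_pderiv_one, evalTwo_eulerD]

/-- In degree 2n + ε only the monomial p_2^n p_1^ε counts. Its derivative is n p_2^{n-1} p_1^ε, on
which the functional takes n times the same value. -/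
theorem lamFunctional_pderiv {ε : Fin 2} {n : ℕ} {F : Lam}
    (h : eulerD F = ((2 * n + ε : ℕ) : ℝ) • F) :
    lamFunctional ε (pderiv 1 F) = n * lamFunctional ε F := by
  have h1 := lamFunctional_eulerD ε F
  rw [h, map_smul, smul_eq_mul] at h1
  push_cast at h1
  linarith

theorem wordStat_bump_add_two (u : ℕ → ℕ) {K b : ℕ} (h : b + 2 ≤ K) :
    wordStat (bump u (b + 2) 1) K =
      wordStat (bump u b 1) K + tailCount u K (b + 1) + tailCount u K (b + 2) := by
  rw [wordStat_bump u h, wordStat_bump u (by omega : b ≤ K), Finset.sum_Icc_succ_top (by omega),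
    Finset.sum_Icc_succ_top (by omega)]
  ring

theorem wordStat_bump_add_one (u : ℕ → ℕ) {K b : ℕ} (h : b + 1 ≤ K) :
    wordStat (bump u (b + 1) 2) K = wordStat (bump u b 2) K + 2 * tailCount u K (b + 1) + 1 := by
  rw [wordStat_bump_two u h, wordStat_bump_two u (by omega : b ≤ K),
    Finset.sum_Icc_succ_top (by omega)]
  ring

/-- Decrease the multiplicity of `a` by `x`. -/
def drop (m : ℕ → ℕ) (a x : ℕ) : ℕ → ℕ := fun j => if j = a then m j - x else m j

theorem bump_drop {m : ℕ → ℕ} {a x : ℕ} (h : x ≤ m a) : bump (drop m a x) a x = m := by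
  funext j
  simp only [bump, drop]
  split_ifs with hj
  · subst hj; omega
  · rfl

theorem downTwo_eq (m : ℕ → ℕ) (b : ℕ) : downTwo m (b + 2) = bump (drop m (b + 2) 1) b 1 := by
  funext j
  simp only [downTwo, bump, drop]
  split_ifs <;> omega

theorem downPair_eq (m : ℕ → ℕ) (b : ℕ) : downPair m (b + 1) = bump (drop m (b + 1) 2) b 2 := by
  funext j
  simp only [downPair, bump, drop]
  split_ifs <;> omega

theorem wordSize_downTwo {m : ℕ → ℕ} {K b : ℕ} (hb : b + 2 ≤ K) (hm : 1 ≤ m (b + 2)) :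
    wordSize m K = wordSize (downTwo m (b + 2)) K + 2 := by
  rw [downTwo_eq, wordSize_bump _ (by omega : b ≤ K)]
  conv_lhs => rw [← bump_drop hm, wordSize_bump _ hb]
  ring

theorem wordSize_downPair {m : ℕ → ℕ} {K b : ℕ} (hb : b + 1 ≤ K) (hm : 2 ≤ m (b + 1)) :
    wordSize m K = wordSize (downPair m (b + 1)) K + 2 := by
  rw [downPair_eq, wordSize_bump _ (by omega : b ≤ K)]
  conv_lhs => rw [← bump_drop hm, wordSize_bump _ hb]
  ring

/-- With a = b + 2, n(λ) drops by the column counts λ'_{a-1} + λ'_a of the other parts, which is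
congruent to m_{a-1} mod 2. This sign cancels that of t^{m_{a-1}} in `pderiv_word`. -/
theorem neg_one_pow_wordStat_downTwo {m : ℕ → ℕ} {K b : ℕ} (hb : b + 2 ≤ K)
    (hm : 1 ≤ m (b + 2)) :
    (-1 : ℝ) ^ wordStat m K = (-1) ^ wordStat (downTwo m (b + 2)) K * (-1) ^ m (b + 1) := by
  rw [downTwo_eq]
  conv_lhs => rw [← bump_drop hm, wordStat_bump_add_two _ hb, tailCount_eq_add _ (by omega)]
  have h : drop m (b + 2) 1 (b + 1) = m (b + 1) := by simp [drop]
  rw [h, add_assoc, pow_add, add_assoc, pow_add _ (m (b + 1)), ← two_mul]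
  simp

/-- Here n(λ) changes by an odd number, which compensates the negative factor t - 1 in
`pderiv_word`. -/
theorem neg_one_pow_wordStat_downPair {m : ℕ → ℕ} {K b : ℕ} (hb : b + 1 ≤ K)
    (hm : 2 ≤ m (b + 1)) :
    (-1 : ℝ) ^ wordStat m K = -(-1) ^ wordStat (downPair m (b + 1)) K := by
  rw [downPair_eq]
  conv_lhs => rw [← bump_drop hm, wordStat_bump_add_one _ hb]
  rw [pow_succ, pow_add]
  simp

theorem gaussInt_pos {t : ℝ} (h1 : -1 < t) (h2 : t < 1) {m : ℕ} (hm : m ≠ 0) :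
    0 < gaussInt t m := by
  have h := gaussInt_mul t m
  have h3 := one_sub_pow_pos h1 h2 hm
  rw [← h] at h3
  exact pos_of_mul_pos_left h3 (by linarith)

theorem gaussChooseTwo_pos {t : ℝ} (h1 : -1 < t) (h2 : t < 1) {m : ℕ} (hm : 2 ≤ m) :
    0 < gaussChooseTwo t m := by
  have h := gaussChooseTwo_mul t m
  have h3 := mul_pos (one_sub_pow_pos h1 h2 (by omega : m ≠ 0))
    (one_sub_pow_pos h1 h2 (by omega : m - 1 ≠ 0))
  rw [← h] at h3
  have h4 := one_sub_pow_pos h1 h2 (two_ne_zero)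
  exact pos_of_mul_pos_left h3 (mul_pos (by linarith) h4).le

theorem word_eq_of_wordSize_le_one (t : ℝ) {m : ℕ → ℕ} {K : ℕ} (h : wordSize m K ≤ 1) :
    word t m K = if wordSize m K = 0 then 1 else (1 - t) • X 0 := by
  have hle : ∀ a ∈ Finset.Icc 1 K, a * m a ≤ wordSize m K := fun a ha =>
    Finset.single_le_sum (f := fun a => a * m a) (fun _ _ => Nat.zero_le _) ha
  have h2 : ∀ a, 1 < a → a ≤ K → m a = 0 := by
    intro a h1 h2
    have := hle a (Finset.mem_Icc.mpr ⟨by omega, h2⟩)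
    by_contra h3
    have : a * 1 ≤ a * m a := Nat.mul_le_mul_left a (by omega)
    omega
  cases K with
  | zero => simp [word, wordSize]
  | succ K =>
    have hs : wordSize m (K + 1) = m 1 := by
      rw [wordSize, Finset.sum_eq_single 1]
      · simp
      · intro a ha h1
        rw [Finset.mem_Icc] at ha
        rw [h2 a (by omega) ha.2, mul_zero]
      · intro h1
        exact absurd (Finset.mem_Icc.mpr ⟨le_rfl, by omega⟩) h1
    rw [word_of_le t (by omega : 1 ≤ K + 1) h2, hs]
    rw [hs] at h
    rw [word, word]
    split_ifs with h0
    · simp [h0]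
    · simp [show m 1 = 1 by omega, jing_one, qFun_one]

/-- This makes the inequality strict: beyond degree 1 there is a part of size at least 2 or a
repeated part, hence a nonzero term in the derivative. -/
theorem exists_of_two_le_wordSize {m : ℕ → ℕ} {K : ℕ} (h : 2 ≤ wordSize m K) :
    ∃ i < K, (i ≠ 0 ∧ m (i + 1) ≠ 0) ∨ 2 ≤ m (i + 1) := by
  by_contra! hc
  have h1 : ∀ a ∈ Finset.Icc 1 K, a * m a ≤ if a = 1 then 1 else 0 := by
    intro a ha
    rw [Finset.mem_Icc] at ha
    have h2 := hc (a - 1) (by omega)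
    rw [Nat.sub_add_cancel ha.1] at h2
    split_ifs with h3
    · subst h3; omega
    · rw [h2.1 (by omega), mul_zero]
  have h2 := Finset.sum_le_sum h1
  rw [Finset.sum_ite_eq'] at h2
  have h3 : wordSize m K ≤ 1 := h2.trans (by split_ifs <;> omega)
  omega

/-- Up to the sign `(-1) ^ n(λ)`, the functional is positive on `Q_λ`. -/
theorem lamFunctional_word_pos {t : ℝ} (h1 : -1 < t) (h2 : t < 0) (ε : Fin 2) (K n : ℕ) :
    ∀ m : ℕ → ℕ, wordSize m K = 2 * n + ε →
      0 < (-1) ^ wordStat m K * lamFunctional ε (word t m K) := by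
  have hsq : 0 < 1 - t ^ 2 := one_sub_pow_pos h1 (by linarith) two_ne_zero
  induction n with
  | zero =>
    intro m hm
    have hs : wordSize m K ≤ 1 := by omega
    have h0 : wordStat m K = 0 := by
      refine Finset.sum_eq_zero fun j hj => Nat.choose_eq_zero_of_lt ?_
      have : tailCount m K j ≤ wordSize m K := by
        refine le_trans ?_ (Finset.sum_le_sum_of_subset
          (Finset.Icc_subset_Icc_left (Finset.mem_Icc.mp hj).1))
        refine Finset.sum_le_sum fun i hi => Nat.le_mul_of_pos_left _ ?_
        have := (Finset.mem_Icc.mp hj).1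
        have := (Finset.mem_Icc.mp hi).1
        omega
      omega
    rw [h0, word_eq_of_wordSize_le_one t hs, hm, lamFunctional]
    fin_cases ε
    · simp
    · simp
      linarith
  | succ n ih =>
    intro m hm
    -- The factor n + 1 is positive, so it suffices to find the sign of the functional on the
    -- derivative, whose expansion lives in degree lower by 2.
    have hw := lamFunctional_pderiv (ε := ε) (n := n + 1) (F := word t m K)
      (by rw [eulerD_word, hm])
    rw [pderiv_word, map_smul, map_sum, smul_eq_mul] at hw
    have hpos : 0 < ∑ i ∈ Finset.range K, (-1) ^ wordStat m K * lamFunctional ε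
        ((gaussInt t (m (i + 1)) * if i = 0 then 0 else t ^ m i) • word t (downTwo m (i + 1)) K +
          ((t - 1) * gaussChooseTwo t (m (i + 1))) • word t (downPair m (i + 1)) K) := by
      have hA : ∀ i < K, i ≠ 0 → m (i + 1) ≠ 0 → 0 < (-1) ^ wordStat m K *
          ((gaussInt t (m (i + 1)) * if i = 0 then 0 else t ^ m i) *
            lamFunctional ε (word t (downTwo m (i + 1)) K)) := by
        intro i hi hi0 hmi
        obtain ⟨b, rfl⟩ := Nat.exists_eq_succ_of_ne_zero hi0
        have hb : b + 2 ≤ K := by omega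
        have hmb : 1 ≤ m (b + 2) := Nat.one_le_iff_ne_zero.mpr hmi
        have hsz := wordSize_downTwo hb hmb
        have := ih (downTwo m (b + 2)) (by omega)
        rw [if_neg hi0, neg_one_pow_wordStat_downTwo hb hmb]
        have h3 : 0 < (-1) ^ m (b + 1) * t ^ m (b + 1) := by
          rw [← mul_pow]
          exact pow_pos (by linarith) _
        have h4 := mul_pos (gaussInt_pos h1 (by linarith) hmi) (mul_pos h3 this)
        refine h4.trans_eq ?_
        simp only [Nat.succ_eq_add_one, add_assoc, one_add_one_eq_two]
        ring
      have hB : ∀ i < K, 2 ≤ m (i + 1) → 0 < (-1) ^ wordStat m K *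
          (((t - 1) * gaussChooseTwo t (m (i + 1))) *
            lamFunctional ε (word t (downPair m (i + 1)) K)) := by
        intro i hi hmi
        have hsz := wordSize_downPair (by omega : i + 1 ≤ K) hmi
        have := ih (downPair m (i + 1)) (by omega)
        rw [neg_one_pow_wordStat_downPair (by omega : i + 1 ≤ K) hmi]
        have h4 := mul_pos (mul_pos (by linarith : 0 < 1 - t)
          (gaussChooseTwo_pos h1 (by linarith) hmi)) this
        refine h4.trans_eq ?_
        ring
      have hA0 : ∀ i < K, 0 ≤ (-1) ^ wordStat m K *
          ((gaussInt t (m (i + 1)) * if i = 0 then 0 else t ^ m i) *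
            lamFunctional ε (word t (downTwo m (i + 1)) K)) := by
        intro i hi
        by_cases hi0 : i = 0
        · simp [hi0]
        by_cases hmi : m (i + 1) = 0
        · simp [hmi, gaussInt_zero]
        exact (hA i hi hi0 hmi).le
      have hB0 : ∀ i < K, 0 ≤ (-1) ^ wordStat m K *
          (((t - 1) * gaussChooseTwo t (m (i + 1))) *
            lamFunctional ε (word t (downPair m (i + 1)) K)) := by
        intro i hi
        by_cases hmi : 2 ≤ m (i + 1)
        · exact (hB i hi hmi).le
        · have : gaussChooseTwo t (m (i + 1)) = 0 := by
            have : m (i + 1) = 0 ∨ m (i + 1) = 1 := by omega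
            rcases this with h | h <;> simp [h, gaussChooseTwo, gaussInt]
          simp [this]
      simp only [map_add, map_smul, smul_eq_mul, mul_add ((-1 : ℝ) ^ wordStat m K)]
      refine Finset.sum_pos' (fun i hi => add_nonneg (hA0 i (Finset.mem_range.mp hi))
        (hB0 i (Finset.mem_range.mp hi))) ?_
      obtain ⟨i, hi, h | h⟩ := exists_of_two_le_wordSize (m := m) (K := K) (by omega)
      · exact ⟨i, Finset.mem_range.mpr hi, add_pos_of_pos_of_nonneg (hA i hi h.1 h.2) (hB0 i hi)⟩
      · exact ⟨i, Finset.mem_range.mpr hi, add_pos_of_nonneg_of_pos (hA0 i hi) (hB i hi h)⟩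
    rw [← Finset.mul_sum] at hpos
    have h5 := mul_pos (div_pos hsq two_pos) hpos
    rw [mul_left_comm, hw, mul_left_comm] at h5
    exact pos_of_mul_pos_right h5 (by positivity)

theorem plancherel_qTildePar_pos {t : ℝ} (h1 : -1 < t) (h2 : t < 0) (ε : Fin 2) {n : ℕ}
    (lam : Nat.Partition (2 * n + ε)) : 0 < plancherel ε (qTildePar t ε lam) := by
  rw [plancherel_qTildePar h1 (by linarith), nStat_eq]
  exact lamFunctional_word_pos h1 h2 ε _ n _ (wordSize_count lam)

theorem plancherel_nonneg_of_mem_hlCone {t : ℝ} (h1 : -1 < t) (h2 : t < 0) {ε : Fin 2}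
    {F : SymPar ε} (hF : F ∈ hlCone t ε) : 0 ≤ plancherel ε F := by
  induction hF using Submodule.span_induction with
  | mem F hF =>
    obtain ⟨n, lam, rfl⟩ := hF
    exact (plancherel_qTildePar_pos h1 h2 ε lam).le
  | zero => rw [map_zero]
  | add F G _ _ hF hG => rw [map_add]; exact add_nonneg hF hG
  | smul c F _ hF =>
    have : c • F = (c : ℝ) • F := rfl
    rw [this, map_smul]
    exact mul_nonneg c.2 hF

end HLUnitary

end

/-! ### Masses of cylinders and the harmonicity relation at t = -1/q -/

noncomputable section

namespace HLUnitary

open MvPolynomial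

theorem tailCount_of_le {m : ℕ → ℕ} {N L : ℕ} (h : ∀ j, N < j → m j = 0) (hL : N ≤ L) (j : ℕ) :
    tailCount m L j = tailCount m N j := by
  symm
  refine Finset.sum_subset (Finset.Icc_subset_Icc_right hL) fun i hi h1 => h i ?_
  rw [Finset.mem_Icc] at hi h1
  omega

theorem tailCount_eq_zero {m : ℕ → ℕ} {N j : ℕ} (h : N < j) : tailCount m N j = 0 := by
  rw [tailCount, Finset.Icc_eq_empty (by omega), Finset.sum_empty]

theorem wordStat_of_le {m : ℕ → ℕ} {N L : ℕ} (h : ∀ j, N < j → m j = 0) (hL : N ≤ L) :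
    wordStat m L = wordStat m N := by
  rw [wordStat, wordStat]
  symm
  refine Finset.sum_subset_zero_on_sdiff (Finset.Icc_subset_Icc_right hL) (fun i hi => ?_)
    fun i _ => ?_
  · rw [Finset.mem_sdiff, Finset.mem_Icc, Finset.mem_Icc] at hi
    rw [tailCount_of_le h hL, tailCount_eq_zero (by omega)]
    rfl
  · rw [tailCount_of_le h hL]

theorem upTwo_eq (m : ℕ → ℕ) (a : ℕ) : upTwo m a = bump (drop m a 1) (a + 2) 1 := by
  funext j
  simp only [upTwo, bump, drop]
  split_ifs <;> omega

theorem upPair_eq (m : ℕ → ℕ) (a : ℕ) : upPair m a = bump (drop m a 2) (a + 1) 2 := by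
  funext j
  simp only [upPair, bump, drop]
  split_ifs <;> omega

theorem tailCount_drop (m : ℕ → ℕ) (K a x : ℕ) {j : ℕ} (hj : a < j) :
    tailCount (drop m a x) K j = tailCount m K j := by
  refine Finset.sum_congr rfl fun i hi => ?_
  have := (Finset.mem_Icc.mp hi).1
  rw [drop, if_neg (by omega)]

theorem wordStat_upTwo {m : ℕ → ℕ} {N a : ℕ} (h : ∀ j, N < j → m j = 0) (haN : a ≤ N)
    (ha : 1 ≤ m a) : wordStat (upTwo m a) (N + 2) =
      wordStat m N + (m (a + 1) + 2 * tailCount m N (a + 2)) := by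
  have h1 : tailCount m (N + 2) (a + 1) = m (a + 1) + tailCount m (N + 2) (a + 2) :=
    tailCount_eq_add m (by omega)
  rw [upTwo_eq, wordStat_bump_add_two _ (by omega), bump_drop ha, tailCount_drop _ _ _ _ (by omega),
    tailCount_drop _ _ _ _ (by omega), wordStat_of_le h (by omega), h1, tailCount_of_le h (by omega)]
  ring

theorem wordStat_upPair {m : ℕ → ℕ} {N a : ℕ} (h : ∀ j, N < j → m j = 0) (haN : a ≤ N)
    (ha : 2 ≤ m a) : wordStat (upPair m a) (N + 2) =
      wordStat m N + (2 * tailCount m N (a + 1) + 1) := by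
  rw [upPair_eq, wordStat_bump_add_one _ (by omega), bump_drop ha, tailCount_drop _ _ _ _ (by omega),
    wordStat_of_le h (by omega), tailCount_of_le h (by omega)]
  ring

theorem wordStat_bump_zero (m : ℕ → ℕ) (K x : ℕ) : wordStat (bump m 0 x) K = wordStat m K := by
  refine Finset.sum_congr rfl fun j hj => ?_
  have := (Finset.mem_Icc.mp hj).1
  rw [tailCount_bump m (Nat.zero_le K), if_neg (by omega), add_zero]

theorem wordStat_bump_two_one {m : ℕ → ℕ} {N : ℕ} (h : ∀ j, N < j → m j = 0) :
    wordStat (bump m 2 1) (N + 2) = wordStat m N + (m 1 + 2 * tailCount m N 2) := by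
  have h1 : tailCount m (N + 2) 1 = m 1 + tailCount m (N + 2) 2 := tailCount_eq_add m (by omega)
  have h2 := wordStat_bump_add_two m (K := N + 2) (b := 0) (by omega)
  rw [zero_add, zero_add, wordStat_bump_zero, wordStat_of_le h (by omega), h1,
    tailCount_of_le h (by omega)] at h2
  rw [h2]
  ring

theorem wordStat_bump_one_two {m : ℕ → ℕ} {N : ℕ} (h : ∀ j, N < j → m j = 0) :
    wordStat (bump m 1 2) (N + 2) = wordStat m N + (2 * tailCount m N 1 + 1) := by
  have h2 := wordStat_bump_add_one m (K := N + 2) (b := 0) (by omega)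
  rw [zero_add, wordStat_bump_zero, wordStat_of_le h (by omega), tailCount_of_le h (by omega)] at h2
  rw [h2]
  ring

/-- The mass of a cylinder set whose matrix of order `N` is nilpotent with `m a` Jordan blocks of
length `a`. -/
def cylMass (ε : Fin 2) (q : ℕ) (N : ℕ) (m : ℕ → ℕ) : ℝ :=
  (q : ℝ) ^ ((wordStat m N : ℤ) - (N.choose 2 : ℤ)) /
      (1 - (q : ℝ) ^ (-2 : ℤ)) ^ ((N : ℝ) / 2) *
    ((-1) ^ wordStat m N * lamFunctional ε (word (-(q : ℝ)⁻¹) m N))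

theorem one_sub_zpow_pos {q : ℕ} (hq : 1 < q) : 0 < 1 - (q : ℝ) ^ (-2 : ℤ) := by
  have h1 : (1 : ℝ) < q := by exact_mod_cast hq
  have h2 : (q : ℝ) ^ (-2 : ℤ) < 1 := zpow_lt_one_of_neg₀ h1 (by norm_num)
  linarith

theorem cylMass_congr (ε : Fin 2) (q : ℕ) {N : ℕ} {m m' : ℕ → ℕ}
    (h : ∀ j, 1 ≤ j → j ≤ N → m j = m' j) : cylMass ε q N m = cylMass ε q N m' := by
  have h1 : wordStat m N = wordStat m' N := by
    refine Finset.sum_congr rfl fun j hj => ?_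
    rw [tailCount, tailCount, Finset.sum_congr rfl fun i hi => h i ?_ (Finset.mem_Icc.mp hi).2]
    exact (Finset.mem_Icc.mp hj).1.trans (Finset.mem_Icc.mp hi).1
  rw [cylMass, cylMass, h1, word_congr _ h]

/-- From order N to N + 2 the binomial C(N, 2) grows by 2N + 1 and the denominator gains a factor 1
- q^{-2}. If the statistic grows by x, the power of q and the sign combine to (-q)^x. -/
theorem cylMass_add_two {ε : Fin 2} {q : ℕ} (hq : 1 < q) {N s x : ℕ} {m' : ℕ → ℕ}
    (h : wordStat m' (N + 2) = s + x) :
    cylMass ε q (N + 2) m' =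
      (q : ℝ) ^ ((s : ℤ) - (N.choose 2 : ℤ)) / (1 - (q : ℝ) ^ (-2 : ℤ)) ^ ((N : ℝ) / 2) * (-1) ^ s *
        ((-(q : ℝ)) ^ x / (q ^ (2 * N + 1) * (1 - (q : ℝ) ^ (-2 : ℤ))) *
          lamFunctional ε (word (-(q : ℝ)⁻¹) m' (N + 2))) := by
  have hq0 : (q : ℝ) ≠ 0 := by positivity
  have hp := one_sub_zpow_pos hq
  have h1 : (N + 2).choose 2 = N.choose 2 + (2 * N + 1) := by
    rw [Nat.choose_succ_succ', Nat.choose_one_right, Nat.choose_succ_succ', Nat.choose_one_right]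
    ring
  have h2 : (((N + 2 : ℕ) : ℝ) / 2) = (N : ℝ) / 2 + 1 := by
    push_cast
    ring
  rw [cylMass, h, h1, h2, Real.rpow_add hp, Real.rpow_one]
  have h3 : ((s + x : ℕ) : ℤ) - ((N.choose 2 + (2 * N + 1) : ℕ) : ℤ) =
      ((s : ℤ) - (N.choose 2 : ℤ)) + (x : ℤ) - ((2 * N + 1 : ℕ) : ℤ) := by
    push_cast
    ring
  rw [h3, zpow_sub₀ hq0, zpow_add₀ hq0, zpow_natCast, zpow_natCast,
    pow_add (-1 : ℝ), neg_pow (q : ℝ) x]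
  have h4 := (Real.rpow_pos_of_pos hp ((N : ℝ) / 2)).ne'
  field_simp

/-- The number of ways to enlarge one Jordan block from `a` to `a + 2`. -/
def upTwoCount (q N : ℕ) (m : ℕ → ℕ) (a : ℕ) : ℝ :=
  q ^ (2 * N + 1) / q ^ (2 * tailCount m N (a + 1)) * (1 - (-(q : ℝ)⁻¹) ^ m a) * (1 - (q : ℝ)⁻¹)

/-- The number of ways to enlarge two Jordan blocks from `a` to `a + 1`. -/
def upPairCount (q N : ℕ) (m : ℕ → ℕ) (a : ℕ) : ℝ :=
  q ^ (2 * N) / q ^ (2 * tailCount m N (a + 1)) * (1 - (-(q : ℝ)⁻¹) ^ m a) *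
    (1 - (-(q : ℝ)⁻¹) ^ (m a - 1))

theorem one_sub_zpow_eq (q : ℕ) :
    1 - (q : ℝ) ^ (-2 : ℤ) = (1 + (q : ℝ)⁻¹) * (1 - (q : ℝ)⁻¹) := by
  rw [show (-2 : ℤ) = -((2 : ℕ) : ℤ) from rfl, zpow_neg, zpow_natCast, ← inv_pow]
  ring

theorem one_sub_inv_pos {q : ℕ} (hq : 1 < q) : 0 < 1 - (q : ℝ)⁻¹ := by
  have h1 : (1 : ℝ) < q := by exact_mod_cast hq
  have := inv_lt_one_of_one_lt₀ h1
  linarith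

/-- With x = m_{a+1} and y the number of parts at least a + 2, this turns the growth of n(λ) into
the power t^{m_{a+1}} of the Pieri rule at t = -1/q. -/
theorem neg_pow_eq_of_tail {q : ℕ} (hq : 1 < q) (x y : ℕ) :
    (-(q : ℝ)) ^ (x + 2 * y) / q ^ (2 * (x + y)) = (-(q : ℝ)⁻¹) ^ x := by
  have hq0 : (q : ℝ) ≠ 0 := by positivity
  rw [pow_add, pow_mul, neg_sq, ← pow_mul, mul_add, pow_add, two_mul x, pow_add,
    show -(q : ℝ)⁻¹ = -(q : ℝ) / (q * q) by field_simp, div_pow, mul_pow]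
  field_simp

/-- The `p₂`-harmonicity of the functional in terms of the masses of cylinder sets. -/
theorem cylMass_eq_sum (ε : Fin 2) {q : ℕ} (hq : 1 < q) {N : ℕ} {m : ℕ → ℕ}
    (h : ∀ j, N < j → m j = 0) :
    cylMass ε q N m =
      (∑ i ∈ Finset.range N, (upTwoCount q N m (i + 1) * cylMass ε q (N + 2) (upTwo m (i + 1)) +
        upPairCount q N m (i + 1) * cylMass ε q (N + 2) (upPair m (i + 1)))) +
      (q ^ (2 * N) / q ^ (2 * tailCount m N 1) * (q - 1) * cylMass ε q (N + 2) (bump m 2 1) +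
        q ^ (2 * N) / q ^ (2 * tailCount m N 1) * cylMass ε q (N + 2) (bump m 1 2)) := by
  have hq0 : (q : ℝ) ≠ 0 := by positivity
  have hq1 : 1 < (q : ℝ) := by exact_mod_cast hq
  have hq2 : (q : ℝ) - 1 ≠ 0 := (sub_pos.mpr hq1).ne'
  have hi := one_sub_inv_pos hq
  have hp : 0 < 1 + (q : ℝ)⁻¹ := by positivity
  have hodd : ∀ x, (-(q : ℝ)) ^ (2 * x + 1) = -(q ^ (2 * x) * q) := by
    intro x
    rw [pow_succ, pow_mul, neg_sq, ← pow_mul]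
    ring
  have hm : trunc m N = m := by
    funext j
    rw [trunc]
    split_ifs with h1
    · rfl
    · exact (h j (by omega)).symm
  have h1 : 1 - -(q : ℝ)⁻¹ ≠ 0 := by rw [sub_neg_eq_add]; exact hp.ne'
  have h2 : 1 - (-(q : ℝ)⁻¹) ^ 2 = (1 + (q : ℝ)⁻¹) * (1 - (q : ℝ)⁻¹) := by ring
  have h3 : 1 - (-(q : ℝ)⁻¹) ^ 2 ≠ 0 := by
    rw [h2]
    exact (mul_pos hp hi).ne'
  -- Harmonicity applied to the Pieri expansion of p_2 Q_λ; the rest compares coefficients term by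
  -- term.
  have hX := congrArg (lamFunctional ε) (X_mul_word (-(q : ℝ)⁻¹) h1 h3 m N)
  rw [lamFunctional_X_mul, hm] at hX
  simp only [map_add, map_sub, map_sum, map_smul, smul_eq_mul] at hX
  set c : ℝ := (q : ℝ) ^ ((wordStat m N : ℤ) - (N.choose 2 : ℤ)) /
    (1 - (q : ℝ) ^ (-2 : ℤ)) ^ ((N : ℝ) / 2) * (-1) ^ wordStat m N with hc
  have hL : cylMass ε q N m = c * lamFunctional ε (word (-(q : ℝ)⁻¹) m N) := by
    rw [cylMass, hc]
    ring
  have htail : ∀ a ≤ N, tailCount m N (a + 1) = m (a + 1) + tailCount m N (a + 2) := by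
    intro a ha
    have h4 := tailCount_eq_add m (K := N + 2) (j := a + 1) (by omega)
    rwa [tailCount_of_le h (by omega : N ≤ N + 2), tailCount_of_le h (by omega : N ≤ N + 2)] at h4
  rw [hL, hX, mul_add, Finset.mul_sum, mul_sub]
  congr 1
  · refine Finset.sum_congr rfl fun i hiN => ?_
    have hiN' : i + 1 ≤ N := Finset.mem_range.mp hiN
    rw [mul_add]
    congr 1
    · by_cases h0 : m (i + 1) = 0
      · simp [h0, upTwoCount, gaussInt_zero]
      rw [cylMass_add_two hq (wordStat_upTwo h hiN' (Nat.one_le_iff_ne_zero.mpr h0)), ← hc,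
        upTwoCount, htail (i + 1) hiN', one_sub_zpow_eq q, ← gaussInt_mul,
        show i + 2 = i + 1 + 1 from rfl, ← neg_pow_eq_of_tail hq _ (tailCount m N (i + 1 + 2))]
      rw [sub_neg_eq_add]
      field_simp
    · by_cases h0 : 2 ≤ m (i + 1)
      · rw [cylMass_add_two hq (wordStat_upPair h hiN' h0), ← hc, upPairCount,
          one_sub_zpow_eq q]
        have hg := gaussChooseTwo_mul (-(q : ℝ)⁻¹) (m (i + 1))
        rw [mul_assoc ((q : ℝ) ^ (2 * N) / _), ← hg, h2, sub_neg_eq_add, hodd, pow_succ (q : ℝ) (2 * N)]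
        field_simp
        ring
      · have : m (i + 1) = 0 ∨ m (i + 1) = 1 := by omega
        rcases this with h | h <;> simp [h, upPairCount, gaussChooseTwo, gaussInt]
  · rw [sub_eq_add_neg]
    congr 1
    · rw [cylMass_add_two hq (wordStat_bump_two_one h), ← hc, htail 0 (Nat.zero_le N), zero_add,
        zero_add, one_sub_zpow_eq q, ← neg_pow_eq_of_tail hq _ (tailCount m N 2), sub_neg_eq_add,
        pow_succ (q : ℝ) (2 * N)]
      field_simp
    · rw [cylMass_add_two hq (wordStat_bump_one_two h), ← hc, one_sub_zpow_eq q, h2, hodd,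
        pow_succ (q : ℝ) (2 * N)]
      field_simp

theorem cylMass_nonneg (ε : Fin 2) {q : ℕ} (hq : 1 < q) {n : ℕ} {m : ℕ → ℕ}
    (h : wordSize m (2 * n + ε) = 2 * n + ε) : 0 ≤ cylMass ε q (2 * n + ε) m := by
  have hq1 : 1 < (q : ℝ) := by exact_mod_cast hq
  have hi := one_sub_inv_pos hq
  refine mul_nonneg (div_nonneg (by positivity) ?_) ?_
  · exact Real.rpow_nonneg (one_sub_zpow_pos hq).le _
  · exact (lamFunctional_word_pos (by linarith) (neg_lt_zero.mpr (by positivity)) ε _ n m h).le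

theorem cylMass_count (ε : Fin 2) {q : ℕ} (hq : 1 < q) {n : ℕ}
    (lam : Nat.Partition (2 * n + ε)) :
    cylMass ε q (2 * n + ε) (fun a => lam.parts.count a) =
      (q : ℝ) ^ ((nStat lam : ℤ) - ((2 * n + ε : ℕ).choose 2 : ℤ)) /
          (1 - (q : ℝ) ^ (-2 : ℤ)) ^ (((2 * n + ε : ℕ) : ℝ) / 2) *
        plancherel ε (qTildePar (-(q : ℝ)⁻¹) ε lam) := by
  have hq1 : 1 < (q : ℝ) := by exact_mod_cast hq
  have hi := one_sub_inv_pos hq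
  have hp : 0 < (q : ℝ)⁻¹ := by positivity
  rw [cylMass, plancherel_qTildePar (by linarith) (by linarith), nStat_eq]

end HLUnitary

end

noncomputable section

namespace HLUnitary

/-! ### Norm and trace equations in the field with q² elements -/

section FiniteField

/-- In a cyclic group of order ab the b-th powers are exactly the solutions of x^a = 1, and the b-th
roots of one of them form a coset of a subgroup of order b. -/
theorem ncard_pow_eq_of_isCyclic {G : Type*} [CommGroup G] [IsCyclic G] [Finite G] {a b : ℕ}
    (hG : Nat.card G = a * b) {r : G} (hr : r ^ a = 1) : {x : G | x ^ b = r}.ncard = b := by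
  have hpos : 0 < a * b := hG ▸ Nat.card_pos
  have ha : 0 < a := Nat.pos_of_mul_pos_right hpos
  have hb : 0 < b := Nat.pos_of_mul_pos_left hpos
  have hle : (powMonoidHom b : G →* G).range ≤ (powMonoidHom a : G →* G).ker := by
    rintro _ ⟨x, rfl⟩
    rw [MonoidHom.mem_ker, powMonoidHom_apply, powMonoidHom_apply, ← pow_mul, mul_comm, ← hG,
      pow_card_eq_one']
  have heq : (powMonoidHom b : G →* G).range = (powMonoidHom a : G →* G).ker := by
    refine Subgroup.eq_of_le_of_card_ge hle ?_
    rw [IsCyclic.card_powMonoidHom_range, IsCyclic.card_powMonoidHom_ker, hG,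
      Nat.gcd_eq_right (Dvd.intro_left a rfl), Nat.gcd_eq_right (Dvd.intro b rfl),
      Nat.mul_div_cancel _ hb]
  obtain ⟨s, hs⟩ : r ∈ (powMonoidHom b : G →* G).range := by
    rw [heq]
    exact hr
  rw [powMonoidHom_apply] at hs
  have hcard : Nat.card (powMonoidHom b : G →* G).ker = b := by
    rw [IsCyclic.card_powMonoidHom_ker, hG, Nat.gcd_eq_right (Dvd.intro_left a rfl)]
  rw [← Nat.card_coe_set_eq]
  refine (Nat.card_congr ?_).trans hcard
  refine (Equiv.mulRight s⁻¹).subtypeEquiv fun x => ?_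
  change x ^ b = r ↔ (x * s⁻¹) ^ b = 1
  rw [mul_pow, inv_pow, hs, mul_inv_eq_one]

theorem ncard_pow_eq {K : Type*} [Field K] [Finite K] {a b : ℕ} (hK : Nat.card K = a * b + 1)
    {r : K} (hr0 : r ≠ 0) (hr : r ^ a = 1) : {x : K | x ^ b = r}.ncard = b := by
  have hcard : Nat.card Kˣ = a * b := by rw [Nat.card_units, hK, Nat.add_sub_cancel]
  have hpos : 0 < a * b := hcard ▸ Nat.card_pos
  have hb : b ≠ 0 := (Nat.pos_of_mul_pos_left hpos).ne'
  refine Eq.trans ?_ (ncard_pow_eq_of_isCyclic hcard (r := Units.mk0 r hr0)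
    (Units.ext (by simpa using hr)))
  rw [← Set.ncard_image_of_injective _ Units.val_injective]
  congr 1
  ext x
  constructor
  · intro hx
    have hx0 : x ≠ 0 := by
      rintro rfl
      exact hr0 (by rw [← show (0 : K) ^ b = r from hx, zero_pow hb])
    exact ⟨Units.mk0 x hx0, Units.ext (by simpa using hx), rfl⟩
  · rintro ⟨y, hy, rfl⟩
    have := congrArg Units.val hy
    simpa using this

variable {K : Type*} [Field K] [Finite K] {q : ℕ} (hq : IsPrimePow q) (hK : Nat.card K = q ^ 2)

include hq hK

theorem add_pow_conj (x y : K) : (x + y) ^ q = x ^ q + y ^ q := by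
  have := Fintype.ofFinite K
  obtain ⟨p, hp, n, hpp, hn⟩ := FiniteField.card' K
  obtain ⟨r, k, hr, hk, rfl⟩ := hq
  rw [← Nat.card_eq_fintype_card, hK] at hn
  have hdvd : p ∣ r := by
    refine hpp.dvd_of_dvd_pow (n := k) (hpp.dvd_of_dvd_pow (n := 2) ?_)
    rw [hn]
    exact dvd_pow_self p n.2.ne'
  rw [← (Nat.prime_dvd_prime_iff_eq hpp hr.nat_prime).mp hdvd]
  have := Fact.mk hpp
  exact add_pow_char_pow x y p k

theorem neg_pow_conj (x : K) : (-x) ^ q = -x ^ q := by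
  have h := add_pow_conj hq hK x (-x)
  rw [add_neg_cancel, zero_pow hq.ne_zero] at h
  exact (neg_eq_of_add_eq_zero_right h.symm).symm

theorem sub_pow_conj (x y : K) : (x - y) ^ q = x ^ q - y ^ q := by
  rw [sub_eq_add_neg, add_pow_conj hq hK, neg_pow_conj hq hK, sub_eq_add_neg]

theorem sum_pow_conj {ι : Type*} (s : Finset ι) (f : ι → K) :
    (∑ i ∈ s, f i) ^ q = ∑ i ∈ s, f i ^ q := by
  classical
  induction s using Finset.induction_on with
  | empty => simp [zero_pow hq.ne_zero]
  | insert i s hi ih => rw [Finset.sum_insert hi, Finset.sum_insert hi, add_pow_conj hq hK, ih]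

omit hq in
theorem pow_pow_conj (x : K) : (x ^ q) ^ q = x := by
  have := Fintype.ofFinite K
  have h := FiniteField.pow_card x
  rw [← Nat.card_eq_fintype_card, hK] at h
  rw [← pow_mul, ← pow_two, h]

theorem ncard_norm_eq {r : K} (hr0 : r ≠ 0) (hr : r ^ q = r) :
    {x : K | x ^ (q + 1) = r}.ncard = q + 1 := by
  have h1 := hq.one_lt
  refine ncard_pow_eq (a := q - 1) ?_ hr0 ?_
  · obtain ⟨k, rfl⟩ := Nat.exists_eq_add_of_lt h1
    rw [hK, show 1 + k + 1 - 1 = k + 1 by omega]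
    ring
  · rw [← mul_left_inj' hr0, ← pow_succ, Nat.sub_add_cancel h1.le, hr, one_mul]

/-- The admissible corner entries of a skew-Hermitian matrix: 0 and the q - 1 roots of z^{q-1} = -1.
-/
theorem ncard_conj_eq_neg : {z : K | z ^ q = -z}.ncard = q := by
  have h1 := hq.one_lt
  have h2 : {z : K | z ^ q = -z} = insert 0 {z : K | z ^ (q - 1) = -1} := by
    ext z
    simp only [Set.mem_ofPred_eq, Set.mem_insert_iff]
    by_cases hz : z = 0
    · simp [hz, hq.ne_zero]
    · rw [or_iff_right hz, ← mul_left_inj' hz (a := z ^ (q - 1)), ← pow_succ,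
        Nat.sub_add_cancel h1.le, neg_one_mul]
  have h3 : {z : K | z ^ (q - 1) = -1}.ncard = q - 1 := by
    refine ncard_pow_eq (a := q + 1) ?_ (neg_ne_zero.mpr one_ne_zero) ?_
    · obtain ⟨k, rfl⟩ := Nat.exists_eq_add_of_lt h1
      rw [hK, show 1 + k + 1 - 1 = k + 1 by omega]
      ring
    · rw [pow_succ, neg_pow_conj hq hK, one_pow]
      ring
  rw [h2, Set.ncard_insert_of_notMem, h3]
  · omega
  · rw [Set.mem_ofPred_eq, zero_pow (by omega)]
    exact (neg_ne_zero.mpr one_ne_zero).symm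

/-- Otherwise x = 1 forces c = -1, and all q² elements would satisfy x^q = x, an equation with at
most q solutions. -/
theorem exists_add_conj_ne_zero (c : K) : ∃ x : K, x + c * x ^ q ≠ 0 := by
  by_contra! h
  have h1 : c = -1 := by
    have := h 1
    rw [one_pow, mul_one] at this
    exact (neg_eq_of_add_eq_zero_right this).symm
  subst h1
  have h2 : {x : K | x ^ q = x}.ncard ≤ q := by
    rw [show {x : K | x ^ q = x} = insert 0 {x : K | x ^ (q - 1) = 1} from ?_]
    · have h3 : {x : K | x ^ (q - 1) = 1}.ncard = q - 1 := by
        refine ncard_pow_eq (a := q + 1) ?_ one_ne_zero (one_pow _)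
        obtain ⟨k, rfl⟩ := Nat.exists_eq_add_of_lt hq.one_lt
        rw [hK, show 1 + k + 1 - 1 = k + 1 by omega]
        ring
      refine (Set.ncard_insert_le _ _).trans ?_
      have := hq.one_lt
      omega
    · ext x
      simp only [Set.mem_ofPred_eq, Set.mem_insert_iff]
      by_cases hx : x = 0
      · simp [hx, hq.ne_zero]
      · rw [or_iff_right hx, ← mul_left_inj' hx (a := x ^ (q - 1)), ← pow_succ,
          Nat.sub_add_cancel hq.one_lt.le, one_mul]
  have h3 : {x : K | x ^ q = x} = Set.univ := by
    ext x
    have := h x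
    simp only [Set.mem_ofPred_eq, Set.mem_univ, iff_true]
    rw [neg_one_mul, ← sub_eq_add_neg, sub_eq_zero] at this
    exact this.symm
  rw [h3, Set.ncard_univ, hK] at h2
  have := hq.one_lt
  nlinarith

end FiniteField

/-! ### Isotropic vectors of Hermitian forms over a finite field -/

section HermitianCount

variable {K : Type*} [Field K] [Finite K] {q : ℕ} (hq : IsPrimePow q) (hK : Nat.card K = q ^ 2)
variable {V : Type*} [AddCommGroup V] [Module K V] [Finite V]
variable {H : V → V →ₗ[K] K} {c : K} (hH : ∀ u v, H v u = c * H u v ^ q)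

/-- The radical of the restriction of a form to the subspace `U`. -/
def formRadical (H : V → V →ₗ[K] K) (U : Submodule K V) : Submodule K V :=
  U ⊓ ⨅ v ∈ U, LinearMap.ker (H v)

omit [Finite K] [Finite V] in
theorem mem_formRadical {U : Submodule K V} {u : V} :
    u ∈ formRadical H U ↔ u ∈ U ∧ ∀ v ∈ U, H v u = 0 := by
  simp [formRadical]

include hH in
omit [Finite K] [Finite V] in
theorem form_comm_eq_zero {u v : V} (h : H u v = 0) (hq0 : q ≠ 0) : H v u = 0 := by
  rw [hH, h, zero_pow hq0, mul_zero]

include hq hK hH in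
omit [Finite V] in
theorem form_add_left (u v w : V) : H (u + v) w = H u w + H v w := by
  rw [hH w, hH w u, hH w v, map_add, add_pow_conj hq hK, mul_add]

include hH in
omit [Finite K] [Finite V] in
theorem form_smul_left (x : K) (u w : V) : H (x • u) w = x ^ q * H u w := by
  rw [hH w, hH w u, map_smul, smul_eq_mul, mul_pow]
  ring

include hq hK hH in
omit [Finite V] in
-- Polarization: if every vector were isotropic, rescaling v so that H(u, v) = x would give H(u+v,
-- u+v) = x + c x^q, which is nonzero for a suitable x.
theorem exists_anisotropic {U : Submodule K V} {u v : V} (hu : u ∈ U) (hv : v ∈ U)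
    (huv : H u v ≠ 0) : ∃ e ∈ U, H e e ≠ 0 := by
  by_contra! h
  obtain ⟨x, hx⟩ := exists_add_conj_ne_zero hq hK c
  have h1 := h (u + (x / H u v) • v) (U.add_mem hu (U.smul_mem _ hv))
  have h2 := h _ (U.smul_mem (x / H u v) hv)
  rw [map_add, form_add_left hq hK hH, form_add_left hq hK hH, h u hu, h2,
    hH u ((x / H u v) • v), map_smul, smul_eq_mul, div_mul_cancel₀ x huv] at h1
  apply hx
  linear_combination h1

/-- The decomposition of a subspace into an anisotropic line and its orthogonal complement. -/
def anisotropicSplitting {U : Submodule K V} {e : V} (he : e ∈ U) (hee : H e e ≠ 0) :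
    (K × ↥(U ⊓ LinearMap.ker (H e))) ≃ₗ[K] U where
  toFun x := ⟨x.1 • e + x.2.1, U.add_mem (U.smul_mem _ he) x.2.2.1⟩
  map_add' x y := Subtype.ext (by
    simp only [Prod.fst_add, Prod.snd_add, Submodule.coe_add, add_smul]
    abel)
  map_smul' a x := Subtype.ext (by
    simp [smul_smul])
  invFun u := (H e u / H e e, ⟨u - (H e u / H e e) • e,
    ⟨U.sub_mem u.2 (U.smul_mem _ he), by
      rw [SetLike.mem_coe, LinearMap.mem_ker, map_sub, map_smul, smul_eq_mul,
        div_mul_cancel₀ _ hee, sub_self]⟩⟩)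
  left_inv x := by
    have h : H e x.2.1 = 0 := x.2.2.2
    refine Prod.ext ?_ (Subtype.ext ?_) <;>
      simp [map_add, map_smul, h, mul_div_cancel_right₀ _ hee]
  right_inv u := Subtype.ext (by simp)

include hq hK hH in
omit [Finite V] in
theorem formRadical_inf_ker {U : Submodule K V} {e : V} (he : e ∈ U) (hee : H e e ≠ 0) :
    formRadical H (U ⊓ LinearMap.ker (H e)) = formRadical H U := by
  ext u
  rw [mem_formRadical, mem_formRadical]
  constructor
  · rintro ⟨hu, h⟩
    refine ⟨hu.1, fun v hv => ?_⟩
    obtain ⟨⟨x, w⟩, hxw⟩ := (anisotropicSplitting he hee).surjective ⟨v, hv⟩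
    have h1 : x • e + w.1 = v := congrArg Subtype.val hxw
    rw [← h1, form_add_left hq hK hH, form_smul_left hH, show H e u = 0 from hu.2, h _ w.2, mul_zero,
      add_zero]
  · rintro ⟨hu, h⟩
    exact ⟨⟨hu, h e he⟩, fun v hv => h v hv.1⟩

open Classical in
include hq hK hH in
omit [Finite V] in
-- The condition is the norm equation x^{q+1} = -H(v,v)/H(e,e). Its right side lies in the field
-- with q elements, since numerator and denominator carry the same factor c under conjugation.
theorem ncard_line {e v : V} (hee : H e e ≠ 0) (hev : H e v = 0) :
    {x : K | H (x • e + v) (x • e + v) = 0}.ncard = if H v v = 0 then 1 else q + 1 := by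
  have hve : H v e = 0 := form_comm_eq_zero hH hev hq.ne_zero
  have h1 : ∀ x : K, H (x • e + v) (x • e + v) = x ^ (q + 1) * H e e + H v v := by
    intro x
    rw [form_add_left hq hK hH, form_smul_left hH, map_add, map_add, map_smul, map_smul, hev, hve,
      smul_eq_mul, smul_eq_mul]
    ring
  simp only [h1]
  split_ifs with h
  · rw [Set.ncard_eq_one]
    refine ⟨0, ?_⟩
    ext x
    simp [h, hee]
  · refine Eq.trans ?_ (ncard_norm_eq hq hK (r := -H v v / H e e)
      (div_ne_zero (neg_ne_zero.mpr h) hee) ?_)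
    · congr 1
      ext x
      rw [Set.mem_ofPred_eq, Set.mem_ofPred_eq, eq_div_iff hee, add_eq_zero_iff_eq_neg]
    · have e1 := hH e e
      have e2 := hH v v
      have e3 : H e e ^ q ≠ 0 := pow_ne_zero _ hee
      rw [div_pow, neg_pow_conj hq hK, div_eq_div_iff e3 hee]
      linear_combination H v v ^ q * (-e1) + H e e ^ q * e2

include hq hK hH in
/-- The number of isotropic vectors in a subspace on which the form has rank `r`. -/
theorem card_isotropic (r : ℕ) : ∀ U : Submodule K V,
    Module.finrank K U = Module.finrank K (formRadical H U) + r →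
    (Nat.card {u : U // H u u = 0} : ℝ) * q =
      Nat.card U * (1 + (q - 1) * (-(q : ℝ)⁻¹) ^ r) := by
  have hq0 : (q : ℝ) ≠ 0 := by exact_mod_cast hq.ne_zero
  have hfin : ∀ U : Submodule K V, Finite U := fun U => inferInstance
  have hfd : FiniteDimensional K V := Module.Finite.of_finite
  induction r with
  | zero =>
    intro U hU
    have h1 : formRadical H U = U := Submodule.eq_of_le_of_finrank_eq inf_le_left (by omega)
    have h2 : Nat.card {u : U // H u u = 0} = Nat.card U := by
      refine Nat.card_congr (Equiv.subtypeUnivEquiv fun u => ?_)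
      have h3 : (u : V) ∈ formRadical H U := by rw [h1]; exact u.2
      exact (mem_formRadical.mp h3).2 u u.2
    rw [h2]
    ring
  | succ r ih =>
    intro U hU
    obtain ⟨u, hu, v, hv, huv⟩ : ∃ u ∈ U, ∃ v ∈ U, H u v ≠ 0 := by
      by_contra! h
      have h1 : formRadical H U = U :=
        le_antisymm inf_le_left fun u hu => mem_formRadical.mpr ⟨hu, fun v hv => h v hv u hu⟩
      rw [h1] at hU
      omega
    obtain ⟨e, he, hee⟩ := exists_anisotropic hq hK hH hu hv huv
    set W := U ⊓ LinearMap.ker (H e) with hW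
    have h1 := (anisotropicSplitting he hee).finrank_eq
    rw [Module.finrank_prod, Module.finrank_self] at h1
    have h2 := ih W (by rw [hW, formRadical_inf_ker hq hK hH he hee]; omega)
    have h3 := Nat.card_congr (anisotropicSplitting he hee).toEquiv
    rw [Nat.card_prod, hK] at h3
    have h4 : Nat.card {u : U // H u u = 0} =
        Nat.card (Σ w : W, {x : K | H (x • e + w) (x • e + w) = 0}) := by
      refine Nat.card_congr (Equiv.trans ?_ (Equiv.trans
        (Equiv.subtypeProdEquivSigmaSubtype fun (w : W) (x : K) =>
          H (x • e + w) (x • e + w) = 0) (Equiv.refl _)))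
      exact (((Equiv.prodComm _ _).trans (anisotropicSplitting he hee).toEquiv).subtypeEquiv
        fun _ => Iff.rfl).symm
    have := Fintype.ofFinite W
    classical
    -- The isotropic vectors are counted over their components w in the complement of e: one above
    -- each isotropic w and q + 1 above each other w.
    have h5 : (Nat.card {u : U // H u u = 0} : ℝ) =
        (q + 1) * Nat.card W - q * Nat.card {w : W // H w w = 0} := by
      have h6 : ∀ w : W, ((if H w w = 0 then 1 else q + 1 : ℕ) : ℝ) =
          (q + 1) - q * (if H w w = 0 then 1 else 0) := by
        intro w
        split_ifs <;> push_cast <;> ring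
      rw [h4, Nat.card_sigma]
      simp only [Nat.card_coe_set_eq]
      rw [Finset.sum_congr rfl fun (w : W) _ => ncard_line hq hK hH hee w.2.2]
      push_cast
      simp only [Nat.cast_ite, Nat.cast_add, Nat.cast_one] at h6
      rw [Finset.sum_congr rfl fun w _ => h6 w, Finset.sum_sub_distrib, ← Finset.mul_sum,
        Finset.sum_boole, Finset.sum_const, Nat.card_eq_fintype_card (α := W),
        Nat.card_eq_fintype_card (α := {w : W // H w w = 0}), Fintype.card_subtype (α := W), Finset.card_univ, nsmul_eq_mul]
      ring
    rw [h5, ← h3, ← hW]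
    push_cast
    rw [pow_succ]
    have h7 : (q : ℝ) * (Nat.card {w : W // H w w = 0} : ℝ) =
        Nat.card W * (1 + (q - 1) * (-(q : ℝ)⁻¹) ^ r) := by rw [← h2]; ring
    rw [h7]
    linear_combination (Nat.card W : ℝ) * (-(q : ℝ)⁻¹) ^ r * q * (q - 1) * mul_inv_cancel₀ hq0

end HermitianCount

end HLUnitary

end

noncomputable section

namespace HLUnitary

/-! ### Jordan block multiplicities from kernel dimensions -/

section KernelDimensions

variable {K V V' : Type*} [Field K] [AddCommGroup V] [Module K V] [AddCommGroup V'] [Module K V']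

theorem finrank_submodule_prod [FiniteDimensional K V] [FiniteDimensional K V']
    (p : Submodule K V) (p' : Submodule K V') :
    Module.finrank K (p.prod p') = Module.finrank K p + Module.finrank K p' := by
  let e : p.prod p' ≃ₗ[K] p × p' :=
    { toFun := fun x => (⟨x.1.1, x.2.1⟩, ⟨x.1.2, x.2.2⟩)
      map_add' := fun _ _ => rfl
      map_smul' := fun _ _ => rfl
      invFun := fun x => ⟨(x.1.1, x.2.1), ⟨x.1.2, x.2.2⟩⟩
      left_inv := fun _ => rfl
      right_inv := fun _ => rfl }
  rw [e.finrank_eq, Module.finrank_prod]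

theorem finrank_comap_eq [FiniteDimensional K V] (f : V →ₗ[K] V') (S : Submodule K V') :
    Module.finrank K (S.comap f) =
      Module.finrank K (LinearMap.ker f) + Module.finrank K ↥(S ⊓ LinearMap.range f) := by
  have h1 := (f.domRestrict (S.comap f)).finrank_range_add_finrank_ker
  have h2 : LinearMap.range (f.domRestrict (S.comap f)) = S ⊓ LinearMap.range f := by
    ext x
    constructor
    · rintro ⟨u, rfl⟩
      exact ⟨u.2, ⟨u.1, rfl⟩⟩
    · rintro ⟨hx, u, rfl⟩
      exact ⟨⟨u, hx⟩, rfl⟩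
  have hle : LinearMap.ker f ≤ S.comap f := by
    intro u hu
    rw [Submodule.mem_comap, LinearMap.mem_ker.mp hu]
    exact S.zero_mem
  have h3 : LinearMap.ker (f.domRestrict (S.comap f)) =
      (LinearMap.ker f).comap (S.comap f).subtype := LinearMap.ker_comp _ _
  rw [h2, h3, (Submodule.comapSubtypeEquivOfLe hle).finrank_eq] at h1
  omega

theorem finrank_ker_pow_conj {X : Module.End K V} {X' : Module.End K V'} (e : V ≃ₗ[K] V')
    (h : ∀ v, e (X v) = X' (e v)) (j : ℕ) :
    Module.finrank K (LinearMap.ker (X ^ j)) = Module.finrank K (LinearMap.ker (X' ^ j)) := by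
  have h1 : ∀ v, e ((X ^ j) v) = (X' ^ j) (e v) := by
    intro v
    induction j with
    | zero => rfl
    | succ j ih => rw [pow_succ', pow_succ', Module.End.mul_apply, Module.End.mul_apply, h, ih]
  have h2 : LinearMap.ker (X ^ j) = (LinearMap.ker (X' ^ j)).comap e.toLinearMap := by
    ext v
    rw [LinearMap.mem_ker, Submodule.mem_comap, LinearMap.mem_ker, LinearEquiv.coe_coe, ← h1,
      LinearEquiv.map_eq_zero_iff]
  rw [h2]
  exact (LinearEquiv.ofSubmodule' e (LinearMap.ker (X' ^ j))).finrank_eq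

variable [FiniteDimensional K V] (X : Module.End K V)

/-- The number of Jordan blocks of the eigenvalue zero that have length greater than `j`. -/
def tailMult (j : ℕ) : ℕ := Module.finrank K ↥(LinearMap.ker X ⊓ LinearMap.range (X ^ j))

/-- The number of Jordan blocks of the eigenvalue zero that have length `a`. -/
def jordanMult (a : ℕ) : ℕ := tailMult X (a - 1) - tailMult X a

theorem finrank_ker_pow_succ (j : ℕ) :
    Module.finrank K (LinearMap.ker (X ^ (j + 1))) =
      Module.finrank K (LinearMap.ker (X ^ j)) + tailMult X j := by
  have h : LinearMap.ker (X ^ (j + 1)) = (LinearMap.ker X).comap (X ^ j) := by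
    rw [pow_succ']
    exact LinearMap.ker_comp _ _
  rw [h, finrank_comap_eq, tailMult]

theorem tailMult_succ_le (j : ℕ) : tailMult X (j + 1) ≤ tailMult X j := by
  refine Submodule.finrank_mono (inf_le_inf_left _ ?_)
  rw [pow_succ]
  exact LinearMap.range_comp_le_range _ _

variable {X}

omit [FiniteDimensional K V] in
theorem tailMult_eq_zero {j : ℕ} (h : X ^ j = 0) : tailMult X j = 0 := by
  rw [tailMult, h, LinearMap.range_zero, inf_bot_eq, finrank_bot]

theorem pow_finrank_eq_zero (h : IsNilpotent X) : X ^ Module.finrank K V = 0 := by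
  obtain ⟨k, hk⟩ := h
  have := LinearMap.ker_eq_top.mpr hk
  rw [← LinearMap.ker_eq_top, eq_top_iff, ← this]
  exact Module.End.ker_pow_le_ker_pow_finrank X k

theorem jordanMult_eq_zero (h : IsNilpotent X) {j : ℕ} (hj : Module.finrank K V < j) :
    jordanMult X j = 0 := by
  have h1 : X ^ (j - 1) = 0 := pow_eq_zero_of_le (by omega) (pow_finrank_eq_zero h)
  rw [jordanMult, tailMult_eq_zero h1, Nat.zero_sub]

theorem tailCount_jordanMult (h : IsNilpotent X) {L j : ℕ} (hL : Module.finrank K V ≤ L) :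
    tailCount (jordanMult X) L (j + 1) = tailMult X j := by
  have h0 : ∀ i, L ≤ i → tailMult X i = 0 := fun i hi =>
    tailMult_eq_zero (pow_eq_zero_of_le (by omega) (pow_finrank_eq_zero h))
  by_cases hj : L ≤ j
  · rw [tailCount_eq_zero (by omega), h0 j hj]
  · induction hk : L - j generalizing j with
    | zero => omega
    | succ k ih =>
      rw [tailCount_eq_add _ (by omega), jordanMult, Nat.add_sub_cancel]
      by_cases hj' : L ≤ j + 1
      · rw [tailCount_eq_zero (by omega), h0 _ hj']
        rfl
      · rw [ih hj' (by omega)]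
        exact Nat.sub_add_cancel (tailMult_succ_le X j)

theorem finrank_ker_pow_eq_sum (j : ℕ) :
    Module.finrank K (LinearMap.ker (X ^ j)) = ∑ i ∈ Finset.range j, tailMult X i := by
  induction j with
  | zero =>
    rw [pow_zero, show LinearMap.ker (1 : Module.End K V) = ⊥ from LinearMap.ker_id]
    simp
  | succ j ih => rw [finrank_ker_pow_succ, ih, Finset.sum_range_succ]

theorem wordSize_eq_sum_tailCount (m : ℕ → ℕ) (L : ℕ) :
    wordSize m L = ∑ j ∈ Finset.range L, tailCount m L (j + 1) := by
  have h : ∀ i ∈ Finset.Icc 1 L, i * m i =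
      ∑ j ∈ Finset.range L, if j + 1 ≤ i then m i else 0 := by
    intro i hi
    rw [Finset.mem_Icc] at hi
    rw [← Finset.sum_filter, Finset.sum_const, smul_eq_mul]
    congr 1
    rw [show (Finset.range L).filter (fun j => j + 1 ≤ i) = Finset.range i from ?_,
      Finset.card_range]
    ext j
    simp only [Finset.mem_filter, Finset.mem_range]
    omega
  rw [wordSize, Finset.sum_congr rfl h, Finset.sum_comm]
  refine Finset.sum_congr rfl fun j _ => ?_
  rw [← Finset.sum_filter, tailCount]
  refine Finset.sum_congr ?_ fun _ _ => rfl
  ext i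
  simp only [Finset.mem_filter, Finset.mem_Icc]
  omega

theorem wordSize_jordanMult (h : IsNilpotent X) :
    wordSize (jordanMult X) (Module.finrank K V) = Module.finrank K V := by
  rw [wordSize_eq_sum_tailCount, Finset.sum_congr rfl fun j _ => tailCount_jordanMult h le_rfl,
    ← finrank_ker_pow_eq_sum, pow_finrank_eq_zero h, LinearMap.ker_zero, finrank_top]

/-- Two endomorphisms with the same dimensions of the kernels of all powers have the same
numbers of Jordan blocks. -/
theorem tailMult_eq_of_finrank [FiniteDimensional K V'] {X' : Module.End K V'}
    (h : ∀ j, Module.finrank K (LinearMap.ker (X ^ j)) =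
      Module.finrank K (LinearMap.ker (X' ^ j))) (j : ℕ) : tailMult X j = tailMult X' j := by
  have h1 := h (j + 1)
  rw [finrank_ker_pow_succ, finrank_ker_pow_succ, h j] at h1
  omega

variable (X)

/-- The subspace `Im X + Ker X ^ a`. -/
def imKer (a : ℕ) : Submodule K V := LinearMap.range X ⊔ LinearMap.ker (X ^ a)

theorem finrank_ker_inf_range (a : ℕ) :
    Module.finrank K ↥(LinearMap.ker (X ^ a) ⊓ LinearMap.range X) +
      Module.finrank K (LinearMap.ker X) =
    Module.finrank K (LinearMap.ker (X ^ (a + 1))) := by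
  have h : LinearMap.ker (X ^ (a + 1)) = (LinearMap.ker (X ^ a)).comap X := by
    rw [pow_succ]
    exact LinearMap.ker_comp _ _
  rw [h, finrank_comap_eq, add_comm]

theorem finrank_imKer (a : ℕ) :
    Module.finrank K (imKer X a) + tailMult X a = Module.finrank K V := by
  have h1 := Submodule.finrank_sup_add_finrank_inf_eq (LinearMap.range X) (LinearMap.ker (X ^ a))
  have h2 := finrank_ker_inf_range X a
  have h3 := X.finrank_range_add_finrank_ker
  rw [finrank_ker_pow_succ] at h2
  rw [inf_comm, ← imKer] at h1
  omega

omit [FiniteDimensional K V] in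
theorem ker_pow_le {a b : ℕ} (h : a ≤ b) : LinearMap.ker (X ^ a) ≤ LinearMap.ker (X ^ b) := by
  obtain ⟨c, rfl⟩ := Nat.exists_eq_add_of_le h
  rw [add_comm, pow_add]
  exact LinearMap.ker_le_ker_comp _ _

omit [FiniteDimensional K V] in
theorem imKer_mono {a b : ℕ} (h : a ≤ b) : imKer X a ≤ imKer X b :=
  sup_le_sup_left (ker_pow_le X h) _

omit [FiniteDimensional K V] in
theorem imKer_succ (a : ℕ) : imKer X (a + 1) = imKer X a ⊔ LinearMap.ker (X ^ (a + 1)) := by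
  rw [imKer, imKer, sup_assoc, sup_eq_right.mpr (ker_pow_le X (Nat.le_succ a))]

/-- The number of blocks of length a + 1 is the dimension of Ker X^{a+1} modulo its intersection
with Im X + Ker X^a. It is the rank of the Hermitian form considered below. -/
theorem finrank_ker_inf_imKer (a : ℕ) :
    Module.finrank K (LinearMap.ker (X ^ (a + 1))) =
      Module.finrank K ↥(LinearMap.ker (X ^ (a + 1)) ⊓ imKer X a) + jordanMult X (a + 1) := by
  have h1 := Submodule.finrank_sup_add_finrank_inf_eq (imKer X a) (LinearMap.ker (X ^ (a + 1)))
  rw [← imKer_succ, inf_comm] at h1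
  have h2 := finrank_imKer X a
  have h3 := finrank_imKer X (a + 1)
  have h4 := tailMult_succ_le X a
  rw [jordanMult, Nat.add_sub_cancel]
  omega

end KernelDimensions

/-! ### Skew-adjoint endomorphisms of a unitary space -/

section UnitaryForm

variable {K V : Type*} [Field K] [AddCommGroup V] [Module K V]

/-- A nondegenerate Hermitian form, linear in the second variable. -/
structure IsUnitaryForm (q : ℕ) (τ : V → V →ₗ[K] K) : Prop where
  herm : ∀ u v, τ v u = τ u v ^ q
  surj : Function.Surjective τ

/-- An endomorphism that is skew-adjoint for the form. -/
def IsSkewEnd (τ : V → V →ₗ[K] K) (X : Module.End K V) : Prop := ∀ u v, τ (X u) v = -τ u (X v)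

variable {q : ℕ} {τ : V → V →ₗ[K] K} {X : Module.End K V}

theorem IsSkewEnd.pow (hX : IsSkewEnd τ X) (j : ℕ) (u v : V) :
    τ ((X ^ j) u) v = (-1) ^ j * τ u ((X ^ j) v) := by
  induction j generalizing v with
  | zero => simp
  | succ j ih =>
    rw [pow_succ', Module.End.mul_apply, hX, ih, ← Module.End.mul_apply, ← pow_succ, pow_succ',
      pow_succ']
    ring

theorem IsUnitaryForm.eq_zero (hτ : IsUnitaryForm q τ) {u : V} (h : ∀ v, τ v u = 0) : u = 0 := by
  refine (Module.forall_dual_apply_eq_zero_iff K u).mp fun f => ?_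
  obtain ⟨v, rfl⟩ := hτ.surj f
  exact h v

theorem IsUnitaryForm.injective (hτ : IsUnitaryForm q τ) : Function.Injective τ := by
  intro u u' h
  rw [← sub_eq_zero]
  refine hτ.eq_zero fun v => ?_
  rw [map_sub, hτ.herm u, hτ.herm u', h, sub_self]

variable [Finite K] (hq : IsPrimePow q) (hK : Nat.card K = q ^ 2)

include hq hK in
-- The orthogonal complement of Ker X^j lies in Im X^j: a functional that kills the kernel factors
-- through X^j, and X^j is its own adjoint up to sign.
theorem IsUnitaryForm.mem_range_of_orthogonal (hτ : IsUnitaryForm q τ) (hX : IsSkewEnd τ X) {j : ℕ}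
    {u : V} (h : ∀ v ∈ LinearMap.ker (X ^ j), τ u v = 0) : u ∈ LinearMap.range (X ^ j) := by
  have h1 : τ u ∈ LinearMap.range (LinearMap.dualMap (X ^ j)) := by
    rw [LinearMap.range_dualMap_eq_dualAnnihilator_ker, Submodule.mem_dualAnnihilator]
    exact h
  obtain ⟨g, hg⟩ := h1
  obtain ⟨w, rfl⟩ := hτ.surj g
  have hs : ((-1 : K) ^ j) ^ q = (-1) ^ j := by
    rw [← pow_mul, mul_comm, pow_mul, neg_pow_conj hq hK, one_pow]
  have h2 : u = (X ^ j) ((-1 : K) ^ j • w) := by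
    refine hτ.injective (LinearMap.ext fun v => ?_)
    rw [hX.pow, hτ.herm _ (_ • w), map_smul, smul_eq_mul, mul_pow, hs, ← hτ.herm, ← mul_assoc, ← mul_pow,
      neg_one_mul, neg_neg, one_pow, one_mul, ← hg]
    rfl
  rw [h2]
  exact ⟨_, rfl⟩

include hq hK in
-- The form τ(u, X^j v) is Hermitian up to the sign (-1)^j. This is why `card_isotropic` allows a
-- constant c.
theorem IsUnitaryForm.herm_pow (hτ : IsUnitaryForm q τ) (hX : IsSkewEnd τ X) (j : ℕ) (u v : V) :
    (τ v ∘ₗ X ^ j) u = (-1) ^ j * ((τ u ∘ₗ X ^ j) v) ^ q := by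
  have hs : ((-1 : K) ^ j) ^ q = (-1) ^ j := by
    rw [← pow_mul, mul_comm, pow_mul, neg_pow_conj hq hK, one_pow]
  rw [LinearMap.comp_apply, LinearMap.comp_apply, hτ.herm, hX.pow, mul_pow, hs]

include hq hK in
/-- The radical of the form `(u, v) ↦ τ(u, X ^ a v)` on the kernel of `X ^ (a + 1)`. -/
theorem IsUnitaryForm.formRadical_eq (hτ : IsUnitaryForm q τ) (hX : IsSkewEnd τ X) (a : ℕ) :
    formRadical (fun v => τ v ∘ₗ X ^ a) (LinearMap.ker (X ^ (a + 1))) =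
      LinearMap.ker (X ^ (a + 1)) ⊓ imKer X a := by
  have hq0 := hq.ne_zero
  ext u
  rw [mem_formRadical, Submodule.mem_inf]
  refine and_congr_right fun hu => ?_
  rw [imKer]
  constructor
  · intro h
    have h1 : (X ^ a) u ∈ LinearMap.range (X ^ (a + 1)) := by
      refine hτ.mem_range_of_orthogonal hq hK hX fun v hv => ?_
      have h2 : τ v ((X ^ a) u) = 0 := h v hv
      rw [hτ.herm, h2, zero_pow hq0]
    obtain ⟨w, hw⟩ := h1
    refine Submodule.mem_sup.mpr ⟨X w, ⟨w, rfl⟩, u - X w, ?_, by abel⟩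
    rw [LinearMap.mem_ker, map_sub, ← hw, pow_succ, Module.End.mul_apply, sub_self]
  · intro h v hv
    obtain ⟨_, ⟨w, rfl⟩, y, hy, rfl⟩ := Submodule.mem_sup.mp h
    rw [LinearMap.mem_ker] at hv hy
    have h1 : (X ^ a) (X w) = (X ^ (a + 1)) w := by rw [pow_succ, Module.End.mul_apply]
    rw [LinearMap.comp_apply, map_add, hy, add_zero, h1]
    have h2 := hX.pow (a + 1) v w
    rw [hv] at h2
    have h3 : τ 0 w = 0 := by rw [hτ.herm, map_zero, zero_pow hq0]
    rw [h3] at h2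
    exact (mul_eq_zero.mp h2.symm).resolve_left (pow_ne_zero _ (neg_ne_zero.mpr one_ne_zero))

end UnitaryForm

end HLUnitary

end

noncomputable section

namespace HLUnitary

/-! ### Extensions by a column and a corner entry, and their kernel dimensions -/

section Extension

variable {K V : Type*} [Field K] [AddCommGroup V] [Module K V]

/-- The extension of a skew-adjoint endomorphism `X` by a column `y` and a corner entry `z`. -/
def extendEnd (τ : V → V →ₗ[K] K) (X : Module.End K V) (y : V) (z : K) :
    Module.End K (K × V × K) where
  toFun p := (z * p.2.2 - τ y p.2.1, X p.2.1 + p.2.2 • y, 0)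
  map_add' p p' := by
    ext <;> simp [mul_add, add_smul]
    · ring
    · abel
  map_smul' a p := by
    ext <;> simp [mul_smul]
    ring

variable {q : ℕ} {τ : V → V →ₗ[K] K} {X : Module.End K V}

theorem extendEnd_apply (y : V) (z : K) (p : K × V × K) :
    extendEnd τ X y z p = (z * p.2.2 - τ y p.2.1, X p.2.1 + p.2.2 • y, 0) := rfl

theorem extendEnd_pow (y : V) (z : K) (i : ℕ) (p : K × V × K) :
    (extendEnd τ X y z ^ (i + 2)) p =
      (-τ y ((X ^ (i + 1)) p.2.1 + p.2.2 • (X ^ i) y),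
        (X ^ (i + 2)) p.2.1 + p.2.2 • (X ^ (i + 1)) y, 0) := by
  induction i with
  | zero =>
    rw [pow_two, Module.End.mul_apply, extendEnd_apply, extendEnd_apply]
    simp [pow_two]
  | succ i ih =>
    rw [pow_succ', Module.End.mul_apply, ih, extendEnd_apply]
    simp only [map_add, map_smul, ← Module.End.mul_apply, ← pow_succ', mul_zero, zero_smul, add_zero,
      zero_sub]

theorem extendEnd_isNilpotent (hX : IsNilpotent X) (y : V) (z : K) :
    IsNilpotent (extendEnd τ X y z) := by
  obtain ⟨k, hk⟩ := hX
  refine ⟨k + 2, LinearMap.ext fun p => ?_⟩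
  have h1 : ∀ j, k ≤ j → X ^ j = 0 := fun j hj => pow_eq_zero_of_le hj hk
  rw [extendEnd_pow, h1 (k + 1) (by omega), h1 (k + 2) (by omega), hk]
  simp

variable [Finite K] (hq : IsPrimePow q) (hK : Nat.card K = q ^ 2)

/-- A unipotent change of basis. -/
def shear (φ : V →ₗ[K] K) (w : V) : (K × V × K) ≃ₗ[K] (K × V × K) where
  toFun p := (p.1 - φ p.2.1, p.2.1 + p.2.2 • w, p.2.2)
  map_add' p p' := by
    ext <;> simp [add_smul]
    · ring
    · abel
  map_smul' a p := by
    ext <;> simp [mul_smul, mul_sub]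
  invFun p := (p.1 + φ (p.2.1 - p.2.2 • w), p.2.1 - p.2.2 • w, p.2.2)
  left_inv p := by ext <;> simp
  right_inv p := by ext <;> simp

include hq hK in
theorem IsUnitaryForm.add_left (hτ : IsUnitaryForm q τ) (u v w : V) :
    τ (u + v) w = τ u w + τ v w :=
  form_add_left (H := τ) (c := 1) hq hK (fun u v => by rw [one_mul, hτ.herm]) u v w

include hq hK in
-- A unipotent change of basis removes X w from the column at the cost of a change of the corner
-- entry. So y matters only modulo Im X.
theorem finrank_ker_extendEnd_shear (hτ : IsUnitaryForm q τ) (hX : IsSkewEnd τ X) (w y : V) (z : K)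
    (j : ℕ) :
    Module.finrank K (LinearMap.ker (extendEnd τ X (X w + y) z ^ j)) =
      Module.finrank K (LinearMap.ker
        (extendEnd τ X y (z - τ w (X w) - τ w y + τ y w) ^ j)) := by
  refine finrank_ker_pow_conj (shear (τ w) w) (fun p => ?_) j
  simp only [extendEnd_apply, shear, LinearEquiv.coe_mk, LinearMap.coe_mk, AddHom.coe_mk]
  ext
  · simp only [hτ.add_left hq hK, map_add, map_smul, smul_eq_mul, hX w]
    ring
  · simp only [map_add, map_smul, smul_add, zero_smul, add_zero]
    abel
  · rfl

variable [FiniteDimensional K V]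

omit [Finite K] [FiniteDimensional K V] in
theorem mem_ker_extendEnd_pow_iff (y : V) (z : K) (i : ℕ) (p : K × V × K) :
    p ∈ LinearMap.ker (extendEnd τ X y z ^ (i + 2)) ↔
      τ y ((X ^ (i + 1)) p.2.1 + p.2.2 • (X ^ i) y) = 0 ∧
        (X ^ (i + 2)) p.2.1 + p.2.2 • (X ^ (i + 1)) y = 0 := by
  rw [LinearMap.mem_ker, extendEnd_pow, Prod.mk_eq_zero, Prod.mk_eq_zero, neg_eq_zero]
  simp only [and_true]

omit [Finite K] in
theorem finrank_top_prod (S : Submodule K V) (T : Submodule K K) :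
    Module.finrank K ↥((⊤ : Submodule K K).prod (S.prod T)) =
      Module.finrank K S + (1 + Module.finrank K T) := by
  rw [finrank_submodule_prod, finrank_submodule_prod, finrank_top, Module.finrank_self]
  omega

open Classical in
omit [Finite K] in
/-- The kernel dimensions of the powers of an extension by the zero column. -/
theorem finrank_ker_extendEnd_zero (hτ : IsUnitaryForm q τ) (hq0 : q ≠ 0) (z : K) {j : ℕ}
    (hj : j ≠ 0) :
    Module.finrank K (LinearMap.ker (extendEnd τ X 0 z ^ j)) =
      Module.finrank K (LinearMap.ker (X ^ j)) +
        if j = 1 then (if z = 0 then 2 else 1) else 2 := by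
  have h0 : ∀ v, τ 0 v = 0 := fun v => by rw [hτ.herm, map_zero, zero_pow hq0]
  obtain rfl | ⟨i, rfl⟩ : j = 1 ∨ ∃ i, j = i + 2 := by
    rcases j with _ | _ | i
    · exact absurd rfl hj
    · exact Or.inl rfl
    · exact Or.inr ⟨i, rfl⟩
  · rw [if_pos rfl, pow_one, pow_one]
    have h1 : LinearMap.ker (extendEnd τ X 0 z) =
        (⊤ : Submodule K K).prod ((LinearMap.ker X).prod (if z = 0 then ⊤ else ⊥)) := by
      ext p
      rw [LinearMap.mem_ker, extendEnd_apply]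
      simp only [Prod.mk_eq_zero, h0, smul_zero, add_zero, sub_zero, mul_eq_zero, and_true,
        Submodule.mem_prod, Submodule.mem_top, LinearMap.mem_ker, true_and]
      split_ifs with hz
      · simp only [hz, true_or, true_and, Submodule.mem_top, and_true]
      · simp only [hz, false_or, Submodule.mem_bot, and_comm]
    rw [h1, finrank_top_prod]
    split_ifs with hz
    · rw [if_pos hz, finrank_top, Module.finrank_self]
    · rw [if_neg hz, finrank_bot]
  · rw [if_neg (by omega)]
    have h1 : LinearMap.ker (extendEnd τ X 0 z ^ (i + 2)) =
        (⊤ : Submodule K K).prod ((LinearMap.ker (X ^ (i + 2))).prod ⊤) := by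
      ext p
      rw [mem_ker_extendEnd_pow_iff]
      simp [h0]
    rw [h1, finrank_top_prod]
    simp

omit [Finite K] [FiniteDimensional K V] in
-- The corner entry z enters only the first power; in higher powers τ(y, X^{i-1} y) takes its place.
theorem mem_ker_extendEnd_pow_succ_iff (y : V) (z : K) (i : ℕ) (p : K × V × K) :
    p ∈ LinearMap.ker (extendEnd τ X y z ^ (i + 1)) ↔
      τ y ((X ^ i) p.2.1) = p.2.2 * (if i = 0 then z else -τ y ((X ^ (i - 1)) y)) ∧
        (X ^ (i + 1)) p.2.1 + p.2.2 • (X ^ i) y = 0 := by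
  rcases i with _ | i
  · rw [LinearMap.mem_ker, zero_add, pow_one, pow_one, extendEnd_apply, Prod.mk_eq_zero,
      Prod.mk_eq_zero, sub_eq_zero, mul_comm z, eq_comm]
    simp
  · rw [mem_ker_extendEnd_pow_iff, if_neg (Nat.succ_ne_zero i), map_add, map_smul, smul_eq_mul,
      mul_neg, add_eq_zero_iff_eq_neg]
    rfl

omit [Finite K] in
theorem finrank_inf_ker_add_one {S : Submodule K V} {φ : V →ₗ[K] K} {v : V} (hv : v ∈ S)
    (h : φ v ≠ 0) :
    Module.finrank K ↥(S ⊓ LinearMap.ker φ) + 1 = Module.finrank K S := by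
  have h1 : φ.domRestrict S ≠ 0 := fun h0 => h (LinearMap.congr_fun h0 ⟨v, hv⟩)
  have h2 : LinearMap.ker (φ.domRestrict S) = (S ⊓ LinearMap.ker φ).comap S.subtype := by
    ext u
    simp
  rw [← Module.Dual.finrank_ker_add_one_of_ne_zero h1, h2,
    (Submodule.comapSubtypeEquivOfLe inf_le_left).finrank_eq]

open Classical in
include hq hK in
/-- The kernel dimensions of the powers of an extension by a column `y` in the kernel of
`X ^ (a + 1)` that does not belong to `Im X + Ker X ^ a`. -/
theorem finrank_ker_extendEnd (hτ : IsUnitaryForm q τ) (hX : IsSkewEnd τ X) {a : ℕ} {y : V}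
    (hy : (X ^ (a + 1)) y = 0) (hy' : y ∉ imKer X a) (z : K) {j : ℕ} (hj : j ≠ 0) :
    Module.finrank K (LinearMap.ker (extendEnd τ X y z ^ j)) =
      Module.finrank K (LinearMap.ker (X ^ j)) +
        if j ≤ a + 1 then 0 else
          if j = a + 2 then (if τ y ((X ^ a) y) = 0 then 2 else 1) else 2 := by
  have hq0 := hq.ne_zero
  have h0 : ∀ v, τ 0 v = 0 := fun v => by rw [hτ.herm, map_zero, zero_pow hq0]
  split_ifs with h1 h2 h3
  · obtain ⟨i, rfl⟩ := Nat.exists_eq_succ_of_ne_zero hj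
    have hyi : y ∉ imKer X i := fun h => hy' (imKer_mono X (by omega) h)
    have hker : ∀ w, (X ^ i) (y - X w) ≠ 0 := fun w hw => hyi
      (Submodule.mem_sup.mpr ⟨X w, ⟨w, rfl⟩, y - X w, hw, by abel⟩)
    have h4 : LinearMap.ker (extendEnd τ X y z ^ (i + 1)) = (⊤ : Submodule K K).prod
        ((LinearMap.ker (X ^ (i + 1)) ⊓ LinearMap.ker (τ y ∘ₗ X ^ i)).prod ⊥) := by
      ext p
      rw [mem_ker_extendEnd_pow_succ_iff]
      simp only [Submodule.mem_prod, Submodule.mem_top, true_and, Submodule.mem_inf,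
        LinearMap.mem_ker, LinearMap.comp_apply, Submodule.mem_bot]
      constructor
      · rintro ⟨h5, h6⟩
        -- A nonzero last coordinate would give X^i (y - X w) = 0 for some w, and y would lie in Im
        -- X + Ker X^i.
        have hp : p.2.2 = 0 := by
          by_contra hp
          refine hker (-(p.2.2⁻¹ • p.2.1)) ?_
          have h7 := congrArg (fun v => p.2.2⁻¹ • v) h6
          simp only [smul_add, smul_smul, inv_mul_cancel₀ hp, one_smul, smul_zero] at h7
          rw [map_neg, sub_neg_eq_add, map_add, map_smul, map_smul, ← h7, pow_succ,
            Module.End.mul_apply, add_comm]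
        rw [hp, zero_mul] at h5
        rw [hp, zero_smul, add_zero] at h6
        exact ⟨⟨h6, h5⟩, hp⟩
      · rintro ⟨⟨h5, h6⟩, h7⟩
        rw [h5, h6, h7]
        simp
    -- The functional does not vanish on Ker X^{i+1}: otherwise X^i y would lie in Im X^{i+1}, and
    -- again y in Im X + Ker X^i. The dimension lost here cancels the one gained from the first
    -- coordinate.
    obtain ⟨v, hv, hv'⟩ : ∃ v ∈ LinearMap.ker (X ^ (i + 1)), (τ y ∘ₗ X ^ i) v ≠ 0 := by
      by_contra! h
      have h5 : (X ^ i) y ∈ LinearMap.range (X ^ (i + 1)) := by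
        refine hτ.mem_range_of_orthogonal hq hK hX fun v hv => ?_
        have h6 : τ y ((X ^ i) v) = 0 := h v hv
        rw [hX.pow, h6, mul_zero]
      obtain ⟨w, hw⟩ := h5
      refine hker w ?_
      rw [map_sub, ← hw, pow_succ, Module.End.mul_apply, sub_self]
    have h5 := finrank_inf_ker_add_one hv hv'
    rw [Nat.succ_eq_add_one, h4, finrank_top_prod, finrank_bot]
    omega
  all_goals
    obtain ⟨i, rfl⟩ := Nat.exists_eq_add_of_le' (show 2 ≤ j by omega)
    -- For j = i + 2 ≥ a + 2 the column no longer restricts the middle component. The only remaining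
    -- condition is that the last coordinate times τ(y, X^i y) vanishes.
    have h5 : (X ^ (i + 1)) y = 0 := by
      obtain ⟨b, rfl⟩ := Nat.exists_eq_add_of_le (show a ≤ i by omega)
      rw [show a + b + 1 = b + (a + 1) by ring, pow_add, Module.End.mul_apply, hy, map_zero]
    have h6 : ∀ v, τ y ((X ^ (i + 1)) v) = 0 := by
      intro v
      have h7 := hX.pow (i + 1) y v
      rw [h5, h0] at h7
      exact (mul_eq_zero.mp h7.symm).resolve_left (pow_ne_zero _ (neg_ne_zero.mpr one_ne_zero))
    have h4 : LinearMap.ker (extendEnd τ X y z ^ (i + 2)) = (⊤ : Submodule K K).prod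
        ((LinearMap.ker (X ^ (i + 2))).prod (if τ y ((X ^ i) y) = 0 then ⊤ else ⊥)) := by
      ext p
      rw [mem_ker_extendEnd_pow_iff, h5, map_add, h6, map_smul, smul_zero, add_zero, zero_add,
        smul_eq_mul, mul_eq_zero]
      simp only [Submodule.mem_prod, Submodule.mem_top, LinearMap.mem_ker, true_and]
      split_ifs with h8
      · simp only [h8, or_true, true_and, Submodule.mem_top, and_true]
      · simp only [h8, or_false, Submodule.mem_bot, and_comm]
    rw [h4, finrank_top_prod]
  · obtain rfl : i = a := by omega
    rw [if_pos h3, finrank_top, Module.finrank_self]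
  · obtain rfl : i = a := by omega
    rw [if_neg h3, finrank_bot]
  · have h7 : (X ^ i) y = 0 := by
      obtain ⟨b, rfl⟩ := Nat.exists_eq_add_of_le (show a + 1 ≤ i by omega)
      rw [add_comm, pow_add, Module.End.mul_apply, hy, map_zero]
    rw [h7, map_zero, if_pos rfl, finrank_top, Module.finrank_self]

end Extension

end HLUnitary

end

noncomputable section

namespace HLUnitary

/-! ### The Jordan type of an extension -/

section JordanMult

variable {K V V' : Type*} [Field K] [AddCommGroup V] [Module K V] [AddCommGroup V'] [Module K V']
  [FiniteDimensional K V] [FiniteDimensional K V'] {X : Module.End K V} {X' : Module.End K V'}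

/-- First differences of the kernel dimensions. The pattern means that one block of length b became
one of length b + 2; for b = 0 a block of length 2 is new. -/
theorem tailMult_up {b : ℕ}
    (h : ∀ j, j ≠ 0 → Module.finrank K (LinearMap.ker (X' ^ j)) =
      Module.finrank K (LinearMap.ker (X ^ j)) +
        if j ≤ b then 0 else if j = b + 1 then 1 else 2) (j : ℕ) :
    tailMult X' j = tailMult X j + if j = b then 1 else if j = b + 1 then 1 else 0 := by
  have h1 := finrank_ker_pow_succ X j
  have h2 := finrank_ker_pow_succ X' j
  have h3 := h (j + 1) (Nat.succ_ne_zero j)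
  have h4 : Module.finrank K (LinearMap.ker (X' ^ j)) =
      Module.finrank K (LinearMap.ker (X ^ j)) + if j ≤ b then 0 else if j = b + 1 then 1 else 2 := by
    rcases Nat.eq_zero_or_pos j with rfl | hj
    · rw [finrank_ker_pow_eq_sum, finrank_ker_pow_eq_sum, if_pos (Nat.zero_le b)]
      rfl
    · exact h j hj.ne'
  rw [h1, h2, h4] at h3
  split_ifs at h3 ⊢ <;> omega

/-- Here two blocks of length b became blocks of length b + 1; for b = 0 two blocks of length 1 are
new. -/
theorem tailMult_pair {b : ℕ}
    (h : ∀ j, j ≠ 0 → Module.finrank K (LinearMap.ker (X' ^ j)) =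
      Module.finrank K (LinearMap.ker (X ^ j)) + if j ≤ b then 0 else 2) (j : ℕ) :
    tailMult X' j = tailMult X j + if j = b then 2 else 0 := by
  have h1 := finrank_ker_pow_succ X j
  have h2 := finrank_ker_pow_succ X' j
  have h3 := h (j + 1) (Nat.succ_ne_zero j)
  have h4 : Module.finrank K (LinearMap.ker (X' ^ j)) =
      Module.finrank K (LinearMap.ker (X ^ j)) + if j ≤ b then 0 else 2 := by
    rcases Nat.eq_zero_or_pos j with rfl | hj
    · rw [finrank_ker_pow_eq_sum, finrank_ker_pow_eq_sum, if_pos (Nat.zero_le b)]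
      rfl
    · exact h j hj.ne'
  rw [h1, h2, h4] at h3
  split_ifs at h3 ⊢ <;> omega

theorem jordanMult_up {b : ℕ}
    (h : ∀ j, j ≠ 0 → Module.finrank K (LinearMap.ker (X' ^ j)) =
      Module.finrank K (LinearMap.ker (X ^ j)) +
        if j ≤ b then 0 else if j = b + 1 then 1 else 2) {j : ℕ} (hj : 1 ≤ j) :
    jordanMult X' j = if b = 0 then bump (jordanMult X) 2 1 j else upTwo (jordanMult X) b j := by
  have h1 := tailMult_up h
  have h2 := tailMult_succ_le X (j - 1)
  rw [Nat.sub_add_cancel hj] at h2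
  simp only [jordanMult, bump, upTwo, h1]
  split_ifs <;> omega

theorem jordanMult_pair {b : ℕ}
    (h : ∀ j, j ≠ 0 → Module.finrank K (LinearMap.ker (X' ^ j)) =
      Module.finrank K (LinearMap.ker (X ^ j)) + if j ≤ b then 0 else 2) {j : ℕ} (hj : 1 ≤ j) :
    jordanMult X' j = if b = 0 then bump (jordanMult X) 1 2 j else upPair (jordanMult X) b j := by
  have h1 := tailMult_pair h
  have h2 := tailMult_succ_le X (j - 1)
  rw [Nat.sub_add_cancel hj] at h2
  simp only [jordanMult, bump, upPair, h1]
  split_ifs <;> omega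

end JordanMult

/-! ### The number of extensions of each type, and coherence of the masses -/

section Coherence

open Classical in
-- All nonempty fibres of a linear map have the size of its kernel. This allows sums over subspaces
-- such as Im X + Ker X^a to be taken over parameters.
theorem sum_comp_linearMap {K A V : Type*} [Field K] [AddCommGroup A] [Module K A]
    [AddCommGroup V] [Module K V] [Fintype A] [Fintype V] (f : A →ₗ[K] V) (h : V → ℝ) :
    (∑ a, h (f a)) * Nat.card (LinearMap.range f) =
      Nat.card A * ∑ y with y ∈ LinearMap.range f, h y := by
  have key : ∀ h : V → ℝ, ∑ a, h (f a) =
      (Finset.univ.filter fun a => f a = 0).card * ∑ y with y ∈ LinearMap.range f, h y := by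
    intro h
    rw [← Finset.sum_fiberwise_of_maps_to (s := Finset.univ) (g := f)
      (t := Finset.univ.filter (· ∈ LinearMap.range f))
      (fun a _ => Finset.mem_filter.mpr ⟨Finset.mem_univ _, ⟨a, rfl⟩⟩), Finset.mul_sum]
    refine Finset.sum_congr rfl fun y hy => ?_
    rw [Finset.sum_congr rfl fun a ha => congrArg h (Finset.mem_filter.mp ha).2, Finset.sum_const,
      nsmul_eq_mul]
    congr 2
    exact AddMonoidHom.card_fiber_eq_of_mem_range f (Finset.mem_filter.mp hy).2 ⟨0, map_zero f⟩
  have h1 := key fun _ => 1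
  rw [Finset.sum_const, Finset.sum_const, nsmul_one, nsmul_one, Finset.card_univ,
    ← Nat.card_eq_fintype_card] at h1
  have h2 : Nat.card (LinearMap.range f) =
      (Finset.univ.filter (· ∈ LinearMap.range f)).card := by
    rw [Nat.card_eq_fintype_card, Fintype.card_subtype]
  rw [key, h1, h2]
  ring

variable {K V : Type*} [Field K] [AddCommGroup V] [Module K V] [Fintype K] [Fintype V]
  {q : ℕ} (hq : IsPrimePow q) (hK : Nat.card K = q ^ 2)
  {τ : V → V →ₗ[K] K} {X : Module.End K V} (hτ : IsUnitaryForm q τ) (hX : IsSkewEnd τ X)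

include hK in
omit [Fintype K] in
theorem natCard_submodule (S : Submodule K V) :
    (Nat.card S : ℝ) = (q : ℝ) ^ (2 * Module.finrank K S) := by
  rw [Module.natCard_eq_pow_finrank (K := K), hK, ← pow_mul]
  push_cast
  rfl

include hK in
omit [Fintype K] in
theorem natCard_imKer (hq0 : (q : ℝ) ≠ 0) (a : ℕ) : (Nat.card (imKer X a) : ℝ) =
    q ^ (2 * Module.finrank K V) / q ^ (2 * tailMult X a) := by
  have : FiniteDimensional K V := Module.Finite.of_finite
  rw [natCard_submodule hK, ← finrank_imKer X a, mul_add, pow_add, mul_div_cancel_right₀]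
  exact pow_ne_zero _ hq0

include hq hK hτ hX in
open Classical in
/-- The contribution to the coherence relation of the columns `y` in the image of `X`. -/
theorem sum_extendEnd_range (ε : Fin 2) :
    ∑ y with y ∈ imKer X 0, ∑ z : {z : K // z ^ q = -z},
        cylMass ε q (Module.finrank K V + 2) (jordanMult (extendEnd τ X y z)) =
      q ^ (2 * Module.finrank K V) / q ^ (2 * tailMult X 0) * (q - 1) *
          cylMass ε q (Module.finrank K V + 2) (bump (jordanMult X) 2 1) +
        q ^ (2 * Module.finrank K V) / q ^ (2 * tailMult X 0) *
          cylMass ε q (Module.finrank K V + 2) (bump (jordanMult X) 1 2) := by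
  have : FiniteDimensional K V := Module.Finite.of_finite
  have hq0 : (q : ℝ) ≠ 0 := by exact_mod_cast hq.ne_zero
  set N := Module.finrank K V with hN
  set A := cylMass ε q (N + 2) (bump (jordanMult X) 2 1)
  set B := cylMass ε q (N + 2) (bump (jordanMult X) 1 2)
  have hrange : imKer X 0 = LinearMap.range X := by
    rw [imKer, pow_zero, show LinearMap.ker (1 : Module.End K V) = ⊥ from LinearMap.ker_id,
      sup_bot_eq]
  have hcard : Fintype.card {z : K // z ^ q = -z} = q := by
    rw [← Nat.card_eq_fintype_card]
    exact (Nat.card_coe_set_eq _).trans (ncard_conj_eq_neg hq hK)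
  have h1 : ∀ w, ∑ z : {z : K // z ^ q = -z}, cylMass ε q (N + 2)
      (jordanMult (extendEnd τ X (X w) z)) = (q - 1) * A + B := by
    intro w
    have hc : τ w (X w) ^ q = -τ w (X w) := by rw [← hτ.herm, hX]
    -- After the shear the column is 0 and the corner is z - τ(w, X w). It vanishes for exactly one
    -- admissible z, which yields two blocks of length 1; the other q - 1 values yield a block of
    -- length 2.
    have h2 : ∀ z : {z : K // z ^ q = -z}, cylMass ε q (N + 2)
        (jordanMult (extendEnd τ X (X w) z)) = A + if z = ⟨τ w (X w), hc⟩ then B - A else 0 := by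
      intro z
      have h4 := finrank_ker_extendEnd_shear hq hK hτ hX w 0 z
      have h0 : τ 0 w = 0 := by rw [hτ.herm, map_zero, zero_pow hq.ne_zero]
      rw [add_zero, map_zero, sub_zero, h0, add_zero] at h4
      have h3 := fun j (hj : j ≠ 0) => (h4 j).trans
        (finrank_ker_extendEnd_zero hτ hq.ne_zero _ hj)
      by_cases hz : (z : K) - τ w (X w) = 0
      · rw [if_pos (Subtype.ext (sub_eq_zero.mp hz)), add_sub_cancel]
        refine cylMass_congr ε q fun j hj _ => ?_
        rw [jordanMult_pair (b := 0) (X := X) ?_ hj, if_pos rfl]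
        intro i hi
        rw [h3 i hi, if_pos hz]
        split_ifs <;> omega
      · rw [if_neg fun h => hz (sub_eq_zero.mpr (congrArg Subtype.val h)), add_zero]
        refine cylMass_congr ε q fun j hj _ => ?_
        rw [jordanMult_up (b := 0) (X := X) ?_ hj, if_pos rfl]
        intro i hi
        rw [h3 i hi, if_neg hz]
        split_ifs <;> omega
    rw [Finset.sum_congr rfl fun z _ => h2 z, Finset.sum_add_distrib, Finset.sum_ite_eq',
      if_pos (Finset.mem_univ _), Finset.sum_const, Finset.card_univ, hcard, nsmul_eq_mul]
    ring
  have h2 := sum_comp_linearMap X fun y => ∑ z : {z : K // z ^ q = -z}, cylMass ε q (N + 2)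
      (jordanMult (extendEnd τ X y z))
  simp only [h1] at h2
  rw [Finset.sum_const, Finset.card_univ, nsmul_eq_mul, ← Nat.card_eq_fintype_card, ← hrange,
    natCard_imKer hK hq0, mul_assoc] at h2
  have h3 := mul_left_cancel₀ (Nat.cast_ne_zero.mpr Nat.card_pos.ne') h2
  rw [← h3]
  ring

include hq hK hτ hX in
open Classical in
/-- The contribution to the coherence relation of the columns `y` that belong to
`Im X + Ker X ^ (a + 1)` but not to `Im X + Ker X ^ a`. -/
theorem sum_extendEnd_level (hnil : IsNilpotent X) (ε : Fin 2) (a : ℕ) :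
    ∑ y with y ∈ imKer X (a + 1), (if y ∈ imKer X a then 0 else ∑ z : {z : K // z ^ q = -z},
        cylMass ε q (Module.finrank K V + 2) (jordanMult (extendEnd τ X y z))) =
      upTwoCount q (Module.finrank K V) (jordanMult X) (a + 1) *
          cylMass ε q (Module.finrank K V + 2) (upTwo (jordanMult X) (a + 1)) +
        upPairCount q (Module.finrank K V) (jordanMult X) (a + 1) *
          cylMass ε q (Module.finrank K V + 2) (upPair (jordanMult X) (a + 1)) := by
  have : FiniteDimensional K V := Module.Finite.of_finite
  have hq0 : (q : ℝ) ≠ 0 := by exact_mod_cast hq.ne_zero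
  set N := Module.finrank K V with hN
  set A := cylMass ε q (N + 2) (upTwo (jordanMult X) (a + 1))
  set B := cylMass ε q (N + 2) (upPair (jordanMult X) (a + 1))
  set U := LinearMap.ker (X ^ (a + 1)) with hU
  set H : V → V →ₗ[K] K := fun v => τ v ∘ₗ X ^ a with hH
  set r := jordanMult X (a + 1) with hr
  have hcard : Fintype.card {z : K // z ^ q = -z} = q := by
    rw [← Nat.card_eq_fintype_card]
    exact (Nat.card_coe_set_eq _).trans (ncard_conj_eq_neg hq hK)
  -- the value of the inner sum
  have h1 : ∀ w, ∀ y ∈ U, y ∉ imKer X a → ∑ z : {z : K // z ^ q = -z}, cylMass ε q (N + 2)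
      (jordanMult (extendEnd τ X (X w + y) z)) = q * if H y y = 0 then B else A := by
    intro w y hy hy'
    have h2 : ∀ z : {z : K // z ^ q = -z}, cylMass ε q (N + 2)
        (jordanMult (extendEnd τ X (X w + y) z)) = if H y y = 0 then B else A := by
      intro z
      have h3 : ∀ j, j ≠ 0 → Module.finrank K (LinearMap.ker (extendEnd τ X (X w + y) z ^ j)) = _ :=
        fun j hj => (finrank_ker_extendEnd_shear hq hK hτ hX w y z j).trans
          (finrank_ker_extendEnd hq hK hτ hX hy hy' _ hj)
      split_ifs with hs
      · refine cylMass_congr ε q fun j hj _ => ?_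
        rw [jordanMult_pair (b := a + 1) (X := X) ?_ hj, if_neg (Nat.succ_ne_zero a)]
        intro i hi
        rw [h3 i hi, if_pos (show τ y ((X ^ a) y) = 0 from hs), ite_self]
      · refine cylMass_congr ε q fun j hj _ => ?_
        rw [jordanMult_up (b := a + 1) (X := X) ?_ hj, if_neg (Nat.succ_ne_zero a)]
        intro i hi
        rw [h3 i hi, if_neg (show ¬τ y ((X ^ a) y) = 0 from hs)]
    rw [Finset.sum_congr rfl fun z _ => h2 z, Finset.sum_const, Finset.card_univ, hcard,
      nsmul_eq_mul]
  -- the parametrization of the columns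
  have h2 := sum_comp_linearMap (X.coprod U.subtype) fun y => if y ∈ imKer X a then 0 else
    ∑ z : {z : K // z ^ q = -z}, cylMass ε q (N + 2) (jordanMult (extendEnd τ X y z))
  have hrange : LinearMap.range (X.coprod U.subtype) = imKer X (a + 1) := by
    rw [LinearMap.range_coprod, Submodule.range_subtype, imKer]
  have hXw : ∀ w, X w ∈ imKer X a := fun w => Submodule.mem_sup_left ⟨w, rfl⟩
  have h3 : ∀ p : V × U, (if X.coprod U.subtype p ∈ imKer X a then 0 else
      ∑ z : {z : K // z ^ q = -z},
        cylMass ε q (N + 2) (jordanMult (extendEnd τ X (X.coprod U.subtype p) z))) =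
      if (p.2 : V) ∈ imKer X a then 0 else q * if H p.2 p.2 = 0 then B else A := by
    rintro ⟨w, y⟩
    rw [LinearMap.coprod_apply, Submodule.subtype_apply,
      (imKer X a).add_mem_iff_right (hXw w)]
    split_ifs with h4
    · rfl
    · rw [h1 w y y.2 h4, if_pos (by assumption)]
    · rw [h1 w y y.2 h4, if_neg (by assumption)]
  -- the number of isotropic vectors
  have hrad : formRadical H U = U ⊓ imKer X a := hτ.formRadical_eq hq hK hX a
  have hiso := card_isotropic hq hK (hτ.herm_pow hq hK hX a) r U
    (by rw [hrad]; exact finrank_ker_inf_imKer X a)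
  have hrk := finrank_ker_inf_imKer X a
  have h5 : (Nat.card {u : U // (u : V) ∈ imKer X a} : ℝ) * q ^ (2 * r) = Nat.card U := by
    have h6 : Nat.card {u : U // (u : V) ∈ imKer X a} = Nat.card ↥(U ⊓ imKer X a) :=
      Nat.card_congr (Equiv.subtypeSubtypeEquivSubtypeInter (· ∈ U) (· ∈ imKer X a))
    rw [h6, natCard_submodule hK, natCard_submodule hK, hrk, mul_add, pow_add]
  -- Vectors of Ker X^{a+1} in Im X + Ker X^a form the radical and hence are isotropic, so excluding
  -- them removes terms of value q B only.
  have h6 : ∀ u : U, (if (u : V) ∈ imKer X a then 0 else (q : ℝ) * if H u u = 0 then B else A) =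
      q * A + q * (B - A) * (if H u u = 0 then 1 else 0) -
        q * B * if (u : V) ∈ imKer X a then 1 else 0 := by
    intro u
    by_cases hu : (u : V) ∈ imKer X a
    · have h7 : (u : V) ∈ formRadical H U := by
        rw [hrad]
        exact ⟨u.2, hu⟩
      rw [if_pos hu, if_pos hu, if_pos ((mem_formRadical.mp h7).2 u u.2)]
      ring
    · rw [if_neg hu, if_neg hu]
      split_ifs <;> ring
  rw [Finset.sum_congr rfl fun p _ => h3 p, Fintype.sum_prod_type] at h2
  simp only [h6] at h2
  simp only [Finset.sum_sub_distrib, Finset.sum_add_distrib, ← Finset.mul_sum, Finset.sum_boole,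
    Finset.sum_const, Finset.card_univ, nsmul_eq_mul] at h2
  rw [← Fintype.card_subtype, ← Fintype.card_subtype, Nat.card_prod, hrange,
    natCard_imKer hK hq0] at h2
  simp only [← Nat.card_eq_fintype_card] at h2
  have hV : (Nat.card V : ℝ) ≠ 0 := Nat.cast_ne_zero.mpr Nat.card_pos.ne'
  have hU0 : (Nat.card U : ℝ) ≠ 0 := Nat.cast_ne_zero.mpr Nat.card_pos.ne'
  have hu : (q : ℝ) ^ (2 * r) * ((-(q : ℝ)⁻¹) ^ r) ^ 2 = 1 := by
    rw [pow_mul, ← pow_mul _ r, mul_comm r, pow_mul, ← mul_pow, neg_sq, inv_pow,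
      mul_inv_cancel₀ (pow_ne_zero _ hq0), one_pow]
  -- Up to the factor 1/q of the isotropic count, the right side is the density of isotropic vectors
  -- outside the radical. For r = 0 the truncated exponent does no harm, because the first factor
  -- vanishes.
  have hB : (1 - (-(q : ℝ)⁻¹) ^ r) * (1 - (-(q : ℝ)⁻¹) ^ (r - 1)) =
      1 + (q - 1) * (-(q : ℝ)⁻¹) ^ r - q * ((-(q : ℝ)⁻¹) ^ r) ^ 2 := by
    rcases r with _ | r
    · simp
    · rw [Nat.add_sub_cancel, pow_succ]
      field_simp
      ring
  have htail : tailCount (jordanMult X) N (a + 1 + 1) = tailMult X (a + 1) :=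
    tailCount_jordanMult hnil le_rfl
  rw [upTwoCount, upPairCount, htail, ← hr, mul_assoc ((q : ℝ) ^ (2 * N) / _) (1 - _) (1 - _), hB]
  set c := (-(q : ℝ)⁻¹) ^ r
  set M := (q : ℝ) ^ (2 * N) / q ^ (2 * tailMult X (a + 1)) with hM
  have hM' : (q : ℝ) ^ (2 * N + 1) / q ^ (2 * tailMult X (a + 1)) = M * q := by
    rw [hM, pow_succ]
    ring
  have h7 : (Nat.card {u : U // (u : V) ∈ imKer X a} : ℝ) = Nat.card U * c ^ 2 := by
    rw [← h5, mul_assoc, hu, mul_one]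
  have h8 : (Nat.card {u : U // H u u = 0} : ℝ) = Nat.card U * (1 + (q - 1) * c) / q :=
    eq_div_of_mul_eq hq0 hiso
  push_cast at h2
  rw [h7, h8] at h2
  refine mul_left_cancel₀ (mul_ne_zero hV hU0) (h2.symm.trans ?_)
  rw [hM']
  field_simp
  ring

include hq hK hτ hX in
open Classical in
/-- The coherence relation for the masses of cylinder sets. -/
theorem sum_extendEnd (hnil : IsNilpotent X) (ε : Fin 2) :
    ∑ y, ∑ z : {z : K // z ^ q = -z},
        cylMass ε q (Module.finrank K V + 2) (jordanMult (extendEnd τ X y z)) =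
      cylMass ε q (Module.finrank K V) (jordanMult X) := by
  have : FiniteDimensional K V := Module.Finite.of_finite
  set N := Module.finrank K V with hN
  set F : V → ℝ := fun y => ∑ z : {z : K // z ^ q = -z},
    cylMass ε q (N + 2) (jordanMult (extendEnd τ X y z))
  have htop : imKer X N = ⊤ := by
    rw [imKer, hN, pow_finrank_eq_zero hnil, LinearMap.ker_zero, sup_top_eq]
  -- The subspaces Im X + Ker X^a ascend from Im X to V. The sum over all columns telescopes along
  -- them, with one layer for each block length a + 1.
  have h1 : ∀ a, ∑ y with y ∈ imKer X (a + 1), F y - ∑ y with y ∈ imKer X a, F y =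
      ∑ y with y ∈ imKer X (a + 1), if y ∈ imKer X a then 0 else F y := by
    intro a
    rw [sub_eq_iff_eq_add, Finset.sum_filter, Finset.sum_filter, Finset.sum_filter,
      ← Finset.sum_add_distrib]
    refine Finset.sum_congr rfl fun y _ => ?_
    have h2 : y ∈ imKer X a → y ∈ imKer X (a + 1) := fun h => imKer_mono X (Nat.le_succ a) h
    split_ifs <;> simp_all
  have h2 := Finset.sum_range_sub (fun a => ∑ y with y ∈ imKer X a, F y) N
  rw [htop] at h2
  simp only [Submodule.mem_top, Finset.filter_true] at h2
  rw [cylMass_eq_sum ε hq.one_lt fun j hj => jordanMult_eq_zero hnil hj,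
    show tailCount (jordanMult X) N 1 = tailMult X 0 from tailCount_jordanMult hnil le_rfl,
    ← sum_extendEnd_range hq hK hτ hX ε, ← sub_eq_iff_eq_add]
  refine h2.symm.trans (Finset.sum_congr rfl fun a _ => ?_)
  rw [h1]
  exact sum_extendEnd_level hq hK hτ hX hnil ε a

end Coherence

end HLUnitary

end

noncomputable section

namespace HLUnitary

/-! ### Central blocks and bordered skew-Hermitian matrices -/

section Blocks

variable {ε : Fin 2} {n : ℕ}

@[simp] theorem Idx.coe_neg (i : Idx ε) : (-i).1 = -i.1 := rfl

@[simp] theorem Blk.coe_neg (i : Blk ε n) : (-i).1 = -i.1 := rfl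

instance : InvolutiveNeg (Idx ε) := ⟨fun i => Subtype.ext (neg_neg i.1)⟩

instance : InvolutiveNeg (Blk ε n) := ⟨fun i => Subtype.ext (neg_neg i.1)⟩

/-- The inclusion of a central block in the next one. -/
def Blk.incl (i : Blk ε n) : Blk ε (n + 1) := ⟨i.1, i.2.trans (by push_cast; omega)⟩

variable (ε n) in
/-- The last index of a central block. -/
def Blk.last : Blk ε (n + 1) :=
  ⟨⟨(n : ℤ) + 1, fun h => by omega⟩, by
    change |(n : ℤ) + 1| ≤ _
    rw [abs_of_nonneg (by omega)]
    push_cast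
    rfl⟩

theorem Blk.neg_incl (i : Blk ε n) : -(Blk.incl i) = Blk.incl (-i) := rfl

theorem Blk.incl_injective : Function.Injective (Blk.incl (ε := ε) (n := n)) :=
  fun _ _ h => Subtype.ext (congrArg (fun a : Blk ε (n + 1) => a.1) h)

@[simp] theorem Blk.coe_incl (i : Blk ε n) : (Blk.incl i).1 = i.1 := rfl

@[simp] theorem Blk.coe_last : (Blk.last ε n).1.1 = (n : ℤ) + 1 := rfl

theorem Blk.incl_ne_last (i : Blk ε n) : Blk.incl i ≠ Blk.last ε n := by
  intro h
  have h1 := congrArg (fun a : Blk ε (n + 1) => a.1.1) h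
  have h2 := (abs_le.mp i.2).2
  simp only [Blk.coe_incl, Blk.coe_last] at h1
  omega

theorem Blk.incl_ne_neg_last (i : Blk ε n) : Blk.incl i ≠ -Blk.last ε n := by
  intro h
  apply Blk.incl_ne_last (-i)
  rw [← Blk.neg_incl, h, neg_neg]

theorem Blk.last_ne_neg_last : Blk.last ε n ≠ -Blk.last ε n := by
  intro h
  have h1 := congrArg (fun a : Blk ε (n + 1) => a.1.1) h
  simp only [Blk.coe_neg, Idx.coe_neg, Blk.coe_last] at h1
  omega

theorem Blk.cases (a : Blk ε (n + 1)) :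
    a = -Blk.last ε n ∨ a = Blk.last ε n ∨ ∃ i, a = Blk.incl i := by
  by_cases h : |a.1.1| ≤ (n : ℤ)
  · exact Or.inr (Or.inr ⟨⟨a.1, h⟩, rfl⟩)
  · have h1 := a.2
    push_cast at h1
    rcases abs_cases a.1.1 with ⟨h2, -⟩ | ⟨h2, -⟩
    · refine Or.inr (Or.inl (Subtype.ext (Subtype.ext ?_)))
      rw [Blk.coe_last]
      omega
    · refine Or.inl (Subtype.ext (Subtype.ext ?_))
      rw [Blk.coe_neg, Idx.coe_neg, Blk.coe_last]
      omega

/-- The function on a central block with prescribed values at the first index, on the previous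
central block, and at the last index. -/
def blkElim {α : Type*} (x : α) (f : Blk ε n → α) (z : α) (a : Blk ε (n + 1)) : α :=
  if h : |a.1.1| ≤ (n : ℤ) then f ⟨a.1, h⟩ else if a = Blk.last ε n then z else x

@[simp] theorem blkElim_incl {α : Type*} (x : α) (f : Blk ε n → α) (z : α) (i : Blk ε n) :
    blkElim x f z (Blk.incl i) = f i := dif_pos i.2

@[simp] theorem blkElim_last {α : Type*} (x : α) (f : Blk ε n → α) (z : α) :
    blkElim x f z (Blk.last ε n) = z := by
  rw [blkElim, dif_neg, if_pos rfl]
  intro h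
  exact Blk.incl_ne_last ⟨_, h⟩ rfl

@[simp] theorem blkElim_neg_last {α : Type*} (x : α) (f : Blk ε n → α) (z : α) :
    blkElim x f z (-Blk.last ε n) = x := by
  rw [blkElim, dif_neg, if_neg Blk.last_ne_neg_last.symm]
  intro h
  exact Blk.incl_ne_neg_last ⟨_, h⟩ rfl

theorem sum_blk_succ {M : Type*} [AddCommMonoid M] (f : Blk ε (n + 1) → M) :
    ∑ a, f a = f (-Blk.last ε n) + ∑ i, f (Blk.incl i) + f (Blk.last ε n) := by
  have h : (Finset.univ : Finset (Blk ε (n + 1))) =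
      insert (-Blk.last ε n) (insert (Blk.last ε n)
        (Finset.univ.map ⟨Blk.incl, Blk.incl_injective⟩)) := by
    ext a
    simp only [Finset.mem_univ, Finset.mem_insert, Finset.mem_map, true_iff, true_and,
      Function.Embedding.coeFn_mk]
    rcases Blk.cases a with h | h | ⟨i, h⟩
    · exact Or.inl h
    · exact Or.inr (Or.inl h)
    · exact Or.inr (Or.inr ⟨i, h.symm⟩)
  rw [h, Finset.sum_insert, Finset.sum_insert, Finset.sum_map, add_assoc,
    add_comm (f (Blk.last ε n))]
  · rfl
  · simp [Blk.incl_ne_last]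
  · simp [Blk.incl_ne_neg_last, Blk.last_ne_neg_last.symm]

variable (ε n) in
theorem card_blk : Fintype.card (Blk ε n) = 2 * n + ε := by
  induction n with
  | zero =>
    by_cases h : ε = 1
    · subst h
      refine Fintype.card_eq_one_iff.mpr ?_
      refine ⟨⟨⟨0, fun _ => rfl⟩, by simp⟩, fun a => Subtype.ext (Subtype.ext ?_)⟩
      have := a.2
      simpa using this
    · have h0 : ε = 0 := by omega
      have : IsEmpty (Blk ε 0) := ⟨fun a => h (a.1.2 (by have := a.2; simpa using this))⟩
      rw [Fintype.card_eq_zero, h0]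
      rfl
  | succ n ih =>
    rw [Fintype.card_eq_sum_ones, sum_blk_succ, ← Fintype.card_eq_sum_ones, ih]
    ring

/-- Functions on a central block as triples. -/
def blkEquiv (ε : Fin 2) (K : Type*) [Field K] (n : ℕ) :
    (Blk ε (n + 1) → K) ≃ₗ[K] K × (Blk ε n → K) × K where
  toFun f := (f (-Blk.last ε n), fun i => f (Blk.incl i), f (Blk.last ε n))
  map_add' _ _ := rfl
  map_smul' _ _ := rfl
  invFun p := blkElim p.1 p.2.1 p.2.2
  left_inv f := by
    funext a
    rcases Blk.cases a with rfl | rfl | ⟨i, rfl⟩ <;> simp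
  right_inv p := by ext <;> simp

end Blocks

section Form

variable {ε : Fin 2} {n q : ℕ} {K : Type*} [Field K]

/-- The Hermitian form on `K ^ N` with `1`'s on the secondary diagonal. -/
def blkForm (q : ℕ) (y : Blk ε n → K) : (Blk ε n → K) →ₗ[K] K :=
  ∑ b, (y (-b)) ^ q • LinearMap.proj b

theorem blkForm_apply (y v : Blk ε n → K) : blkForm q y v = ∑ b, (y (-b)) ^ q * v b := by
  simp [blkForm]

variable [Finite K] (hq : IsPrimePow q) (hK : Nat.card K = q ^ 2)
include hq hK

theorem isUnitaryForm_blkForm : IsUnitaryForm q (blkForm (ε := ε) (n := n) (K := K) q) where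
  herm u v := by
    rw [blkForm_apply, blkForm_apply, sum_pow_conj hq hK, ← Equiv.sum_comp (Equiv.neg _)]
    refine Finset.sum_congr rfl fun b _ => ?_
    rw [Equiv.neg_apply, neg_neg, mul_pow, pow_pow_conj hK, mul_comm]
  surj φ := by
    classical
    refine ⟨fun b => φ (Pi.single (-b) 1) ^ q, ?_⟩
    ext b
    rw [LinearMap.comp_apply, blkForm_apply, Finset.sum_eq_single b]
    · simp [pow_pow_conj hK]
    · intro c _ hc
      simp [hc]
    · simp

theorem isSkewEnd_toLin' {X : Matrix (Blk ε n) (Blk ε n) K} (hX : IsSkewHermitian q X) :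
    IsSkewEnd (blkForm q) (Matrix.toLin' X) := by
  intro u v
  have e (w : Blk ε n → K) (a : Blk ε n) : Matrix.toLin' X w a = ∑ b, X a b * w b := rfl
  rw [blkForm_apply, blkForm_apply]
  simp only [e, sum_pow_conj hq hK, Finset.sum_mul, Finset.mul_sum]
  rw [Finset.sum_comm, ← Finset.sum_neg_distrib]
  refine Eq.trans ?_ (Equiv.sum_comp (Equiv.neg (Blk ε n)) _)
  refine Finset.sum_congr rfl fun c _ => ?_
  rw [← Finset.sum_neg_distrib]
  refine Finset.sum_congr rfl fun b _ => ?_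
  have h := hX (-b) c
  rw [neg_neg] at h
  rw [Equiv.neg_apply, neg_neg, h, mul_pow]
  ring

end Form

section Glue

variable {ε : Fin 2} {n q : ℕ} {K : Type*} [Field K]

/-- The skew-Hermitian matrix with central block `X`, last column `y` and corner entry `z` that
vanishes elsewhere except for the first row. -/
def glue (q : ℕ) (X : Matrix (Blk ε n) (Blk ε n) K) (y : Blk ε n → K) (z : K) :
    Matrix (Blk ε (n + 1)) (Blk ε (n + 1)) K :=
  Matrix.of fun a b =>
    blkElim (blkElim 0 (fun b => -(y (-b)) ^ q) z b) (fun a => blkElim 0 (fun b => X a b) (y a) b) 0 a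

theorem glue_apply (X : Matrix (Blk ε n) (Blk ε n) K) (y : Blk ε n → K) (z : K)
    (a b : Blk ε (n + 1)) : glue q X y z a b =
      blkElim (blkElim 0 (fun b => -(y (-b)) ^ q) z b)
        (fun a => blkElim 0 (fun b => X a b) (y a) b) 0 a := rfl

/-- In the coordinates (first, middle, last) a bordered matrix acts as the abstract extension, so
the counts above apply to matrices. -/
theorem blkEquiv_mulVec_glue (X : Matrix (Blk ε n) (Blk ε n) K) (y : Blk ε n → K) (z : K)
    (f : Blk ε (n + 1) → K) :
    blkEquiv ε K n (Matrix.toLin' (glue q X y z) f) =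
      extendEnd (blkForm q) (Matrix.toLin' X) y z (blkEquiv ε K n f) := by
  have h : ∀ a, Matrix.toLin' (glue q X y z) f a = ∑ b, glue q X y z a b * f b := fun a => rfl
  have h' : ∀ a, Matrix.toLin' X (fun i => f (Blk.incl i)) a = ∑ b, X a b * f (Blk.incl b) :=
    fun a => rfl
  refine Prod.ext ?_ (Prod.ext (funext fun i => ?_) ?_)
  · change Matrix.toLin' (glue q X y z) f (-Blk.last ε n) =
      z * f (Blk.last ε n) - blkForm q y fun i => f (Blk.incl i)
    rw [h, sum_blk_succ, blkForm_apply]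
    simp only [glue_apply, blkElim_neg_last, blkElim_incl, blkElim_last, neg_mul,
      Finset.sum_neg_distrib]
    ring
  · change Matrix.toLin' (glue q X y z) f (Blk.incl i) =
      Matrix.toLin' X (fun i => f (Blk.incl i)) i + f (Blk.last ε n) * y i
    rw [h, sum_blk_succ, h']
    simp only [glue_apply, blkElim_neg_last, blkElim_incl, blkElim_last]
    ring
  · change Matrix.toLin' (glue q X y z) f (Blk.last ε n) = 0
    rw [h]
    simp only [glue_apply, blkElim_last, zero_mul, Finset.sum_const_zero]

theorem isNilpotent_toLin' {ι : Type*} [Fintype ι] [DecidableEq ι] {X : Matrix ι ι K} :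
    IsNilpotent (Matrix.toLin' X) ↔ IsNilpotent X :=
  IsNilpotent.map_iff (f := Matrix.toLinAlgEquiv' (R := K) (n := ι))
    (Matrix.toLinAlgEquiv' (R := K) (n := ι)).injective

theorem blkEquiv_pow_glue (X : Matrix (Blk ε n) (Blk ε n) K) (y : Blk ε n → K) (z : K) (j : ℕ)
    (f : Blk ε (n + 1) → K) :
    blkEquiv ε K n ((Matrix.toLin' (glue q X y z) ^ j) f) =
      (extendEnd (blkForm q) (Matrix.toLin' X) y z ^ j) (blkEquiv ε K n f) := by
  induction j with
  | zero => rfl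
  | succ j ih =>
    rw [pow_succ', pow_succ', Module.End.mul_apply, Module.End.mul_apply, blkEquiv_mulVec_glue, ih]

theorem isNilpotent_glue {X : Matrix (Blk ε n) (Blk ε n) K} {y : Blk ε n → K} {z : K} :
    IsNilpotent (glue q X y z) ↔ IsNilpotent X := by
  rw [← isNilpotent_toLin', ← isNilpotent_toLin' (X := X)]
  constructor
  · rintro ⟨k, hk⟩
    have h0 : Matrix.toLin' (glue q X y z) ^ (k + 2) = 0 := by rw [pow_add, hk, zero_mul]
    refine ⟨k + 2, LinearMap.ext fun v => ?_⟩
    have h := blkEquiv_pow_glue (q := q) X y z (k + 2) ((blkEquiv ε K n).symm (0, v, 0))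
    rw [h0, extendEnd_pow, LinearEquiv.apply_symm_apply, LinearMap.zero_apply, map_zero] at h
    have h2 := congrArg (fun p : K × (Blk ε n → K) × K => p.2.1) h
    simpa using h2.symm
  · intro h
    obtain ⟨k, hk⟩ := extendEnd_isNilpotent (τ := blkForm q) h y z
    refine ⟨k, LinearMap.ext fun f => (blkEquiv ε K n).injective ?_⟩
    rw [blkEquiv_pow_glue, hk]
    simp

theorem jordanMult_conj {V V' : Type*} [AddCommGroup V] [Module K V] [AddCommGroup V'] [Module K V']
    [FiniteDimensional K V] [FiniteDimensional K V'] {X : Module.End K V} {X' : Module.End K V'}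
    (e : V ≃ₗ[K] V') (h : ∀ v, e (X v) = X' (e v)) : jordanMult X' = jordanMult X := by
  have h1 : ∀ j, tailMult X' j = tailMult X j :=
    tailMult_eq_of_finrank fun j => (finrank_ker_pow_conj e h j).symm
  funext a
  rw [jordanMult, jordanMult, h1, h1]

theorem jordanMult_glue (X : Matrix (Blk ε n) (Blk ε n) K) (y : Blk ε n → K) (z : K) :
    jordanMult (Matrix.toLin' (glue q X y z)) =
      jordanMult (extendEnd (blkForm q) (Matrix.toLin' X) y z) :=
  (jordanMult_conj (blkEquiv ε K n) (blkEquiv_mulVec_glue X y z)).symm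

variable [Finite K] (hq : IsPrimePow q) (hK : Nat.card K = q ^ 2)
include hq hK

theorem isSkewHermitian_glue {X : Matrix (Blk ε n) (Blk ε n) K} (hX : IsSkewHermitian q X)
    (y : Blk ε n → K) {z : K} (hz : z ^ q = -z) : IsSkewHermitian q (glue q X y z) := by
  have h0 : (0 : K) ^ q = 0 := zero_pow hq.pos.ne'
  intro a b
  rcases Blk.cases a with rfl | rfl | ⟨i, rfl⟩ <;> rcases Blk.cases b with rfl | rfl | ⟨j, rfl⟩ <;>
    simp [glue_apply, Blk.neg_incl, h0, hz, hX _ _, pow_pow_conj hK, neg_pow_conj hq hK]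

end Glue

end HLUnitary

end

noncomputable section

namespace HLUnitary

/-! ### Infinite matrices and their central blocks -/

section SkewMat

variable {ε : Fin 2} {q : ℕ} {K : Type*} [Field K] {n k : ℕ}

theorem LSet_mono (h : n ≤ k) : LSet ε q K n ⊆ LSet ε q K k := fun _ hM =>
  ⟨hM.1, fun i j hij hk => hM.2 i j hij (lt_of_le_of_lt (by exact_mod_cast h) hk)⟩

/-- The skew-Hermitian matrices of order `2 * n + ε`. -/
def SkewMat (ε : Fin 2) (q : ℕ) (K : Type*) [Field K] (n : ℕ) : Type _ :=
  {X : Matrix (Blk ε n) (Blk ε n) K // IsSkewHermitian q X}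

instance [Finite K] : Finite (SkewMat ε q K n) :=
  inferInstanceAs (Finite {X : Matrix (Blk ε n) (Blk ε n) K // IsSkewHermitian q X})

instance [Finite K] : Fintype (SkewMat ε q K n) := Fintype.ofFinite _

theorem LSpace.isSkewHermitian (M : LSpace ε q K) : IsSkewHermitian q M.1 := M.2.choose_spec.1

theorem corner_apply (M : LSpace ε q K) (a b : Blk ε n) : corner n M a b = M.1 a.1 b.1 := rfl

/-- The central block as a skew-Hermitian matrix. -/
def skewCorner (n : ℕ) (M : LSpace ε q K) : SkewMat ε q K n :=
  ⟨corner n M, fun a b => M.isSkewHermitian a.1 b.1⟩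

/-- The matrix that vanishes outside of a central block. -/
def zeroExt (X : Matrix (Blk ε n) (Blk ε n) K) : Matrix (Idx ε) (Idx ε) K :=
  Matrix.of fun i j =>
    if h : |i.1| ≤ (n : ℤ) ∧ |j.1| ≤ (n : ℤ) then X ⟨i, h.1⟩ ⟨j, h.2⟩ else 0

theorem zeroExt_of_le (X : Matrix (Blk ε n) (Blk ε n) K) (a b : Blk ε n) :
    zeroExt X a.1 b.1 = X a b := dif_pos ⟨a.2, b.2⟩

theorem zeroExt_of_not (X : Matrix (Blk ε n) (Blk ε n) K) {i j : Idx ε}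
    (h : ¬(|i.1| ≤ (n : ℤ) ∧ |j.1| ≤ (n : ℤ))) : zeroExt X i j = 0 := dif_neg h

theorem zeroExt_mem_LSet (hq : q ≠ 0) {X : Matrix (Blk ε n) (Blk ε n) K}
    (hX : IsSkewHermitian q X) : zeroExt X ∈ LSet ε q K n := by
  refine ⟨fun i j => ?_, fun i j _ h => zeroExt_of_not X fun h' => ?_⟩
  · by_cases h : |i.1| ≤ (n : ℤ) ∧ |j.1| ≤ (n : ℤ)
    · exact (zeroExt_of_le X (-⟨j, h.2⟩) (-⟨i, h.1⟩)).trans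
        ((hX ⟨i, h.1⟩ ⟨j, h.2⟩).trans
          (congrArg (fun x => -x ^ q) (zeroExt_of_le X ⟨i, h.1⟩ ⟨j, h.2⟩).symm))
    · rw [zeroExt_of_not X h, zeroExt_of_not X, zero_pow hq, neg_zero]
      rwa [Idx.coe_neg, Idx.coe_neg, abs_neg, abs_neg, and_comm]
  · exact absurd (max_le h'.1 h'.2) (not_le.mpr h)

/-- A skew-Hermitian matrix as an element of the space `L`. -/
def SkewMat.toLSpace (hq : q ≠ 0) (X : SkewMat ε q K n) : LSpace ε q K :=
  ⟨zeroExt X.1, n, zeroExt_mem_LSet hq X.2⟩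

theorem corner_toLSpace (hq : q ≠ 0) (X : SkewMat ε q K n) : corner n (X.toLSpace hq) = X.1 :=
  Matrix.ext fun a b => zeroExt_of_le X.1 a b

theorem toLSpace_mem_LSet (hq : q ≠ 0) (X : SkewMat ε q K n) :
    (X.toLSpace hq).1 ∈ LSet ε q K n := zeroExt_mem_LSet hq X.2

theorem toLSpace_mem_cyl (hq : q ≠ 0) (X : SkewMat ε q K n) : X.toLSpace hq ∈ cyl q n X.1 :=
  ⟨toLSpace_mem_LSet hq X, corner_toLSpace hq X⟩

theorem toLSpace_skewCorner_apply (hq : q ≠ 0) (M : LSpace ε q K) {i j : Idx ε}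
    (hi : |i.1| ≤ (k : ℤ)) (hj : |j.1| ≤ (k : ℤ)) :
    ((skewCorner k M).toLSpace hq).1 i j = M.1 i j :=
  zeroExt_of_le (corner k M) ⟨i, hi⟩ ⟨j, hj⟩

theorem corner_toLSpace_skewCorner (hq : q ≠ 0) (h : n ≤ k) (M : LSpace ε q K) :
    corner n ((skewCorner k M).toLSpace hq) = corner n M :=
  Matrix.ext fun a b => toLSpace_skewCorner_apply hq M
    (a.2.trans (by exact_mod_cast h)) (b.2.trans (by exact_mod_cast h))

theorem toLSpace_skewCorner_mem_LSet (hq : q ≠ 0) {M : LSpace ε q K}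
    (hM : M.1 ∈ LSet ε q K k) :
    ((skewCorner k M).toLSpace hq).1 ∈ LSet ε q K n ↔ M.1 ∈ LSet ε q K n := by
  have h : ∀ i j : Idx ε, j.1 ≤ i.1 → ((skewCorner k M).toLSpace hq).1 i j = M.1 i j := by
    intro i j hij
    by_cases h : |i.1| ≤ (k : ℤ) ∧ |j.1| ≤ (k : ℤ)
    · exact toLSpace_skewCorner_apply hq M h.1 h.2
    · rw [hM.2 i j hij (not_le.mp fun h' => h (max_le_iff.mp h'))]
      exact zeroExt_of_not _ h
  constructor
  · exact fun h' => ⟨M.isSkewHermitian, fun i j hij hk => by rw [← h i j hij, h'.2 i j hij hk]⟩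
  · exact fun h' => ⟨LSpace.isSkewHermitian _, fun i j hij hk => by
      rw [h i j hij, h'.2 i j hij hk]⟩

/-- Inside L_k, membership in a cylinder of level n ≤ k depends only on the central block of level
k. Refinement of cylinders thus becomes a statement about finite matrices. -/
theorem mem_cyl_iff (hq : q ≠ 0) (h : n ≤ k) {M : LSpace ε q K}
    {X : Matrix (Blk ε n) (Blk ε n) K} :
    M ∈ cyl q n X ↔ M.1 ∈ LSet ε q K k ∧ (skewCorner k M).toLSpace hq ∈ cyl q n X := by
  constructor
  · rintro ⟨h1, h2⟩
    have h3 := LSet_mono h h1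
    exact ⟨h3, (toLSpace_skewCorner_mem_LSet hq h3).mpr h1,
      (corner_toLSpace_skewCorner hq h M).trans h2⟩
  · rintro ⟨h1, h2, h3⟩
    exact ⟨(toLSpace_skewCorner_mem_LSet hq h1).mp h2,
      (corner_toLSpace_skewCorner hq h M).symm.trans h3⟩

/-- The vanishing condition of L_k kills the last row and the first column of the next block, and
skew-Hermitian symmetry determines the first row from the last column. -/
theorem corner_succ_eq_glue {M : LSpace ε q K} (hM : M.1 ∈ LSet ε q K k) :
    corner (k + 1) M = glue q (corner k M)
      (fun a => corner (k + 1) M (Blk.incl a) (Blk.last ε k))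
      (corner (k + 1) M (-Blk.last ε k) (Blk.last ε k)) := by
  have hs (a b : Blk ε (k + 1)) : corner (k + 1) M (-b) (-a) = -(corner (k + 1) M a b) ^ q :=
    (skewCorner (k + 1) M).2 a b
  have h0 : ∀ a b : Blk ε (k + 1), b.1.1 ≤ a.1.1 → (k : ℤ) < max |a.1.1| |b.1.1| →
      corner (k + 1) M a b = 0 := fun a b => hM.2 a.1 b.1
  have hl : (k : ℤ) < |(Blk.last ε k).1.1| := by
    rw [Blk.coe_last, abs_of_nonneg (by omega)]
    omega
  have hb (b : Blk ε (k + 1)) : -((k : ℤ) + 1) ≤ b.1.1 ∧ b.1.1 ≤ (k : ℤ) + 1 := by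
    have := abs_le.mp b.2
    push_cast at this
    omega
  have h1 (b : Blk ε (k + 1)) : corner (k + 1) M (Blk.last ε k) b = 0 :=
    h0 _ _ (hb b).2 (lt_max_of_lt_left hl)
  have h2 (a : Blk ε (k + 1)) : corner (k + 1) M a (-Blk.last ε k) = 0 :=
    h0 _ _ (hb a).1 (lt_max_of_lt_right (hl.trans_eq (abs_neg _).symm))
  ext a b
  rw [glue_apply]
  rcases Blk.cases a with rfl | rfl | ⟨i, rfl⟩
  · rcases Blk.cases b with rfl | rfl | ⟨j, rfl⟩
    · simp [h2]
    · simp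
    · rw [blkElim_neg_last, blkElim_incl, ← hs, ← Blk.neg_incl, neg_neg]
  · rw [blkElim_last, h1]
  · rcases Blk.cases b with rfl | rfl | ⟨j, rfl⟩
    · simp [h2]
    · simp
    · simp [corner_apply]

theorem glue_eq_zero (X : Matrix (Blk ε n) (Blk ε n) K) (y : Blk ε n → K) (z : K)
    {a b : Blk ε (n + 1)} (hab : b.1.1 ≤ a.1.1) (hn : (n : ℤ) < max |a.1.1| |b.1.1|) :
    glue q X y z a b = 0 := by
  rw [glue_apply]
  rcases Blk.cases a with rfl | rfl | ⟨i, rfl⟩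
  · rcases Blk.cases b with rfl | rfl | ⟨j, rfl⟩
    · simp
    · simp only [Blk.coe_neg, Idx.coe_neg, Blk.coe_last] at hab
      omega
    · have := abs_le.mp j.2
      simp only [Blk.coe_neg, Idx.coe_neg, Blk.coe_last, Blk.coe_incl] at hab
      omega
  · rw [blkElim_last]
  · rcases Blk.cases b with rfl | rfl | ⟨j, rfl⟩
    · simp
    · have := abs_le.mp i.2
      simp only [Blk.coe_last, Blk.coe_incl] at hab
      omega
    · exact absurd (max_le i.2 j.2) (not_le.mpr hn)

/-- Bordering preserves nilpotency in both directions, so pronilpotency may be tested at any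
admissible level. -/
theorem isNilpotent_corner_iff {M : LSpace ε q K} (hM : M.1 ∈ LSet ε q K n) (h : n ≤ k) :
    IsNilpotent (corner k M) ↔ IsNilpotent (corner n M) := by
  induction k, h using Nat.le_induction with
  | base => rfl
  | succ k hk ih => rw [corner_succ_eq_glue (LSet_mono hk hM), isNilpotent_glue, ih]

end SkewMat

/-! ### Additivity of the masses under refinement of cylinders -/

section Mass

variable {ε : Fin 2} {q : ℕ} {K : Type*} [Field K] {n k : ℕ}

open Classical in
/-- The mass of the elementary cylinder set with central block `X`. -/
def blkMass (q : ℕ) (X : Matrix (Blk ε n) (Blk ε n) K) : ℝ :=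
  if IsNilpotent X then cylMass ε q (2 * n + ε) (jordanMult (Matrix.toLin' X)) else 0

theorem finrank_blk : Module.finrank K (Blk ε n → K) = 2 * n + ε := by
  rw [Module.finrank_fintype_fun_eq_card, card_blk]

theorem blkMass_nonneg (hq : 1 < q) (X : Matrix (Blk ε n) (Blk ε n) K) : 0 ≤ blkMass q X := by
  rw [blkMass]
  split_ifs with h
  · refine cylMass_nonneg ε hq ?_
    have h' := wordSize_jordanMult (isNilpotent_toLin'.mpr h)
    rwa [finrank_blk] at h'
  · exact le_rfl

variable [Finite K] (hq : IsPrimePow q) (hK : Nat.card K = q ^ 2)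
include hq hK

open Classical in
theorem sum_blkMass_glue {X : Matrix (Blk ε n) (Blk ε n) K} (hX : IsSkewHermitian q X)
    [Fintype K] : ∑ y : Blk ε n → K, ∑ z : {z : K // z ^ q = -z},
      blkMass q (glue q X y z.1) = blkMass q X := by
  by_cases h : IsNilpotent X
  · simp only [blkMass, isNilpotent_glue, if_pos h, jordanMult_glue]
    have h1 := sum_extendEnd hq hK (isUnitaryForm_blkForm hq hK) (isSkewEnd_toLin' hq hK hX)
      (isNilpotent_toLin'.mpr h) ε
    rw [finrank_blk] at h1
    rw [← h1]
    refine Finset.sum_congr rfl fun y _ => Finset.sum_congr rfl fun z _ => ?_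
    congr 1
    ring
  · simp only [blkMass, isNilpotent_glue, if_neg h, Finset.sum_const_zero]

theorem toLSpace_glue_mem_cyl {X : Matrix (Blk ε n) (Blk ε n) K} (hX : IsSkewHermitian q X)
    (y : Blk ε n → K) {z : K} (hz : z ^ q = -z) :
    SkewMat.toLSpace hq.ne_zero ⟨glue q X y z, isSkewHermitian_glue hq hK hX y hz⟩ ∈
      cyl q n X := by
  set Y : SkewMat ε q K (n + 1) := ⟨glue q X y z, isSkewHermitian_glue hq hK hX y hz⟩ with hY
  have e (a b : Blk ε (n + 1)) : (Y.toLSpace hq.ne_zero).1 a.1 b.1 = glue q X y z a b :=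
    zeroExt_of_le Y.1 a b
  refine ⟨⟨LSpace.isSkewHermitian _, fun i j hij hn => ?_⟩, Matrix.ext fun a b => ?_⟩
  · by_cases h : |i.1| ≤ ((n + 1 : ℕ) : ℤ) ∧ |j.1| ≤ ((n + 1 : ℕ) : ℤ)
    · refine (e ⟨i, h.1⟩ ⟨j, h.2⟩).trans ?_
      exact glue_eq_zero X y z hij hn
    · exact zeroExt_of_not _ h
  · refine (e (Blk.incl a) (Blk.incl b)).trans ?_
    rw [glue_apply, blkElim_incl, blkElim_incl]

open Classical in
-- The blocks of the next level inside the cylinder of X correspond bijectively to pairs (y, z) with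
-- z^q = -z; the last condition is skew-Hermitian symmetry at the corner.
theorem sum_blkMass_succ (X : SkewMat ε q K n) :
    ∑ Y : SkewMat ε q K (n + 1),
      (if Y.toLSpace hq.ne_zero ∈ cyl q n X.1 then blkMass q Y.1 else 0) = blkMass q X.1 := by
  have : Fintype K := Fintype.ofFinite K
  rw [← sum_blkMass_glue hq hK X.2, ← Finset.sum_filter, ← Finset.sum_product']
  symm
  refine Finset.sum_bij (fun p _ => ⟨glue q X.1 p.1 p.2.1, isSkewHermitian_glue hq hK X.2 p.1 p.2.2⟩)
    (fun p _ => ?_) (fun p _ p' _ h => ?_) (fun Y hY => ?_) (fun p _ => rfl)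
  · exact Finset.mem_filter.mpr ⟨Finset.mem_univ _, toLSpace_glue_mem_cyl hq hK X.2 p.1 p.2.2⟩
  · have h1 : glue q X.1 p.1 p.2.1 = glue q X.1 p'.1 p'.2.1 := congrArg Subtype.val h
    refine Prod.ext (funext fun a => ?_) (Subtype.ext ?_)
    · have h2 := congrArg (fun Z : Matrix _ _ K => Z (Blk.incl a) (Blk.last ε n)) h1
      simpa [glue_apply] using h2
    · have h2 := congrArg (fun Z : Matrix _ _ K => Z (-Blk.last ε n) (Blk.last ε n)) h1
      simpa [glue_apply] using h2
  · obtain ⟨h1, h2⟩ := (Finset.mem_filter.mp hY).2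
    have h3 := corner_succ_eq_glue h1
    rw [h2, corner_toLSpace] at h3
    have hz : (Y.1 (-Blk.last ε n) (Blk.last ε n)) ^ q = -Y.1 (-Blk.last ε n) (Blk.last ε n) := by
      have h4 := Y.2 (-Blk.last ε n) (Blk.last ε n)
      rw [neg_neg] at h4
      exact neg_eq_iff_eq_neg.mp h4.symm
    exact ⟨(fun a => Y.1 (Blk.incl a) (Blk.last ε n), ⟨_, hz⟩), Finset.mem_univ _,
      Subtype.ext h3.symm⟩

open Classical in
theorem sum_blkMass (h : n ≤ k) (X : SkewMat ε q K n) :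
    ∑ Y : SkewMat ε q K k,
      (if Y.toLSpace hq.ne_zero ∈ cyl q n X.1 then blkMass q Y.1 else 0) = blkMass q X.1 := by
  induction k, h using Nat.le_induction with
  | base =>
    rw [Finset.sum_eq_single X]
    · rw [if_pos (toLSpace_mem_cyl hq.ne_zero X)]
    · intro Y _ hY
      refine if_neg fun h => hY (Subtype.ext ?_)
      rw [← corner_toLSpace hq.ne_zero Y, h.2]
    · exact fun h => absurd (Finset.mem_univ _) h
  | succ k hk ih =>
    rw [← ih]
    simp only [← sum_blkMass_succ hq hK (n := k)]
    rw [← Finset.sum_filter fun Z : SkewMat ε q K k => Z.toLSpace hq.ne_zero ∈ cyl q n X.1,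
      Finset.sum_comm]
    refine Finset.sum_congr rfl fun Y _ => ?_
    by_cases hY : (Y.toLSpace hq.ne_zero).1 ∈ LSet ε q K k
    · have h1 : ∀ Z : SkewMat ε q K k, Y.toLSpace hq.ne_zero ∈ cyl q k Z.1 ↔
          skewCorner k (Y.toLSpace hq.ne_zero) = Z :=
        fun Z => ⟨fun h => Subtype.ext h.2, fun h => ⟨hY, congrArg Subtype.val h⟩⟩
      simp only [h1, Finset.sum_ite_eq, Finset.mem_filter, Finset.mem_univ, true_and,
        mem_cyl_iff hq.ne_zero hk (M := Y.toLSpace hq.ne_zero), hY]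
    · rw [if_neg fun h => hY (LSet_mono hk h.1)]
      exact (Finset.sum_eq_zero fun Z _ => if_neg fun h => hY h.1).symm

end Mass

end HLUnitary

end

noncomputable section

namespace HLUnitary

/-! ### Jordan types as partitions -/

section JordanType

theorem sum_map_min (s : Multiset ℕ) (k : ℕ) :
    (s.map fun p => min p k).sum = ∑ i ∈ Finset.range k, s.countP (i + 1 ≤ ·) := by
  induction s using Multiset.induction_on with
  | empty => simp
  | cons b s ih =>
    simp only [Multiset.map_cons, Multiset.sum_cons, ih, Multiset.countP_cons,
      Finset.sum_add_distrib]
    rw [add_comm, ← Finset.card_filter]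
    congr 1
    have h : (Finset.range k).filter (fun i => i + 1 ≤ b) = Finset.range (min b k) := by
      ext i
      simp only [Finset.mem_filter, Finset.mem_range, lt_min_iff]
      omega
    rw [h, Finset.card_range]

variable {ε : Fin 2} {q : ℕ} {K : Type*} [Field K] {n : ℕ}

/-- Both multiplicities are second differences of the same kernel dimensions, because ∑ min(p, k) is
the sum of the first k column counts of the partition. -/
theorem HasJordanType.jordanMult_eq {X : Matrix (Blk ε n) (Blk ε n) K}
    {lam : Nat.Partition (2 * n + ε)} (h : HasJordanType X lam) {a : ℕ} (h1 : 1 ≤ a)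
    (h2 : a ≤ 2 * n + ε) : jordanMult (Matrix.toLin' X) a = lam.parts.count a := by
  have e (j : ℕ) : tailMult (Matrix.toLin' X) j = lam.parts.countP (j + 1 ≤ ·) := by
    have e1 (k : ℕ) : ∑ i ∈ Finset.range k, tailMult (Matrix.toLin' X) i =
        ∑ i ∈ Finset.range k, lam.parts.countP (i + 1 ≤ ·) := by
      rw [← finrank_ker_pow_eq_sum, ← sum_map_min, ← h.2 k, Matrix.toLin'_pow]
    have e2 := e1 (j + 1)
    rw [Finset.sum_range_succ, Finset.sum_range_succ, e1 j] at e2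
    exact Nat.add_left_cancel e2
  rw [jordanMult, e, e, Nat.sub_add_cancel h1, ← tailCount_count (fun b => le_of_mem_parts lam),
    ← tailCount_count (fun b => le_of_mem_parts lam), tailCount_eq_add _ h2, Nat.add_sub_cancel]

theorem HasJordanType.blkMass_eq (hq : 1 < q) {X : Matrix (Blk ε n) (Blk ε n) K}
    {lam : Nat.Partition (2 * n + ε)} (h : HasJordanType X lam) :
    blkMass q X = (q : ℝ) ^ ((nStat lam : ℤ) - ((2 * n + ε : ℕ).choose 2 : ℤ)) /
      (1 - (q : ℝ) ^ (-2 : ℤ)) ^ (((2 * n + ε : ℕ) : ℝ) / 2) *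
        plancherel ε (qTildePar (-(q : ℝ)⁻¹) ε lam) := by
  rw [blkMass, if_pos h.1, ← cylMass_count ε hq lam]
  exact cylMass_congr ε q fun j h1 h2 => h.jordanMult_eq h1 h2

theorem exists_hasJordanType {X : Matrix (Blk ε n) (Blk ε n) K} (h : IsNilpotent X) :
    ∃ lam : Nat.Partition (2 * n + ε), HasJordanType X lam := by
  have hX := isNilpotent_toLin'.mpr h
  set f := Matrix.toLin' X
  have hmem (a : ℕ) (ha : a ∈ multMultiset (jordanMult f) (2 * n + ε)) :
      1 ≤ a ∧ a ≤ 2 * n + ε := by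
    rw [← Multiset.count_pos, count_multMultiset] at ha
    by_contra h'
    rw [if_neg h'] at ha
    exact lt_irrefl _ ha
  have hc : ∀ a, 1 ≤ a → a ≤ 2 * n + ε →
      (multMultiset (jordanMult f) (2 * n + ε)).count a = jordanMult f a := fun a h1 h2 => by
    rw [count_multMultiset, if_pos ⟨h1, h2⟩]
  refine ⟨⟨multMultiset (jordanMult f) (2 * n + ε), fun ha => (hmem _ ha).1, ?_⟩, h, fun k => ?_⟩
  · rw [← sum_count_mul_eq hmem]
    refine Eq.trans ?_ ((finrank_blk (K := K) ▸ wordSize_jordanMult hX :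
      wordSize (jordanMult f) (2 * n + ε) = 2 * n + ε))
    exact Finset.sum_congr rfl fun a ha =>
      congrArg (a * ·) (hc a (Finset.mem_Icc.mp ha).1 (Finset.mem_Icc.mp ha).2)
  · rw [Matrix.toLin'_pow, finrank_ker_pow_eq_sum, sum_map_min]
    refine Finset.sum_congr rfl fun i _ => ?_
    rw [← tailCount_jordanMult hX (L := 2 * n + ε) finrank_blk.le,
      ← tailCount_count (fun a ha => (hmem a ha).2)]
    refine Finset.sum_congr rfl fun a ha => ?_
    rw [Finset.mem_Icc] at ha
    exact (hc a (by omega) ha.2).symm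

end JordanType

end HLUnitary

end

noncomputable section

namespace HLUnitary

/-! ### Cylinders as a countable basis of compact open sets -/

section Topology

variable {ε : Fin 2} {q : ℕ} {K : Type*} [Field K] {n k : ℕ}

theorem mem_cyl_corner {M : LSpace ε q K} (hM : M.1 ∈ LSet ε q K n) :
    M ∈ cyl q n (corner n M) := ⟨hM, rfl⟩

theorem LSpace.exists_mem_LSet (M : LSpace ε q K) (n : ℕ) : ∃ k, n ≤ k ∧ M.1 ∈ LSet ε q K k :=
  ⟨max n M.2.choose, le_max_left _ _, LSet_mono (le_max_right _ _) M.2.choose_spec⟩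

theorem LClose.mem_cyl {M M' : LSpace ε q K} (hM : M.1 ∈ LSet ε q K n) (h : LClose n M M') :
    M' ∈ cyl q n (corner n M) := by
  refine ⟨⟨M'.isSkewHermitian, fun i j hij hn => ?_⟩, Matrix.ext fun a b => h.2 a.1 b.1 a.2 b.2⟩
  have h1 := h.1.2 i j hij (lt_of_le_of_lt (by positivity) hn)
  rw [Matrix.sub_apply, hM.2 i j hij hn, sub_zero] at h1
  exact h1

theorem isOpen_cyl (X : Matrix (Blk ε n) (Blk ε n) K) : IsOpen (cyl q n X) := fun M hM =>
  ⟨n, fun M' h => by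
    have h' := h.mem_cyl hM.1
    rwa [hM.2] at h'⟩

theorem LClose.mono {M M' : LSpace ε q K} (h : n ≤ k) (h' : LClose k M M') : LClose n M M' :=
  ⟨h'.1, fun i j hi hj => h'.2 i j (hi.trans (by exact_mod_cast h)) (hj.trans (by exact_mod_cast h))⟩

/-- Two cylinders are nested or disjoint: one common point decides, by `mem_cyl_iff`, for the whole
smaller cylinder. -/
theorem cyl_subset (hq : q ≠ 0) (h : n ≤ k) {X : Matrix (Blk ε n) (Blk ε n) K}
    {Y : Matrix (Blk ε k) (Blk ε k) K} {M : LSpace ε q K} (h1 : M ∈ cyl q n X)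
    (h2 : M ∈ cyl q k Y) : cyl q k Y ⊆ cyl q n X := by
  intro M' hM'
  have h3 : skewCorner k M' = skewCorner k M := Subtype.ext (hM'.2.trans h2.2.symm)
  rw [mem_cyl_iff hq h] at h1 ⊢
  rw [h3]
  exact ⟨hM'.1, h1.2⟩

/-- The elementary cylinder sets of level at least `n₀`. -/
def cylFamily (ε : Fin 2) (q : ℕ) (K : Type*) [Field K] (n₀ : ℕ) : Set (Set (LSpace ε q K)) :=
  {s | ∃ n, n₀ ≤ n ∧ ∃ X : SkewMat ε q K n, cyl q n X.1 = s}

theorem isPiSystem_cylFamily (hq : q ≠ 0) (n₀ : ℕ) : IsPiSystem (cylFamily ε q K n₀) := by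
  rintro _ ⟨n, hn, X, rfl⟩ _ ⟨k, hk, Y, rfl⟩ ⟨M, h1, h2⟩
  rcases le_total n k with h | h
  · rw [Set.inter_eq_right.mpr (cyl_subset hq h h1 h2)]
    exact ⟨k, hk, Y, rfl⟩
  · rw [Set.inter_eq_left.mpr (cyl_subset hq h h2 h1)]
    exact ⟨n, hn, X, rfl⟩

theorem sUnion_cylFamily (n₀ : ℕ) : ⋃₀ cylFamily ε q K n₀ = Set.univ := by
  refine Set.eq_univ_of_forall fun M => ?_
  obtain ⟨k, hk, hM⟩ := M.exists_mem_LSet n₀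
  exact ⟨_, ⟨k, hk, skewCorner k M, rfl⟩, mem_cyl_corner hM⟩

theorem countable_cylFamily [Finite K] (n₀ : ℕ) : (cylFamily ε q K n₀).Countable := by
  refine (Set.countable_range fun p : Σ n, SkewMat ε q K n => cyl q p.1 p.2.1).mono ?_
  rintro _ ⟨n, -, X, rfl⟩
  exact ⟨⟨n, X⟩, rfl⟩

instance : T2Space (LSpace ε q K) := by
  refine ⟨fun M M' h => ?_⟩
  obtain ⟨i, j, hij⟩ : ∃ i j, M.1 i j ≠ M'.1 i j := by
    by_contra! h'
    exact h (Subtype.ext (Matrix.ext h'))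
  obtain ⟨k, hk, h1⟩ := M.exists_mem_LSet (max i.1.natAbs j.1.natAbs)
  obtain ⟨l, hl, h2⟩ := M'.exists_mem_LSet k
  refine ⟨cyl q l (corner l M), cyl q l (corner l M'), isOpen_cyl _, isOpen_cyl _,
    mem_cyl_corner (LSet_mono hl h1), mem_cyl_corner h2, ?_⟩
  rw [Set.disjoint_left]
  intro A hA hA'
  have h3 : corner l M = corner l M' := hA.2.symm.trans hA'.2
  have hi : |i.1| ≤ (l : ℤ) := abs_le.mpr ⟨by omega, by omega⟩
  have hj : |j.1| ≤ (l : ℤ) := abs_le.mpr ⟨by omega, by omega⟩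
  exact hij (congrFun (congrFun h3 ⟨i, hi⟩) ⟨j, hj⟩)

variable [Finite K] (hq : IsPrimePow q) (hK : Nat.card K = q ^ 2)
include hq hK

/-- For M in L_n the cylinder through M of level n is the coset of the subgroup L_{-n}, so cylinders
give the group topology. -/
theorem lClose_of_mem_cyl {M M' : LSpace ε q K} (hM : M.1 ∈ LSet ε q K n)
    (h : M' ∈ cyl q n (corner n M)) : LClose n M M' := by
  have h1 : ∀ i j : Idx ε, |i.1| ≤ (n : ℤ) → |j.1| ≤ (n : ℤ) → M'.1 i j = M.1 i j :=
    fun i j hi hj => congrFun (congrFun h.2 ⟨i, hi⟩) ⟨j, hj⟩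
  refine ⟨⟨fun i j => ?_, fun i j hij _ => ?_⟩, h1⟩
  · rw [Matrix.sub_apply, Matrix.sub_apply, M.isSkewHermitian, M'.isSkewHermitian,
      sub_pow_conj hq hK]
    ring
  · rw [Matrix.sub_apply, sub_eq_zero]
    by_cases h2 : |i.1| ≤ (n : ℤ) ∧ |j.1| ≤ (n : ℤ)
    · exact h1 i j h2.1 h2.2
    · have h3 : (n : ℤ) < max |i.1| |j.1| := not_le.mp fun h' => h2 (max_le_iff.mp h')
      rw [hM.2 i j hij h3, h.1.2 i j hij h3]

theorem isTopologicalBasis_cylFamily (n₀ : ℕ) :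
    TopologicalSpace.IsTopologicalBasis (cylFamily ε q K n₀) := by
  refine TopologicalSpace.isTopologicalBasis_of_isOpen_of_nhds ?_ fun M U hM hU => ?_
  · rintro _ ⟨n, -, X, rfl⟩
    exact isOpen_cyl X.1
  · obtain ⟨n, hn⟩ := hU M hM
    obtain ⟨k, hk, h1⟩ := M.exists_mem_LSet (max n n₀)
    refine ⟨_, ⟨k, (le_max_right _ _).trans hk, skewCorner k M, rfl⟩, mem_cyl_corner h1, ?_⟩
    intro M' hM'
    exact hn M' ((lClose_of_mem_cyl hq hK h1 hM').mono ((le_max_left _ _).trans hk))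

theorem secondCountableTopology : SecondCountableTopology (LSpace ε q K) :=
  (isTopologicalBasis_cylFamily hq hK 0).secondCountableTopology (countable_cylFamily 0)

theorem generateFrom_cylFamily (n₀ : ℕ) :
    (inferInstance : MeasurableSpace (LSpace ε q K)) =
      MeasurableSpace.generateFrom (cylFamily ε q K n₀) := by
  have := secondCountableTopology (ε := ε) hq hK
  exact (isTopologicalBasis_cylFamily hq hK n₀).borel_eq_generateFrom

/-- A cylinder is the continuous image of a closed set in a product of copies of the finite discrete
space K, compact by Tychonoff's theorem. -/
theorem isCompact_cyl (X : Matrix (Blk ε n) (Blk ε n) K) : IsCompact (cyl q n X) := by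
  let : TopologicalSpace K := ⊥
  have : DiscreteTopology K := ⟨rfl⟩
  let S : Set (Idx ε → Idx ε → K) := {A | Matrix.of A ∈ LSet ε q K n ∧
    ∀ a b : Blk ε n, A a.1 b.1 = X a b}
  have hc (i j : Idx ε) : Continuous fun A : Idx ε → Idx ε → K => A i j :=
    continuous_apply_apply i j
  have hS : IsClosed S := by
    have h1 : S = (⋂ i, ⋂ j, {A : Idx ε → Idx ε → K | A (-j) (-i) = -(A i j) ^ q}) ∩
        (⋂ i, ⋂ j, {A : Idx ε → Idx ε → K | j.1 ≤ i.1 → (n : ℤ) < max |i.1| |j.1| → A i j = 0}) ∩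
        ⋂ a : Blk ε n, ⋂ b : Blk ε n, {A : Idx ε → Idx ε → K | A a.1 b.1 = X a b} := by
      ext A
      simp only [Set.mem_inter_iff, Set.mem_iInter]
      rfl
    rw [h1]
    refine ((isClosed_iInter fun i => isClosed_iInter fun j => ?_).inter
      (isClosed_iInter fun i => isClosed_iInter fun j => ?_)).inter
      (isClosed_iInter fun a => isClosed_iInter fun b => isClosed_eq (hc _ _) continuous_const)
    · exact isClosed_eq (hc _ _)
        ((continuous_of_discreteTopology (f := fun x : K => -x ^ q)).comp (hc i j))
    · by_cases h : j.1 ≤ i.1 ∧ (n : ℤ) < max |i.1| |j.1|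
      · simpa only [h.1, h.2, forall_const] using isClosed_eq (hc i j) continuous_const
      · convert isClosed_univ
        exact Set.eq_univ_of_forall fun A h1 h2 => absurd ⟨h1, h2⟩ h
  have : CompactSpace S := isCompact_iff_compactSpace.mp hS.isCompact
  let f : S → LSpace ε q K := fun A => ⟨Matrix.of A.1, n, A.2.1⟩
  have hf : Continuous f := by
    -- Only basis cylinders of level at least n are needed; on them the preimage imposes finitely
    -- many coordinate conditions.
    rw [(isTopologicalBasis_cylFamily hq hK n).continuous_iff]
    rintro _ ⟨k, hk, Y, rfl⟩
    have h2 : f ⁻¹' cyl q k Y.1 = ⋂ a : Blk ε k, ⋂ b : Blk ε k, {A : S | A.1 a.1 b.1 = Y.1 a b} := by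
      ext A
      simp only [Set.mem_iInter]
      exact ⟨fun h a b => congrFun (congrFun h.2 a) b,
        fun h => ⟨LSet_mono hk A.2.1, Matrix.ext h⟩⟩
    rw [h2]
    exact isOpen_iInter_of_finite fun a => isOpen_iInter_of_finite fun b =>
      (isOpen_discrete {Y.1 a b}).preimage ((hc a.1 b.1).comp continuous_subtype_val)
  have h3 : cyl q n X = Set.range f := by
    ext M
    constructor
    · exact fun h => ⟨⟨fun i j => M.1 i j, h.1, fun a b => congrFun (congrFun h.2 a) b⟩, rfl⟩
    · rintro ⟨A, rfl⟩
      exact ⟨A.2.1, Matrix.ext A.2.2⟩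
  rw [h3]
  exact isCompact_range hf

theorem locallyCompactSpace : LocallyCompactSpace (LSpace ε q K) := by
  have : WeaklyLocallyCompactSpace (LSpace ε q K) := by
    refine ⟨fun M => ?_⟩
    obtain ⟨k, -, hM⟩ := M.exists_mem_LSet 0
    exact ⟨_, isCompact_cyl hq hK (corner k M), (isOpen_cyl _).mem_nhds (mem_cyl_corner hM)⟩
  infer_instance

end Topology

end HLUnitary

end

noncomputable section

namespace HLUnitary

open Filter Topology CompactlySupported MeasureTheory

/-! ### Construction of the measure by the Riesz–Markov theorem -/

section Existence

variable {ε : Fin 2} {q : ℕ} {K : Type*} [Field K] [Finite K] {n k : ℕ}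

/-- The approximation of the integral at level `k`. -/
def levelSum (hq : q ≠ 0) (k : ℕ) (f : LSpace ε q K → ℝ) : ℝ :=
  ∑ X : SkewMat ε q K k, blkMass q X.1 * f (X.toLSpace hq)

/-- The support of f is covered by finitely many cylinders, and coherence bounds the total mass of
the level-k blocks in the support by the masses of these cylinders, independently of k. -/
theorem exists_abs_levelSum_le (hq : IsPrimePow q) (hK : Nat.card K = q ^ 2)
    (f : C_c(LSpace ε q K, ℝ)) :
    ∃ C : ℝ, ∀ᶠ k in atTop, |levelSum hq.ne_zero k f| ≤ C := by
  classical
  choose l _ hl using fun M : LSpace ε q K => M.exists_mem_LSet 0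
  obtain ⟨t, ht⟩ := f.hasCompactSupport.isCompact.elim_finite_subcover
    (fun M => cyl q (l M) (corner (l M) M)) (fun M => isOpen_cyl _)
    (fun M _ => Set.mem_iUnion.mpr ⟨M, mem_cyl_corner (hl M)⟩)
  obtain ⟨B, hB⟩ := f.continuous.bounded_above_of_compact_support f.hasCompactSupport
  refine ⟨B * ∑ M ∈ t, blkMass q (skewCorner (l M) M).1, ?_⟩
  filter_upwards [eventually_ge_atTop (t.sup l)] with k hk
  rw [Finset.sum_congr rfl fun M hM =>
    (sum_blkMass hq hK ((Finset.le_sup hM).trans hk) (skewCorner (l M) M)).symm,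
    Finset.sum_comm, Finset.mul_sum]
  refine (Finset.abs_sum_le_sum_abs _ _).trans (Finset.sum_le_sum fun X _ => ?_)
  have h0 := blkMass_nonneg hq.one_lt X.1
  rw [abs_mul, abs_of_nonneg h0]
  have hB0 : 0 ≤ B := (norm_nonneg _).trans (hB (X.toLSpace hq.ne_zero))
  have h1 : ∀ M ∈ t, 0 ≤ (if X.toLSpace hq.ne_zero ∈ cyl q (l M) (skewCorner (l M) M).1 then
      blkMass q X.1 else 0) := fun M _ => by
    split_ifs
    · exact h0
    · exact le_rfl
  by_cases hX : f (X.toLSpace hq.ne_zero) = 0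
  · rw [hX, abs_zero, mul_zero]
    exact mul_nonneg hB0 (Finset.sum_nonneg h1)
  · obtain ⟨M, hM, hMX⟩ := Set.mem_iUnion₂.mp (ht (subset_tsupport _ hX))
    rw [mul_comm]
    refine mul_le_mul (hB _) ?_ h0 hB0
    refine le_trans (le_of_eq ?_) (Finset.single_le_sum h1 hM)
    exact (if_pos hMX).symm

/-- A bounded sequence converges along a free ultrafilter. One ultrafilter serves for all f, so the
limit is linear and positive in f. -/
theorem exists_tendsto_levelSum (hq : IsPrimePow q) (hK : Nat.card K = q ^ 2)
    (f : C_c(LSpace ε q K, ℝ)) :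
    ∃ x : ℝ, Tendsto (fun k => levelSum hq.ne_zero k f) (hyperfilter ℕ) (𝓝 x) := by
  obtain ⟨C, hC⟩ := exists_abs_levelSum_le hq hK f
  have h1 : ∀ᶠ k in (hyperfilter ℕ : Filter ℕ), levelSum hq.ne_zero k f ∈ Set.Icc (-C) C :=
    (hC.filter_mono (Nat.hyperfilter_le_atTop)).mono fun k hk => abs_le.mp hk
  obtain ⟨x, -, hx⟩ := isCompact_Icc.ultrafilter_le_nhds
    ((hyperfilter ℕ).map fun k => levelSum hq.ne_zero k f) (le_principal_iff.mpr h1)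
  exact ⟨x, hx⟩

/-- The positive functional that represents the measure. -/
def levelLim (hq : IsPrimePow q) (hK : Nat.card K = q ^ 2) : C_c(LSpace ε q K, ℝ) →ₚ[ℝ] ℝ :=
  PositiveLinearMap.mk₀
    { toFun := fun f => (exists_tendsto_levelSum hq hK f).choose
      map_add' := fun f g => by
        refine tendsto_nhds_unique (exists_tendsto_levelSum hq hK (f + g)).choose_spec ?_
        refine ((exists_tendsto_levelSum hq hK f).choose_spec.add
          (exists_tendsto_levelSum hq hK g).choose_spec).congr fun k => ?_
        simp only [levelSum, CompactlySupportedContinuousMap.coe_add, Pi.add_apply, mul_add,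
          Finset.sum_add_distrib]
      map_smul' := fun c f => by
        refine tendsto_nhds_unique (exists_tendsto_levelSum hq hK (c • f)).choose_spec ?_
        refine ((exists_tendsto_levelSum hq hK f).choose_spec.const_mul c).congr fun k => ?_
        simp only [levelSum, CompactlySupportedContinuousMap.coe_smul, Pi.smul_apply, smul_eq_mul,
          Finset.mul_sum]
        exact Finset.sum_congr rfl fun X _ => by ring }
    fun f hf => by
      refine ge_of_tendsto' (exists_tendsto_levelSum hq hK f).choose_spec fun k => ?_
      exact Finset.sum_nonneg fun X _ => mul_nonneg (blkMass_nonneg hq.one_lt X.1) (hf _)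

theorem tendsto_levelSum (hq : IsPrimePow q) (hK : Nat.card K = q ^ 2)
    (f : C_c(LSpace ε q K, ℝ)) :
    Tendsto (fun k => levelSum hq.ne_zero k f) (hyperfilter ℕ) (𝓝 (levelLim hq hK f)) :=
  (exists_tendsto_levelSum hq hK f).choose_spec

/-- The indicator function of a cylinder set. -/
def cylIndicator (hq : IsPrimePow q) (hK : Nat.card K = q ^ 2) (X : SkewMat ε q K n) :
    C_c(LSpace ε q K, ℝ) where
  toFun := (cyl q n X.1).indicator 1
  continuous_toFun := by
    have h : IsClopen (cyl q n X.1) := ⟨(isCompact_cyl hq hK X.1).isClosed, isOpen_cyl X.1⟩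
    exact h.continuous_indicator continuous_const
  hasCompactSupport' := HasCompactSupport.intro (isCompact_cyl hq hK X.1)
    fun _ h => Set.indicator_of_notMem h _

theorem cylIndicator_apply (hq : IsPrimePow q) (hK : Nat.card K = q ^ 2) (X : SkewMat ε q K n)
    (M : LSpace ε q K) : cylIndicator hq hK X M = (cyl q n X.1).indicator 1 M := rfl

/-- By coherence the finite sums for the indicator of a cylinder are constant from its level on, so
the limit is exact. -/
theorem levelLim_cylIndicator (hq : IsPrimePow q) (hK : Nat.card K = q ^ 2)
    (X : SkewMat ε q K n) : levelLim hq hK (cylIndicator hq hK X) = blkMass q X.1 := by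
  classical
  refine tendsto_nhds_unique (tendsto_levelSum hq hK _) (tendsto_const_nhds.congr' ?_)
  refine Eventually.filter_mono Nat.hyperfilter_le_atTop ?_
  filter_upwards [eventually_ge_atTop n] with k hk
  rw [← sum_blkMass hq hK hk X, levelSum]
  refine Finset.sum_congr rfl fun Y _ => ?_
  rw [cylIndicator_apply, Set.indicator_apply, Pi.one_apply, mul_ite, mul_one, mul_zero]

/-- The indicator of a cylinder is itself a compactly supported continuous function; comparison from
above and below with the Riesz measure pins down the mass. -/
theorem exists_measure_cyl (hq : IsPrimePow q) (hK : Nat.card K = q ^ 2) :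
    ∃ P : Measure (LSpace ε q K), IsFiniteMeasureOnCompacts P ∧
      ∀ (n : ℕ) (X : SkewMat ε q K n), P (cyl q n X.1) = ENNReal.ofReal (blkMass q X.1) := by
  have := locallyCompactSpace (ε := ε) hq hK
  refine ⟨RealRMK.rieszMeasure (levelLim hq hK), inferInstance, fun n X => ?_⟩
  have h0 : ∀ M, 0 ≤ cylIndicator hq hK X M ∧ cylIndicator hq hK X M ≤ 1 := fun M => by
    rw [cylIndicator_apply]
    by_cases h : M ∈ cyl q n X.1
    · simp [Set.indicator_of_mem h]
    · simp [Set.indicator_of_notMem h]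
  rw [← levelLim_cylIndicator hq hK X]
  refine le_antisymm ?_ ?_
  · exact RealRMK.rieszMeasure_le_of_eq_one _ (fun M => (h0 M).1) (isCompact_cyl hq hK X.1)
      fun M hM => Set.indicator_of_mem hM _
  · refine RealRMK.le_rieszMeasure_tsupport_subset _ h0 ?_
    exact closure_minimal (fun M hM => Set.mem_of_indicator_ne_zero hM)
      (isCompact_cyl hq hK X.1).isClosed

end Existence

/-! ### Support and uniqueness -/

section Uniqueness

variable {ε : Fin 2} {q : ℕ} {K : Type*} [Field K] {n : ℕ}

theorem cyl_subset_compl_pronilpotent {X : Matrix (Blk ε n) (Blk ε n) K} (hX : ¬IsNilpotent X) :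
    cyl q n X ⊆ (pronilpotent ε q K)ᶜ := by
  rintro M ⟨h1, h2⟩ ⟨k, h3, h4⟩
  refine hX ?_
  rw [← h2, ← isNilpotent_corner_iff h1 (le_max_left n k),
    isNilpotent_corner_iff h3 (le_max_right n k)]
  exact h4

/-- The complement is covered by countably many cylinders with non-nilpotent central block, which
have mass zero. -/
theorem measure_compl_pronilpotent [Finite K] {P : Measure (LSpace ε q K)}
    (h : ∀ (n : ℕ) (X : SkewMat ε q K n), P (cyl q n X.1) = ENNReal.ofReal (blkMass q X.1)) :
    P (pronilpotent ε q K)ᶜ = 0 := by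
  have h1 : (pronilpotent ε q K)ᶜ ⊆ ⋃ p : Σ n, {X : SkewMat ε q K n // ¬IsNilpotent X.1},
      cyl q p.1 p.2.1.1 := by
    intro M hM
    obtain ⟨k, -, hk⟩ := M.exists_mem_LSet 0
    exact Set.mem_iUnion.mpr
      ⟨⟨k, skewCorner k M, fun h' => hM ⟨k, hk, h'⟩⟩, mem_cyl_corner hk⟩
  refine measure_mono_null h1 (measure_iUnion_null fun p => ?_)
  rw [h, blkMass, if_neg p.2.2, ENNReal.ofReal_zero]

theorem measure_cyl_eq_blkMass (hq : 1 < q) {P : Measure (LSpace ε q K)}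
    (h0 : P (pronilpotent ε q K)ᶜ = 0)
    (h1 : ∀ (n : ℕ) (X : Matrix (Blk ε n) (Blk ε n) K) (lam : Nat.Partition (2 * n + ε)),
      IsSkewHermitian q X → HasJordanType X lam → P (cyl q n X) =
        ENNReal.ofReal ((q : ℝ) ^ ((nStat lam : ℤ) - ((2 * n + ε : ℕ).choose 2 : ℤ)) /
          (1 - (q : ℝ) ^ (-2 : ℤ)) ^ (((2 * n + ε : ℕ) : ℝ) / 2) *
            plancherel ε (qTildePar (-(q : ℝ)⁻¹) ε lam)))
    (X : SkewMat ε q K n) : P (cyl q n X.1) = ENNReal.ofReal (blkMass q X.1) := by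
  by_cases hX : IsNilpotent X.1
  · obtain ⟨lam, hlam⟩ := exists_hasJordanType hX
    rw [h1 n X.1 lam X.2 hlam, hlam.blkMass_eq hq]
  · rw [measure_mono_null (cyl_subset_compl_pronilpotent hX) h0, blkMass, if_neg hX,
      ENNReal.ofReal_zero]

/-- Cylinders of level at least n₀ form a countable π-system that covers L, generates the Borel sets
and consists of sets of finite mass. The freedom in n₀ is needed for invariance, where only high
levels behave well under conjugation. -/
theorem measure_ext_cyl [Finite K] (hq : IsPrimePow q) (hK : Nat.card K = q ^ 2)
    {P P' : Measure (LSpace ε q K)} (n₀ : ℕ)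
    (h : ∀ n, n₀ ≤ n → ∀ X : SkewMat ε q K n, P (cyl q n X.1) = ENNReal.ofReal (blkMass q X.1))
    (h' : ∀ n, n₀ ≤ n → ∀ X : SkewMat ε q K n,
      P' (cyl q n X.1) = ENNReal.ofReal (blkMass q X.1)) : P = P' := by
  refine Measure.ext_of_generateFrom_of_cover_subset (generateFrom_cylFamily hq hK n₀)
    (isPiSystem_cylFamily hq.ne_zero n₀) subset_rfl (countable_cylFamily n₀)
    (sUnion_cylFamily n₀) ?_ ?_
  · rintro _ ⟨n, hn, X, rfl⟩
    rw [h n hn X]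
    exact ENNReal.ofReal_ne_top
  · rintro _ ⟨n, hn, X, rfl⟩
    rw [h n hn X, h' n hn X]

end Uniqueness

end HLUnitary

end

noncomputable section

namespace HLUnitary

/-! ### Hermitian adjoints and products of infinite matrices -/

section Adjoint

variable {q : ℕ} {K : Type*} [Field K] {ι : Type*} [InvolutiveNeg ι]

/-- The adjoint matrix with respect to the Hermitian form with `1`'s on the secondary diagonal. -/
def hermAdj (q : ℕ) (A : Matrix ι ι K) : Matrix ι ι K := Matrix.of fun i j => (A (-j) (-i)) ^ q

theorem hermAdj_apply (A : Matrix ι ι K) (i j : ι) : hermAdj q A i j = (A (-j) (-i)) ^ q := rfl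

variable [Finite K] (hq : IsPrimePow q) (hK : Nat.card K = q ^ 2)

include hK in
theorem hermAdj_hermAdj (A : Matrix ι ι K) : hermAdj q (hermAdj q A) = A := by
  ext i j
  rw [hermAdj_apply, hermAdj_apply, pow_pow_conj hK, neg_neg, neg_neg]

include hq hK

theorem isSkewHermitian_iff {A : Matrix ι ι K} : IsSkewHermitian q A ↔ hermAdj q A = -A := by
  constructor
  · intro h
    ext i j
    rw [hermAdj_apply, h i j, neg_pow_conj hq hK, pow_pow_conj hK, Matrix.neg_apply]
  · intro h a b
    have h1 := congrArg (fun B : Matrix ι ι K => B (-b) (-a)) h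
    simp only [hermAdj_apply, Matrix.neg_apply, neg_neg] at h1
    rw [h1, neg_neg]

theorem hermAdj_mul [Fintype ι] (A B : Matrix ι ι K) :
    hermAdj q (A * B) = hermAdj q B * hermAdj q A := by
  ext i j
  rw [hermAdj_apply, Matrix.mul_apply, Matrix.mul_apply, sum_pow_conj hq hK,
    ← Equiv.sum_comp (Equiv.neg ι)]
  refine Finset.sum_congr rfl fun k _ => ?_
  rw [hermAdj_apply, hermAdj_apply, mul_pow, mul_comm, Equiv.neg_apply]

theorem isSkewHermitian_conj [Fintype ι] {X : Matrix ι ι K} (hX : IsSkewHermitian q X)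
    (G : Matrix ι ι K) : IsSkewHermitian q (hermAdj q G * X * G) := by
  rw [isSkewHermitian_iff hq hK] at hX ⊢
  rw [hermAdj_mul hq hK, hermAdj_mul hq hK, hX, hermAdj_hermAdj hK, Matrix.neg_mul, Matrix.mul_neg,
    Matrix.mul_assoc]

end Adjoint

section InfiniteProduct

variable {ε : Fin 2} {q : ℕ} {K : Type*} [Field K] {n n₀ m : ℕ}

/-- The product of infinite matrices. -/
def imul (A B : Matrix (Idx ε) (Idx ε) K) : Matrix (Idx ε) (Idx ε) K :=
  Matrix.of fun i j => ∑ᶠ k, A i k * B k j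

theorem imul_apply (A B : Matrix (Idx ε) (Idx ε) K) (i j : Idx ε) :
    imul A B i j = ∑ᶠ k, A i k * B k j := rfl

/-- The central block of an infinite matrix. -/
def restr (n : ℕ) (A : Matrix (Idx ε) (Idx ε) K) : Matrix (Blk ε n) (Blk ε n) K :=
  Matrix.of fun a b => A a.1 b.1

omit [Field K] in
theorem restr_apply (A : Matrix (Idx ε) (Idx ε) K) (a b : Blk ε n) :
    restr n A a b = A a.1 b.1 := rfl

theorem exists_le_abs (i j : Idx ε) (n : ℕ) : ∃ k, n ≤ k ∧ |i.1| ≤ (k : ℤ) ∧ |j.1| ≤ (k : ℤ) :=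
  ⟨max n (max i.1.natAbs j.1.natAbs), le_max_left _ _, abs_le.mpr ⟨by omega, by omega⟩,
    abs_le.mpr ⟨by omega, by omega⟩⟩

omit [Field K] in
theorem ext_restr {A B : Matrix (Idx ε) (Idx ε) K} (n₀ : ℕ)
    (h : ∀ n, n₀ ≤ n → restr n A = restr n B) : A = B := by
  ext i j
  obtain ⟨k, hk, hi, hj⟩ := exists_le_abs i j n₀
  exact congrFun (congrFun (h k hk) ⟨i, hi⟩) ⟨j, hj⟩

/-- `A` coincides with the identity matrix outside of a central block. -/
def IsNearOne (n₀ : ℕ) (A : Matrix (Idx ε) (Idx ε) K) : Prop :=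
  ∀ i j : Idx ε, ¬(|i.1| ≤ (n₀ : ℤ) ∧ |j.1| ≤ (n₀ : ℤ)) → A i j = (1 : Matrix (Idx ε) (Idx ε) K) i j

theorem IsNearOne.eq_zero {A : Matrix (Idx ε) (Idx ε) K} (hA : IsNearOne n₀ A) {i j : Idx ε}
    (h : ¬(|i.1| ≤ (n₀ : ℤ) ∧ |j.1| ≤ (n₀ : ℤ))) (hij : i ≠ j) : A i j = 0 := by
  rw [hA i j h, Matrix.one_apply_ne hij]

theorem finsum_eq_sum_blk {f : Idx ε → K} (h : ∀ k, f k ≠ 0 → |k.1| ≤ (n : ℤ)) :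
    ∑ᶠ k, f k = ∑ k : Blk ε n, f k.1 := by
  have h1 : Function.support f ⊆
      ((Finset.univ.map ⟨fun a : Blk ε n => a.1, Subtype.val_injective⟩ : Finset (Idx ε)) :
        Set (Idx ε)) := by
    intro k hk
    rw [Finset.coe_map]
    exact ⟨(⟨k, h k hk⟩ : Blk ε n), Finset.mem_coe.mpr (Finset.mem_univ _), rfl⟩
  rw [finsum_eq_sum_of_support_subset f h1, Finset.sum_map]
  rfl

/-- Restriction to a block is multiplicative here because A is the identity outside of a smaller
block and so does not mix the block with its complement. -/
theorem restr_imul_left {A : Matrix (Idx ε) (Idx ε) K} (hA : IsNearOne n₀ A) (hn : n₀ ≤ n)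
    (B : Matrix (Idx ε) (Idx ε) K) : restr n (imul A B) = restr n A * restr n B := by
  have hn' : (n₀ : ℤ) ≤ n := by exact_mod_cast hn
  ext a b
  rw [restr_apply, imul_apply, Matrix.mul_apply, finsum_eq_sum_blk (n := n)]
  · rfl
  · intro k hk
    by_contra h
    refine hk ?_
    rw [hA.eq_zero (fun h' => h (h'.2.trans hn')), zero_mul]
    rintro rfl
    exact h a.2

theorem restr_imul_right {B : Matrix (Idx ε) (Idx ε) K} (hB : IsNearOne n₀ B) (hn : n₀ ≤ n)
    (A : Matrix (Idx ε) (Idx ε) K) : restr n (imul A B) = restr n A * restr n B := by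
  have hn' : (n₀ : ℤ) ≤ n := by exact_mod_cast hn
  ext a b
  rw [restr_apply, imul_apply, Matrix.mul_apply, finsum_eq_sum_blk (n := n)]
  · rfl
  · intro k hk
    by_contra h
    refine hk ?_
    rw [hB.eq_zero (fun h' => h (h'.1.trans hn')), mul_zero]
    rintro rfl
    exact h b.2

/-- A mixes only rows with index in the small block. If i and k are both there, j ≤ i and |j| > m
force j < -m, so j < k and the entry of B at (k, j) vanishes as well. -/
theorem imul_left_pattern {A B : Matrix (Idx ε) (Idx ε) K} (hA : IsNearOne n₀ A) (hm : n₀ ≤ m)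
    (hB : ∀ i j : Idx ε, j.1 ≤ i.1 → (m : ℤ) < max |i.1| |j.1| → B i j = 0) (i j : Idx ε)
    (hij : j.1 ≤ i.1) (h : (m : ℤ) < max |i.1| |j.1|) : imul A B i j = 0 := by
  rw [imul_apply]
  refine finsum_eq_zero_of_forall_eq_zero fun k => ?_
  by_cases hik : i = k
  · rw [← hik, hB i j hij h, mul_zero]
  · by_cases h1 : |i.1| ≤ (n₀ : ℤ) ∧ |k.1| ≤ (n₀ : ℤ)
    · obtain ⟨h2, h3⟩ := h1
      rw [abs_le] at h2 h3
      have h4 : (m : ℤ) < |j.1| := (lt_max_iff.mp h).resolve_left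
        (not_lt.mpr (abs_le.mpr ⟨by omega, by omega⟩))
      rw [hB k j _ (lt_max_of_lt_right h4), mul_zero]
      rcases lt_abs.mp h4 with h5 | h5 <;> omega
    · rw [hA.eq_zero h1 hik, zero_mul]

theorem imul_right_pattern {A B : Matrix (Idx ε) (Idx ε) K} (hB : IsNearOne n₀ B) (hm : n₀ ≤ m)
    (hA : ∀ i j : Idx ε, j.1 ≤ i.1 → (m : ℤ) < max |i.1| |j.1| → A i j = 0) (i j : Idx ε)
    (hij : j.1 ≤ i.1) (h : (m : ℤ) < max |i.1| |j.1|) : imul A B i j = 0 := by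
  rw [imul_apply]
  refine finsum_eq_zero_of_forall_eq_zero fun k => ?_
  by_cases hkj : k = j
  · rw [hkj, hA i j hij h, zero_mul]
  · by_cases h1 : |k.1| ≤ (n₀ : ℤ) ∧ |j.1| ≤ (n₀ : ℤ)
    · obtain ⟨h2, h3⟩ := h1
      rw [abs_le] at h2 h3
      have h4 : (m : ℤ) < |i.1| := (lt_max_iff.mp h).resolve_right
        (not_lt.mpr (abs_le.mpr ⟨by omega, by omega⟩))
      rw [hA i k _ (lt_max_of_lt_left h4), zero_mul]
      rcases lt_abs.mp h4 with h5 | h5 <;> omega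
    · rw [hB.eq_zero h1 hkj, mul_zero]

theorem exists_isNearOne {g : Matrix (Idx ε) (Idx ε) K}
    (hg : {p : Idx ε × Idx ε | g p.1 p.2 ≠ (1 : Matrix (Idx ε) (Idx ε) K) p.1 p.2}.Finite) :
    ∃ n₀, IsNearOne n₀ g := by
  refine ⟨hg.toFinset.sup fun p => max p.1.1.natAbs p.2.1.natAbs, fun i j h => ?_⟩
  by_contra h'
  have h1 : max i.1.natAbs j.1.natAbs ≤ _ := Finset.le_sup (f := fun p : Idx ε × Idx ε => max p.1.1.natAbs p.2.1.natAbs)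
    (hg.mem_toFinset.mpr (show (i, j) ∈ _ from h'))
  exact h ⟨abs_le.mpr ⟨by omega, by omega⟩, abs_le.mpr ⟨by omega, by omega⟩⟩

theorem IsNearOne.hermAdj (hq : q ≠ 0) {g : Matrix (Idx ε) (Idx ε) K} (hg : IsNearOne n₀ g) :
    IsNearOne n₀ (hermAdj q g) := by
  intro i j h
  rw [hermAdj_apply, hg]
  · by_cases hij : i = j
    · rw [hij, Matrix.one_apply_eq, Matrix.one_apply_eq, one_pow]
    · rw [Matrix.one_apply_ne hij, Matrix.one_apply_ne (fun h' => hij (neg_injective h').symm),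
        zero_pow hq]
  · rwa [Idx.coe_neg, Idx.coe_neg, abs_neg, abs_neg, and_comm]

end InfiniteProduct

/-! ### Invariance under the infinite unitary group -/

section Invariance

variable {ε : Fin 2} {q : ℕ} {K : Type*} [Field K] {n n₀ : ℕ}

theorem isNilpotent_conj {ι : Type*} [Fintype ι] [DecidableEq ι] {G H X : Matrix ι ι K}
    (hHG : H * G = 1) (hX : IsNilpotent X) : IsNilpotent (G * X * H) := by
  obtain ⟨k, hk⟩ := hX
  have h : ∀ j, (G * X * H) ^ (j + 1) = G * X ^ (j + 1) * H := by
    intro j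
    induction j with
    | zero => rw [zero_add, pow_one, pow_one]
    | succ j ih =>
      calc (G * X * H) ^ (j + 2) = G * X ^ (j + 1) * (H * G) * X * H := by
            rw [pow_succ, ih]
            simp only [Matrix.mul_assoc]
        _ = _ := by rw [hHG, Matrix.mul_one, pow_succ X (j + 1), Matrix.mul_assoc G]
  exact ⟨k + 1, by rw [h, pow_succ, hk, zero_mul, mul_zero, zero_mul]⟩

theorem blkMass_conj {G H X : Matrix (Blk ε n) (Blk ε n) K} (hGH : G * H = 1) (hHG : H * G = 1) :
    blkMass q (G * X * H) = blkMass q X := by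
  have h1 : IsNilpotent (G * X * H) ↔ IsNilpotent X := by
    refine ⟨fun h => ?_, isNilpotent_conj hHG⟩
    have h2 := isNilpotent_conj hGH h
    rwa [Matrix.mul_assoc, Matrix.mul_assoc, hHG, Matrix.mul_one, ← Matrix.mul_assoc, hHG,
      Matrix.one_mul] at h2
  have h2 : jordanMult (Matrix.toLin' (G * X * H)) = jordanMult (Matrix.toLin' X) := by
    refine jordanMult_conj (Matrix.toLin'OfInv hHG hGH) fun v => ?_
    change Matrix.toLin' G (Matrix.toLin' X v) = Matrix.toLin' (G * X * H) (Matrix.toLin' G v)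
    rw [← Matrix.toLin'_mul_apply, ← Matrix.toLin'_mul_apply, Matrix.mul_assoc (G * X), hHG,
      Matrix.mul_one]
  by_cases hX : IsNilpotent X
  · rw [blkMass, blkMass, if_pos (h1.mpr hX), if_pos hX, h2]
  · rw [blkMass, blkMass, if_neg (mt h1.mp hX), if_neg hX]

variable [Finite K] (hq : IsPrimePow q) (hK : Nat.card K = q ^ 2)
include hq hK

theorem conj_mem_LSet {g : Matrix (Idx ε) (Idx ε) K} (hg : IsNearOne n₀ g) (hn : n₀ ≤ n)
    {A : Matrix (Idx ε) (Idx ε) K} (hA : A ∈ LSet ε q K n) :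
    imul (imul (hermAdj q g) A) g ∈ LSet ε q K n := by
  refine ⟨fun i j => ?_, imul_right_pattern hg hn
    (imul_left_pattern (hg.hermAdj hq.ne_zero) hn hA.2)⟩
  obtain ⟨k, hk, hi, hj⟩ := exists_le_abs i j n₀
  have h := isSkewHermitian_conj hq hK (X := restr k A) (fun a b => hA.1 a.1 b.1) (restr k g)
  have h1 : restr k (imul (imul (hermAdj q g) A) g) =
      hermAdj q (restr k g) * restr k A * restr k g := by
    rw [restr_imul_right hg hk, restr_imul_left (hg.hermAdj hq.ne_zero) hk]
    rfl
  rw [← h1] at h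
  exact h ⟨i, hi⟩ ⟨j, hj⟩

/-- The conjugation `M ↦ g⁻¹ M g` of the space `L`. -/
def conjL {g : Matrix (Idx ε) (Idx ε) K} (hg : IsNearOne n₀ g) (M : LSpace ε q K) :
    LSpace ε q K :=
  ⟨imul (imul (hermAdj q g) M.1) g, (M.exists_mem_LSet n₀).choose,
    conj_mem_LSet hq hK hg (M.exists_mem_LSet n₀).choose_spec.1
      (M.exists_mem_LSet n₀).choose_spec.2⟩

theorem restr_conjL {g : Matrix (Idx ε) (Idx ε) K} (hg : IsNearOne n₀ g) (hn : n₀ ≤ n)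
    (M : LSpace ε q K) : restr n (conjL hq hK hg M).1 =
      restr n (hermAdj q g) * restr n M.1 * restr n g := by
  rw [conjL, restr_imul_right hg hn, restr_imul_left (hg.hermAdj hq.ne_zero) hn]

omit hq hK [Finite K] in
-- Preservation of the Hermitian form says that the adjoint of g is a left inverse; on finite blocks
-- it is then a two-sided inverse.
theorem restr_hermAdj_mul {g : Matrix (Idx ε) (Idx ε) K} (hg : IsNearOne n₀ g)
    (hu : g ∈ infUnitary ε q K) (hn : n₀ ≤ n) : restr n (hermAdj q g) * restr n g = 1 := by
  have h1 : imul (hermAdj q g) g = 1 := by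
    ext i j
    have h := hu.2 j (-i)
    rw [neg_neg] at h
    rw [imul_apply, Matrix.one_apply, ← if_congr eq_comm rfl rfl, ← h]
    exact finsum_congr fun r => mul_comm _ _
  rw [← restr_imul_right hg hn, h1]
  ext a b
  rw [restr_apply, Matrix.one_apply, Matrix.one_apply]
  exact if_congr Subtype.val_injective.eq_iff rfl rfl

omit hq hK [Finite K] in
theorem restr_mul_hermAdj {g : Matrix (Idx ε) (Idx ε) K} (hg : IsNearOne n₀ g)
    (hu : g ∈ infUnitary ε q K) (hn : n₀ ≤ n) : restr n g * restr n (hermAdj q g) = 1 :=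
  mul_eq_one_comm.mp (restr_hermAdj_mul hg hu hn)

theorem isConjBy_iff {g : Matrix (Idx ε) (Idx ε) K} (hg : IsNearOne n₀ g)
    (hu : g ∈ infUnitary ε q K) (M M' : LSpace ε q K) :
    IsConjBy g M M' ↔ M = conjL hq hK hg M' := by
  have h1 : IsConjBy g M M' ↔ imul M'.1 g = imul g M.1 :=
    ⟨fun h => Matrix.ext h, fun h i j => congrFun (congrFun h i) j⟩
  rw [h1]
  constructor
  · intro h
    refine Subtype.ext (ext_restr n₀ fun n hn => ?_)
    rw [restr_conjL hq hK hg hn, Matrix.mul_assoc, ← restr_imul_right hg hn, h,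
      restr_imul_left hg hn, ← Matrix.mul_assoc, restr_hermAdj_mul hg hu hn, Matrix.one_mul]
  · rintro rfl
    refine ext_restr n₀ fun n hn => ?_
    rw [restr_imul_right hg hn, restr_imul_left hg hn, restr_conjL hq hK hg hn, Matrix.mul_assoc,
      ← Matrix.mul_assoc, restr_mul_hermAdj hg hu hn, Matrix.one_mul]

theorem isSkewHermitian_conj_restr (g : Matrix (Idx ε) (Idx ε) K) (X : SkewMat ε q K n) :
    IsSkewHermitian q (restr n g * X.1 * restr n (hermAdj q g)) := by
  have h := isSkewHermitian_conj hq hK X.2 (restr n (hermAdj q g))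
  have h1 : hermAdj q (restr n (hermAdj q g)) = restr n g := hermAdj_hermAdj hK (restr n g)
  rwa [h1] at h

/-- From level n₀ on, conjugation by g preserves L_n and acts on the central block by conjugation
with the central block of g, so it permutes the cylinders. -/
theorem preimage_conjL_cyl {g : Matrix (Idx ε) (Idx ε) K} (hg : IsNearOne n₀ g)
    (hu : g ∈ infUnitary ε q K) (hn : n₀ ≤ n) (X : SkewMat ε q K n) :
    conjL hq hK hg ⁻¹' cyl q n X.1 = cyl q n (restr n g * X.1 * restr n (hermAdj q g)) := by
  have e (M : LSpace ε q K) : corner n (conjL hq hK hg M) =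
      restr n (hermAdj q g) * corner n M * restr n g := restr_conjL hq hK hg hn M
  have e1 := restr_hermAdj_mul hg hu hn
  have e2 := restr_mul_hermAdj hg hu hn
  ext M
  constructor
  · rintro ⟨h1, h2⟩
    refine ⟨?_, ?_⟩
    · have h3 := conj_mem_LSet hq hK (hg.hermAdj hq.ne_zero) hn h1
      convert h3 using 1
      refine ext_restr n₀ fun k hk => ?_
      rw [hermAdj_hermAdj hK, restr_imul_right (hg.hermAdj hq.ne_zero) hk, restr_imul_left hg hk,
        restr_conjL hq hK hg hk, Matrix.mul_assoc, Matrix.mul_assoc, Matrix.mul_assoc,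
        restr_mul_hermAdj hg hu hk, Matrix.mul_one, ← Matrix.mul_assoc,
        restr_mul_hermAdj hg hu hk, Matrix.one_mul]
    · rw [← h2, e, Matrix.mul_assoc, Matrix.mul_assoc, Matrix.mul_assoc, e2, Matrix.mul_one,
        ← Matrix.mul_assoc, e2, Matrix.one_mul]
  · rintro ⟨h1, h2⟩
    refine ⟨conj_mem_LSet hq hK hg hn h1, ?_⟩
    rw [e, h2, Matrix.mul_assoc, Matrix.mul_assoc, Matrix.mul_assoc, e1, Matrix.mul_one,
      ← Matrix.mul_assoc, e1, Matrix.one_mul]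

open MeasureTheory in
-- The image of P under M ↦ g⁻¹ M g has the same mass on every cylinder of high level, as similar
-- matrices have the same Jordan type. Hence it equals P. The set of conjugates of A is the preimage
-- of A under this map.
theorem isUnitarilyInvariant_of_cyl {P : Measure (LSpace ε q K)}
    (h : ∀ (n : ℕ) (X : SkewMat ε q K n), P (cyl q n X.1) = ENNReal.ofReal (blkMass q X.1)) :
    IsUnitarilyInvariant P := by
  intro g hu A hA
  obtain ⟨n₀, hg⟩ := exists_isNearOne hu.1
  have h1 : ∀ n, n₀ ≤ n → ∀ X : SkewMat ε q K n, conjL hq hK hg ⁻¹' cyl q n X.1 =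
      cyl q n (restr n g * X.1 * restr n (hermAdj q g)) :=
    fun n hn X => preimage_conjL_cyl hq hK hg hu hn X
  have hm : Measurable (conjL hq hK hg) := by
    refine Continuous.measurable ((isTopologicalBasis_cylFamily hq hK n₀).continuous_iff.mpr ?_)
    rintro _ ⟨n, hn, X, rfl⟩
    rw [h1 n hn X]
    exact isOpen_cyl _
  have h2 : P.map (conjL hq hK hg) = P := by
    refine measure_ext_cyl hq hK n₀ (fun n hn X => ?_) fun n _ X => h n X
    rw [Measure.map_apply hm (isOpen_cyl X.1).measurableSet, h1 n hn X,
      h n ⟨_, isSkewHermitian_conj_restr hq hK g X⟩,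
      blkMass_conj (restr_mul_hermAdj hg hu hn) (restr_hermAdj_mul hg hu hn)]
  have h3 : {M' | ∃ M ∈ A, IsConjBy g M M'} = conjL hq hK hg ⁻¹' A := by
    ext M'
    constructor
    · rintro ⟨M, hM, hc⟩
      rw [isConjBy_iff hq hK hg hu] at hc
      rwa [Set.mem_preimage, ← hc]
    · exact fun hM => ⟨_, hM, (isConjBy_iff hq hK hg hu _ _).mpr rfl⟩
  rw [h3, ← Measure.map_apply hm hA, h2]

end Invariance

end HLUnitary

end

theorem mainTheorem8 (ε : Fin 2) :
    ∃ Φ : HLUnitary.SymPar ε →ₗ[ℝ] ℝ,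
      -- the functional is well defined
      HLUnitary.IsPlancherelFunctional ε Φ ∧
      (∀ Φ' : HLUnitary.SymPar ε →ₗ[ℝ] ℝ, HLUnitary.IsPlancherelFunctional ε Φ' → Φ' = Φ) ∧
      -- `p₂`-harmonicity
      (∀ F : HLUnitary.SymPar ε, Φ (HLUnitary.pTwoMul ε F) = Φ F) ∧
      -- positivity on the cone, and strict positivity on its generators
      (∀ t : ℝ, -1 < t → t < 0 →
        (∀ F ∈ HLUnitary.hlCone t ε, 0 ≤ Φ F) ∧
        ∀ (n : ℕ) (lam : Nat.Partition (2 * n + ε)), 0 < Φ (HLUnitary.qTildePar t ε lam)) ∧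
      -- the associated invariant Radon measure on infinite skew-Hermitian matrices
      ∀ (q : ℕ), IsPrimePow q → Odd q →
        ∀ (K : Type*) [Field K] [Finite K], Nat.card K = q ^ 2 →
          ∃! P : MeasureTheory.Measure (HLUnitary.LSpace ε q K),
            MeasureTheory.IsFiniteMeasureOnCompacts P ∧
            HLUnitary.IsUnitarilyInvariant P ∧
            P (HLUnitary.pronilpotent ε q K)ᶜ = 0 ∧
            ∀ (n : ℕ) (X : Matrix (HLUnitary.Blk ε n) (HLUnitary.Blk ε n) K)
              (lam : Nat.Partition (2 * n + ε)),
              HLUnitary.IsSkewHermitian q X → HLUnitary.HasJordanType X lam →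
              P (HLUnitary.cyl q n X) =
                ENNReal.ofReal
                  ((q : ℝ) ^ ((HLUnitary.nStat lam : ℤ) - ((2 * n + ε : ℕ).choose 2 : ℤ)) /
                      (1 - (q : ℝ) ^ (-2 : ℤ)) ^ (((2 * n + ε : ℕ) : ℝ) / 2) *
                    Φ (HLUnitary.qTildePar (-(q : ℝ)⁻¹) ε lam)) := by
  refine ⟨HLUnitary.plancherel ε, HLUnitary.isPlancherelFunctional_plancherel ε,
    fun Φ' h => h.unique (HLUnitary.isPlancherelFunctional_plancherel ε),
    HLUnitary.plancherel_pTwoMul ε,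
    fun t h1 h2 => ⟨fun F hF => HLUnitary.plancherel_nonneg_of_mem_hlCone h1 h2 hF,
      fun n lam => HLUnitary.plancherel_qTildePar_pos h1 h2 ε lam⟩, ?_⟩
  intro q hq _ K _ _ hK
  obtain ⟨P, hP, hcyl⟩ := HLUnitary.exists_measure_cyl (ε := ε) hq hK
  refine ⟨P, ⟨hP, HLUnitary.isUnitarilyInvariant_of_cyl hq hK hcyl,
    HLUnitary.measure_compl_pronilpotent hcyl, fun n X lam hX hlam => ?_⟩, ?_⟩
  · rw [hcyl n ⟨X, hX⟩, hlam.blkMass_eq hq.one_lt]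
  -- The formula fixes the masses of cylinders with nilpotent block, and the support condition makes
  -- the others null; together these determine the measure.
  · rintro P' ⟨-, -, h0, h1⟩
    exact HLUnitary.measure_ext_cyl hq hK 0
      (fun n _ X => HLUnitary.measure_cyl_eq_blkMass hq.one_lt h0 h1 X) fun n _ X => hcyl n X
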